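/- Let $T>0$ and let $\Omega\subset\mathbb R^3$ be a bounded open set with Lipschitz boundary. Let $\rho^*\in C^1(\overline\Omega)$ be a time-independent function with $\rho^*>0$ in $\Omega$. Let $u\in L^2(0,T;(W^{1,2}_0(\Omega))^3)$, $\rho\in L^2((0,T)\times\Omega)$ and $\rho_0\in L^1_{\mathrm{loc}}(\Omega)$ satisfy $$\partial_t\rho+\operatorname{div}(\rho u)=0\quad\text{in }(0,T)\times\Omega,\qquad \rho(0)=\rho_0,$$ in the sense of distributions, that is, $$\int_0^T\!\!\int_\Omega\bigl(\rho\,\partial_t\varphi+\rho\,u\cdot\nabla\varphi\bigr)\,dx\,dt+\int_\Omega\rho_0\,\varphi(0,\cdot)\,dx=0\qquad\text{for all }\varphi\in C_c^\infty([0,T)\times\Omega).$$ Then the following two assertions are equivalent: (i) the distributional (spatial) divergence $\operatorname{div}(\rho^*u)$, which is a locally integrable function on $(0,T)\times\Omega$, vanishes a.e. on $\{(t,x)\in(0,T)\times\Omega:\ \rho(t,x)\ge\rho^*(x)\}$, and $0\le\rho_0\le\rho^*$ a.e. in $\Omega$; (ii) $0\le\rho(t,x)\le\rho^*(x)$ for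 a.e. $(t,x)\in(0,T)\times\Omega$. -/

import Mathlib

open MeasureTheory Set Filter Topology
open scoped ContDiff NNReal

namespace Congestion

/-- Three-dimensional Euclidean space. -/
abbrev E3 : Type := EuclideanSpace ℝ (Fin 3)

/-- `φ` is smooth with compact support contained in `U` (for open `U`: `φ ∈ C_c^∞(U)`). -/
structure IsTestFunction {X Y : Type*} [NormedAddCommGroup X] [NormedSpace ℝ X]
    [NormedAddCommGroup Y] [NormedSpace ℝ Y] (U : Set X) (φ : X → Y) : Prop where
  smooth : ContDiff ℝ ∞ φ
  compact_support : HasCompactSupport φ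
  support_subset : tsupport φ ⊆ U

/-- The space-time cylinder `(0,T) × Ω`. -/
def cylinder (T : ℝ) (Ω : Set E3) : Set (ℝ × E3) := Ioo 0 T ×ˢ Ω

/-- The boundary of `Ω` is Lipschitz: near each boundary point, in suitable orthonormal
coordinates, `Ω` is the part lying strictly above the graph of a Lipschitz function of the
first two coordinates. -/
def HasLipschitzBoundary (Ω : Set E3) : Prop :=
  ∀ x₀ ∈ frontier Ω,
    ∃ (e : E3 ≃ₗᵢ[ℝ] E3) (γ : EuclideanSpace ℝ (Fin 2) → ℝ) (K : ℝ≥0) (r : ℝ),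
      0 < r ∧ LipschitzWith K γ ∧
        ∀ x ∈ Metric.ball x₀ r, (x ∈ Ω ↔ γ !₂[e x 0, e x 1] < e x 2)

/-- `f ∈ C¹(closure Ω)`: `f` is `C¹` in the open set `Ω`, and `f` and its derivative extend
continuously to the closure. -/
def IsC1OnClosure (Ω : Set E3) (f : E3 → ℝ) : Prop :=
  ContDiffOn ℝ 1 f Ω ∧ ContinuousOn f (closure Ω) ∧
    ∃ G : E3 → E3 →L[ℝ] ℝ, ContinuousOn G (closure Ω) ∧ ∀ x ∈ Ω, fderiv ℝ f x = G x

/-- `G` is the weak (distributional) gradient of the vector field `v` in `Ω`. -/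
def HasWeakGradient (Ω : Set E3) (v : E3 → E3) (G : E3 → E3 →L[ℝ] E3) : Prop :=
  ∀ φ : E3 → ℝ, IsTestFunction Ω φ → ∀ w : E3,
    ∫ x in Ω, (fderiv ℝ φ x w) • v x = - ∫ x in Ω, φ x • G x w

/-- `v ∈ W₀^{1,2}(Ω)³` with weak gradient `G`: `v` and `G` are in `L²(Ω)`, and `v` is the limit in
the `W^{1,2}` norm of smooth vector fields with compact support in `Ω`. -/
structure IsW012 (Ω : Set E3) (v : E3 → E3) (G : E3 → E3 →L[ℝ] E3) : Prop where
  memLp : MemLp v 2 (volume.restrict Ω)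
  memLp_grad : MemLp G 2 (volume.restrict Ω)
  weak_grad : HasWeakGradient Ω v G
  approx : ∃ φ : ℕ → E3 → E3, (∀ n, IsTestFunction Ω (φ n)) ∧
    Tendsto (fun n => eLpNorm (fun x => φ n x - v x) 2 (volume.restrict Ω)) atTop (𝓝 0) ∧
    Tendsto (fun n => eLpNorm (fun x => fderiv ℝ (φ n) x - G x) 2 (volume.restrict Ω))
      atTop (𝓝 0)

/-- `u ∈ L²(0,T; W₀^{1,2}(Ω)³)`: `u` and its spatial weak gradient are (classes of) jointly
measurable functions, square integrable on `(0,T) × Ω`, and `u(t) ∈ W₀^{1,2}(Ω)³` for almost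
every `t`. -/
def MemL2W012 (T : ℝ) (Ω : Set E3) (u : ℝ → E3 → E3) : Prop :=
  MemLp (fun p : ℝ × E3 => u p.1 p.2) 2 (volume.restrict (cylinder T Ω)) ∧
  ∃ Du : ℝ → E3 → E3 →L[ℝ] E3,
    MemLp (fun p : ℝ × E3 => Du p.1 p.2) 2 (volume.restrict (cylinder T Ω)) ∧
    ∀ᵐ t ∂(volume.restrict (Ioo 0 T)), IsW012 Ω (u t) (Du t)

/-- `∂ₜρ + div(ρ u) = 0` in `(0,T) × Ω` in the sense of distributions, with `ρ(0) = ρ₀`.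
The test functions are the (restrictions to `t ≥ 0` of) smooth functions with compact support
in `(-∞,T) × Ω`, that is, those of `C_c^∞([0,T) × Ω)`. -/
def SolvesContinuityEquation (T : ℝ) (Ω : Set E3) (ρ : ℝ → E3 → ℝ) (u : ℝ → E3 → E3)
    (ρ₀ : E3 → ℝ) : Prop :=
  ∀ φ : ℝ × E3 → ℝ, IsTestFunction (Iio T ×ˢ Ω) φ →
    (∫ p in cylinder T Ω,
      (ρ p.1 p.2 * deriv (fun s => φ (s, p.2)) p.1
        + ρ p.1 p.2 * fderiv ℝ (fun y => φ (p.1, y)) p.2 (u p.1 p.2)))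
      + ∫ x in Ω, ρ₀ x * φ (0, x) = 0

/-- The locally integrable function `g` is the distributional spatial divergence of the
time-dependent vector field `v` in `(0,T) × Ω`. -/
def HasWeakDivergence (T : ℝ) (Ω : Set E3) (v : ℝ → E3 → E3) (g : ℝ → E3 → ℝ) : Prop :=
  LocallyIntegrableOn (fun p : ℝ × E3 => g p.1 p.2) (cylinder T Ω) ∧
  ∀ φ : ℝ × E3 → ℝ, IsTestFunction (cylinder T Ω) φ →
    ∫ p in cylinder T Ω, fderiv ℝ (fun y => φ (p.1, y)) p.2 (v p.1 p.2)
      = - ∫ p in cylinder T Ω, g p.1 p.2 * φ p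

end Congestion

namespace Congestion

open scoped ENNReal

/-! Put `w = ρ - ρ*` and `g = div(ρ* u)`. Since `ρ*` does not depend on time, the continuity
equation becomes `∂ₜw + div(w u) = -g`. Both implications come from renormalizing this equation: for
`b` of class `C¹`, Lipschitz and with `b 0 = 0`, `∂ₜ b(w) + div(b(w) u) + (w b'(w) - b(w)) div u =
-b'(w) g`.

For (i) ⇒ (ii), let `b` approximate the positive part. That function is homogeneous of degree one,
so `b(s) - s b'(s)` is uniformly small and the term with the unbounded factor `div u` disappears in
the limit. The source disappears because `b'(w)` lives on `{w > 0}`, where `g = 0`. Testing with `T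
- t` gives `∫∫ w⁺ = 0`, with no Gronwall argument. The same comparison applied to `-ρ`, with zero
source, gives `ρ ≥ 0` (`TransportSolution.ae_nonpos`).

For (ii) ⇒ (i), take `b(s) = ε arctan(s/ε)`. Both `b(s)` and `s b'(s)` are `O(ε)` uniformly, while
`b'` tends to the indicator of `{0}`. Only the source survives, so `g = 0` a.e. on `{w = 0}`
(`TransportSolution.ae_eq_zero_of_eq_zero`). Under (ii) this set is `{ρ ≥ ρ*}`. The bounds on `ρ₀`
follow because `t ↦ ∫ ρ ψ` agrees a.e. with a continuous function starting at `∫ ρ₀ ψ`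
(`ZeroExtension.initial_bounds`).

Renormalization is the DiPerna–Lions argument (`TransportSolution.renormalized`). Mollify in space
only; at each point the mollified solution is then absolutely continuous in time and the ordinary
chain rule applies. The commutator of mollification with transport converges in `L¹` because the
density and the velocity gradient are both in `L²` (`tendsto_lintegral_transportCommutator`).

To avoid boundary terms everything is extended by zero to the whole space
(`transportSolution_of_interior`). With cutoffs of gradient `O(1/δ)` in a boundary strip of width
`δ`, the error is `∫ ρ u·∇ζ`. A Poincaré inequality in the strip of the Lipschitz domain gives `‖u‖
≤ C δ ‖∇u‖` there, so the powers of `δ` cancel and the `L²` norm of `ρ` on the shrinking strip tends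
to zero. -/

/-! ### Absolutely continuous functions of time and weak time derivatives -/

theorem absolutelyContinuousOnInterval_comp_of_lipschitz {b f : ℝ → ℝ} {L : ℝ≥0} {x y : ℝ}
    (hb : LipschitzWith L b) (hf : AbsolutelyContinuousOnInterval f x y) :
    AbsolutelyContinuousOnInterval (fun t => b (f t)) x y := by
  rw [absolutelyContinuousOnInterval_iff] at hf ⊢
  intro ε hε
  -- Dividing by `L + 1` instead of `L` covers the case `L = 0`.
  obtain ⟨δ, hδ, h⟩ := hf (ε / (L + 1)) (by positivity)
  refine ⟨δ, hδ, fun E hE hlt => ?_⟩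
  have h1 := h E hE hlt
  have h2 : ∑ i ∈ Finset.range E.1, dist (b (f (E.2 i).1)) (b (f (E.2 i).2))
      ≤ (L + 1) * ∑ i ∈ Finset.range E.1, dist (f (E.2 i).1) (f (E.2 i).2) := by
    rw [Finset.mul_sum]
    refine Finset.sum_le_sum fun i _ => (hb.dist_le_mul _ _).trans ?_
    gcongr
    simp
  refine h2.trans_lt ?_
  rwa [lt_div_iff₀' (by positivity)] at h1

/-- Integrated chain rule for a function with integrable derivative, tested against `φ`. -/
theorem integral_chain_rule_of_primitive {T : ℝ} {F : ℝ → ℝ} {c : ℝ}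
    (hF : IntervalIntegrable F volume 0 T) {b b' : ℝ → ℝ} {L : ℝ≥0}
    (hb : ∀ x, HasDerivAt b (b' x) x) (hL : LipschitzWith L b) {φ : ℝ → ℝ}
    (hφ : ContDiff ℝ 1 φ) (hφT : φ T = 0) :
    ∫ t in (0 : ℝ)..T, (b (c + ∫ s in (0 : ℝ)..t, F s) * deriv φ t
      + b' (c + ∫ s in (0 : ℝ)..t, F s) * F t * φ t) = - (b c * φ 0) := by
  set f : ℝ → ℝ := fun t => c + ∫ s in (0 : ℝ)..t, F s with hf
  have hfac : AbsolutelyContinuousOnInterval f 0 T := by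
    have h0 : AbsolutelyContinuousOnInterval (fun _ : ℝ => c) 0 T :=
      (contDiff_const.contDiffOn (n := 1)).absolutelyContinuousOnInterval
    exact h0.add (hF.absolutelyContinuousOnInterval_intervalIntegral (c := 0) (by simp))
  -- As `F` is only integrable, `f` is differentiable only a.e. Absolute continuity of `b ∘ f` is
  -- what permits integration by parts, and the derivative is then needed only a.e.
  have hbf := absolutelyContinuousOnInterval_comp_of_lipschitz hL hfac
  have hφac : AbsolutelyContinuousOnInterval φ 0 T :=
    hφ.contDiffOn.absolutelyContinuousOnInterval
  have h := hbf.integral_deriv_mul_eq_sub hφac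
  have h0 : f 0 = c := by simp [hf]
  rw [hφT, h0, mul_zero, zero_sub] at h
  rw [← h]
  apply intervalIntegral.integral_congr_ae
  filter_upwards [hF.ae_hasDerivAt_integral] with t ht htm
  have hd : HasDerivAt f (F t) t := (ht (uIoc_subset_uIcc htm) 0 (by simp)).const_add c
  have := (hb (f t)).comp t hd
  have h3 : deriv (fun t => b (f t)) t = b' (f t) * F t := this.deriv
  rw [h3]
  ring

theorem exists_smooth_bump_Ioo {a b : ℝ} (hab : a < b) :
    ∃ θ : ℝ → ℝ, ContDiff ℝ ∞ θ ∧ HasCompactSupport θ ∧ tsupport θ ⊆ Icc a b ∧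
      (∀ x, 0 ≤ θ x) ∧ ∫ x, θ x = 1 := by
  let φ : ContDiffBump ((a + b) / 2) := ⟨(b - a) / 4, (b - a) / 2, by linarith, by linarith⟩
  refine ⟨φ.normed volume, φ.contDiff_normed, φ.hasCompactSupport_normed, ?_,
    fun x => φ.nonneg_normed x, φ.integral_normed⟩
  rw [φ.tsupport_normed_eq, Real.closedBall_eq_Icc]
  change Icc ((a + b) / 2 - (b - a) / 2) ((a + b) / 2 + (b - a) / 2) ⊆ _
  apply Icc_subset_Icc <;> linarith

/-- A test function on `(0,T)` is, on `[0, ∞)`, the derivative of a test function on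
`(-∞, T)`. -/
theorem exists_primitive_test {T : ℝ} (hT : 0 < T) {η : ℝ → ℝ} (hη : IsTestFunction (Ioo 0 T) η) :
    ∃ χ : ℝ → ℝ, IsTestFunction (Iio T) χ ∧ ∀ t, 0 ≤ t → deriv χ t = η t := by
  obtain ⟨θ, hθs, hθc, hθsupp, -, hθi⟩ := exists_smooth_bump_Ioo (show (-2 : ℝ) < -1 by norm_num)
  set c := ∫ x, η x
  -- The correction `c θ` makes the total integral vanish, so the primitive has compact support.
  -- Since `θ` lives in `[-2, -1]`, nothing changes for `t ≥ 0`.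
  set κ : ℝ → ℝ := fun t => η t - c * θ t with hκ
  have hκs : ContDiff ℝ ∞ κ := hη.smooth.sub (contDiff_const.mul hθs)
  have hκi : Integrable κ := (hη.smooth.continuous.integrable_of_hasCompactSupport
    hη.compact_support).sub ((hθs.continuous.integrable_of_hasCompactSupport hθc).const_mul c)
  have hκ0 : ∫ x, κ x = 0 := by
    rw [hκ, integral_sub (hη.smooth.continuous.integrable_of_hasCompactSupport
      hη.compact_support) ((hθs.continuous.integrable_of_hasCompactSupport hθc).const_mul c),
      integral_const_mul, hθi]
    simp [c]
  -- The base point `-3` lies to the left of both supports.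
  set χ : ℝ → ℝ := fun t => ∫ s in (-3 : ℝ)..t, κ s with hχ
  have hd : ∀ t, HasDerivAt χ (κ t) t := fun t =>
    intervalIntegral.integral_hasDerivAt_right (hκs.continuous.intervalIntegrable _ _)
      (hκs.continuous.stronglyMeasurableAtFilter _ _) hκs.continuous.continuousAt
  -- Compactness of the support inside the open interval leaves a gap between its last point and
  -- `T`; `χ` vanishes beyond that point.
  have hηne : ∃ M, 0 < M ∧ M < T ∧ ∀ t, M < t → η t = 0 := by
    rcases (tsupport η).eq_empty_or_nonempty with h | h
    · exact ⟨T / 2, by linarith, by linarith, fun t _ => by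
        rw [tsupport_eq_empty_iff.mp h]; rfl⟩
    · have hm := hη.compact_support.isCompact.sSup_mem h
      have hm' := hη.support_subset hm
      refine ⟨_, hm'.1, hm'.2, fun t ht => ?_⟩
      by_contra hne
      exact absurd (le_csSup hη.compact_support.isCompact.bddAbove
        (subset_tsupport η (Function.mem_support.mpr hne))) (not_le.mpr ht)
  obtain ⟨M, hM0, hMT, hM⟩ := hηne
  have hθ0 : ∀ t, t ∉ Icc (-2 : ℝ) (-1) → θ t = 0 := fun t ht =>
    image_eq_zero_of_notMem_tsupport (fun h => ht (hθsupp h))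
  have hη0 : ∀ t, t ≤ 0 → η t = 0 := fun t ht =>
    image_eq_zero_of_notMem_tsupport (fun h => absurd (hη.support_subset h).1 (not_lt.mpr ht))
  have hχ1 : ∀ t, t ≤ -3 → χ t = 0 := by
    intro t ht
    apply intervalIntegral.integral_zero_ae
    refine Filter.Eventually.of_forall fun s hs => ?_
    rw [uIoc_of_ge ht] at hs
    have hs3 : s ≤ -3 := hs.2
    simp only [hκ, hη0 s (by linarith), hθ0 s (fun h => by linarith [h.1])]
    ring
  have hχ2 : ∀ t, M ≤ t → χ t = 0 := by
    intro t ht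
    rw [hχ, ← hκ0]
    apply intervalIntegral.integral_eq_integral_of_support_subset
    intro s hs
    by_contra hsn
    apply hs
    have : η s = 0 ∧ θ s = 0 := by
      by_cases h : s ≤ -3
      · exact ⟨hη0 s (by linarith), hθ0 s (fun h' => by linarith [h'.1])⟩
      · have : t < s := by
          by_contra h'
          exact hsn ⟨by linarith, by linarith⟩
        exact ⟨hM s (by linarith), hθ0 s (fun h' => by linarith [h'.2])⟩
    simp [hκ, this.1, this.2]
  have hsupp : tsupport χ ⊆ Icc (-3) M := by
    apply closure_minimal _ isClosed_Icc
    intro t ht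
    by_contra hn
    apply ht
    by_cases h : t ≤ -3
    · exact hχ1 t h
    · exact hχ2 t (by by_contra h'; exact hn ⟨by linarith, by linarith⟩)
  refine ⟨χ, ⟨?_, ?_, fun t ht => ?_⟩, fun t ht => ?_⟩
  · rw [contDiff_infty_iff_deriv]
    refine ⟨fun t => (hd t).differentiableAt, ?_⟩
    rwa [show deriv χ = κ from funext fun t => (hd t).deriv]
  · exact HasCompactSupport.of_support_subset_isCompact isCompact_Icc
      ((subset_tsupport χ).trans hsupp)
  · exact lt_of_le_of_lt (hsupp ht).2 hMT
  · rw [(hd t).deriv]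
    simp [hκ, hθ0 t (fun h => by linarith [h.2])]

/-- A function whose distributional derivative on `[0, T)`, with initial value `c`, is the
integrable function `F`, is almost everywhere the primitive of `F` with value `c` at `0`. -/
theorem ae_eq_primitive_of_weak_deriv {T : ℝ} (hT : 0 < T) {f F : ℝ → ℝ} {c : ℝ}
    (hf : IntegrableOn f (Ioo 0 T)) (hF : IntegrableOn F (Ioo 0 T))
    (h : ∀ χ : ℝ → ℝ, IsTestFunction (Iio T) χ →
      (∫ t in Ioo 0 T, (deriv χ t * f t + χ t * F t)) + χ 0 * c = 0) :
    ∀ᵐ t ∂(volume.restrict (Ioo 0 T)), f t = c + ∫ s in (0 : ℝ)..t, F s := by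
  have hFi : IntervalIntegrable F volume 0 T := by
    rw [intervalIntegrable_iff_integrableOn_Ioo_of_le hT.le]; exact hF
  set P : ℝ → ℝ := fun t => ∫ s in (0 : ℝ)..t, F s with hP
  have hPac : AbsolutelyContinuousOnInterval P 0 T :=
    hFi.absolutelyContinuousOnInterval_intervalIntegral (c := 0) (by simp)
  have hPc : ContinuousOn P (Icc 0 T) := by
    have := hPac.continuousOn
    rwa [uIcc_of_le hT.le] at this
  have hPi : IntegrableOn P (Ioo 0 T) :=
    (hPc.integrableOn_Icc).mono_set Ioo_subset_Icc_self
  have hci : IntegrableOn (fun _ : ℝ => c) (Ioo 0 T) := integrableOn_const (by simp)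
  have hgi : IntegrableOn (fun t => f t - (c + P t)) (Ioo 0 T) := hf.sub (hci.add hPi)
  -- The fundamental lemma is applied to the difference of `f` and the candidate primitive. A test
  -- function `η` on `(0, T)` is written as `deriv χ`, which makes the weak equation available.
  have key := isOpen_Ioo.ae_eq_zero_of_integral_contDiff_smul_eq_zero (μ := volume)
    (hgi.locallyIntegrableOn) (U := Ioo 0 T) (f := fun t => f t - (c + P t)) ?_
  · rw [ae_restrict_iff' measurableSet_Ioo]
    filter_upwards [key] with t ht htm
    linarith [ht htm]
  intro η hη1 hη2 hη3
  obtain ⟨χ, hχ, hχd⟩ := exists_primitive_test hT ⟨hη1, hη2, hη3⟩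
  have hχT : χ T = 0 :=
    image_eq_zero_of_notMem_tsupport (fun h => absurd (hχ.support_subset h) (lt_irrefl T))
  have h1 := h χ hχ
  have hbd : ∀ {k p : ℝ → ℝ}, IntegrableOn p (Ioo 0 T) → Continuous k →
      HasCompactSupport k → IntegrableOn (fun t => k t * p t) (Ioo 0 T) := by
    intro k p hp hk hkc
    obtain ⟨C, hC⟩ := hkc.exists_bound_of_continuous hk
    exact hp.bdd_mul hk.aestronglyMeasurable (Filter.Eventually.of_forall hC)
  have hχ'c : Continuous (deriv χ) := hχ.smooth.continuous_deriv (by simp)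
  have hχ's : HasCompactSupport (deriv χ) := hχ.compact_support.deriv
  have hχac : AbsolutelyContinuousOnInterval χ 0 T :=
    (hχ.smooth.of_le (by exact_mod_cast le_top) : ContDiff ℝ 1 χ).contDiffOn.absolutelyContinuousOnInterval
  have h2 := hPac.integral_deriv_mul_eq_sub hχac
  have hP0 : P 0 = 0 := by simp [hP]
  rw [hχT, hP0, mul_zero, zero_mul, sub_zero] at h2
  -- `P` satisfies the same weak equation with initial value zero: the boundary terms vanish because
  -- `P 0 = 0` and `χ T = 0`.
  have h3 : ∫ t in Ioo 0 T, (deriv χ t * P t + χ t * F t) = 0 := by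
    rw [← integral_Ioc_eq_integral_Ioo, ← intervalIntegral.integral_of_le hT.le]
    refine Eq.trans ?_ h2
    apply intervalIntegral.integral_congr_ae
    filter_upwards [hFi.ae_hasDerivAt_integral] with t ht htm
    rw [(ht (uIoc_subset_uIcc htm) 0 (by simp)).deriv]
    ring
  have h4 : ∫ t in Ioo 0 T, deriv χ t = - χ 0 := by
    rw [← integral_Ioc_eq_integral_Ioo, ← intervalIntegral.integral_of_le hT.le,
      hχac.integral_deriv_eq_sub, hχT, zero_sub]
  rw [← setIntegral_eq_integral_of_forall_compl_eq_zero (s := Ioo 0 T)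
    (fun t ht => by simp [image_eq_zero_of_notMem_tsupport (fun h => ht (hη3 h))])]
  have h5 : ∫ t in Ioo 0 T, η t • (f t - (c + P t)) =
      ∫ t in Ioo 0 T, ((deriv χ t * f t + χ t * F t) - (deriv χ t * P t + χ t * F t)
        - c * deriv χ t) := by
    apply setIntegral_congr_fun measurableSet_Ioo
    intro t ht
    simp only [smul_eq_mul, ← hχd t ht.1.le]
    ring
  rw [h5, integral_sub, integral_sub, h3, integral_const_mul, h4]
  · linarith
  · exact (hbd hf hχ'c hχ's).add (hbd hF hχ.smooth.continuous hχ.compact_support)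
  · exact (hbd hPi hχ'c hχ's).add (hbd hF hχ.smooth.continuous hχ.compact_support)
  · exact ((hbd hf hχ'c hχ's).add (hbd hF hχ.smooth.continuous hχ.compact_support)).sub
      ((hbd hPi hχ'c hχ's).add (hbd hF hχ.smooth.continuous hχ.compact_support))
  · exact ((hχ'c.integrable_of_hasCompactSupport hχ's).integrableOn).const_mul c

/-! ### `H¹` vector fields: translation estimates and integration by parts -/

/-- The trace, as a continuous linear functional. -/
noncomputable def traceCLM : (E3 →L[ℝ] E3) →L[ℝ] ℝ :=
  ∑ i : Fin 3, (EuclideanSpace.proj (𝕜 := ℝ) i : E3 →L[ℝ] ℝ).comp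
    (ContinuousLinearMap.apply ℝ E3 (EuclideanSpace.single i (1 : ℝ)))

theorem traceCLM_apply (A : E3 →L[ℝ] E3) :
    traceCLM A = ∑ i : Fin 3, A (EuclideanSpace.single i (1 : ℝ)) i := by
  simp [traceCLM]

theorem exists_abs_traceCLM_le : ∃ c : ℝ, 0 ≤ c ∧ ∀ A : E3 →L[ℝ] E3, ‖traceCLM A‖ ≤ c * ‖A‖ :=
  ⟨_, norm_nonneg _, fun A => traceCLM.le_opNorm A⟩

/-- `v` is a limit of smooth compactly supported fields in `H¹(ℝ³)`, with gradient `G`. -/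
structure IsH1 (v : E3 → E3) (G : E3 → E3 →L[ℝ] E3) : Prop where
  memLp : MemLp v 2 volume
  memLp_grad : MemLp G 2 volume
  approx : ∃ φ : ℕ → E3 → E3, (∀ n, ContDiff ℝ ∞ (φ n) ∧ HasCompactSupport (φ n)) ∧
    Tendsto (fun n => eLpNorm (fun x => φ n x - v x) 2 volume) atTop (𝓝 0) ∧
    Tendsto (fun n => eLpNorm (fun x => fderiv ℝ (φ n) x - G x) 2 volume) atTop (𝓝 0)

theorem eLpNorm_two_sq {α F : Type*} [MeasurableSpace α] [NormedAddCommGroup F] {μ : Measure α}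
    (f : α → F) : eLpNorm f 2 μ ^ 2 = ∫⁻ x, ‖f x‖ₑ ^ 2 ∂μ := by
  have := eLpNorm_nnreal_pow_eq_lintegral (f := f) (μ := μ) (p := 2) (by norm_num)
  simpa using this

theorem eLpNorm_sub_translate {F : Type*} [NormedAddCommGroup F] {f : E3 → F}
    (hf : AEStronglyMeasurable f volume) (h : E3) :
    eLpNorm (fun x => f (x - h)) 2 volume = eLpNorm f 2 volume :=
  eLpNorm_comp_measurePreserving hf (measurePreserving_sub_right volume h)

/-- Translations are measure preserving and depend continuously on `h` as elements of `C(E3, E3)`;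
composition in `L²` is continuous along such families. -/
theorem tendsto_eLpNorm_translate_sub {F : Type*} [NormedAddCommGroup F] {f : E3 → F}
    (hf : MemLp f 2 volume) :
    Tendsto (fun h : E3 => eLpNorm (fun x => f (x - h) - f x) 2 volume) (𝓝 0) (𝓝 0) := by
  set g : E3 → C(E3, E3) := fun h => ⟨fun x => x - h, by fun_prop⟩ with hg
  have hgm : ∀ h, MeasurePreserving (g h) (volume : Measure E3) volume :=
    fun h => measurePreserving_sub_right volume h
  have hgc : Continuous g := by
    apply ContinuousMap.continuous_of_continuous_uncurry
    change Continuous fun p : E3 × E3 => p.2 - p.1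
    fun_prop
  have h1 : Tendsto (fun h => Lp.compMeasurePreserving (g h) (hgm h) (hf.toLp f)) (𝓝 0)
      (𝓝 (Lp.compMeasurePreserving (g 0) (hgm 0) (hf.toLp f))) :=
    Filter.Tendsto.compMeasurePreservingLp tendsto_const_nhds (hgc.tendsto 0) hgm (hgm 0)
      (by norm_num)
  have h2 := tendsto_iff_edist_tendsto_0.mp h1
  refine h2.congr fun h => ?_
  rw [Lp.edist_def]
  apply eLpNorm_congr_ae
  have e : ∀ k, (Lp.compMeasurePreserving (g k) (hgm k) (hf.toLp f) : E3 → F)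
      =ᵐ[volume] fun x => f (x - k) := by
    intro k
    refine (Lp.coeFn_compMeasurePreserving _ (hgm k)).trans ?_
    exact (hgm k).quasiMeasurePreserving.ae_eq_comp hf.coeFn_toLp
  filter_upwards [e h, e 0] with x h1 h2
  rw [Pi.sub_apply, h1, h2, sub_zero]

/-- The difference is the integral of the derivative along the segment. Jensen's inequality on the
unit interval, Tonelli and translation invariance then remove the dependence on the point of the
segment. -/
theorem eLpNorm_translate_sub_le_of_smooth {φ : E3 → E3} (hφ : ContDiff ℝ ∞ φ) (h : E3) :
    eLpNorm (fun x => φ (x - h) - φ x) 2 volume ≤ ‖h‖ₑ * eLpNorm (fderiv ℝ φ) 2 volume := by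
  have hc : Continuous (fderiv ℝ φ) := hφ.continuous_fderiv (by simp)
  have hpt : ∀ x, ‖φ (x - h) - φ x‖ₑ ^ 2 ≤
      ‖h‖ₑ ^ 2 * ∫⁻ s in Ioc (0 : ℝ) 1, ‖fderiv ℝ φ (x - s • h)‖ₑ ^ 2 := by
    intro x
    have hd : ∀ s : ℝ, HasDerivAt (fun s : ℝ => φ (x - s • h))
        (fderiv ℝ φ (x - s • h) (-h)) s := by
      intro s
      have h1 : HasDerivAt (fun s : ℝ => x - s • h) (-h) s := by
        simpa using ((hasDerivAt_id s).smul_const h).const_sub x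
      exact ((hφ.differentiable (by simp)) _).hasFDerivAt.comp_hasDerivAt s h1
    have hcs : Continuous fun s : ℝ => fderiv ℝ φ (x - s • h) (-h) := by fun_prop
    have hI := intervalIntegral.integral_eq_sub_of_hasDerivAt (a := (0 : ℝ)) (b := 1)
      (fun s _ => hd s) (hcs.intervalIntegrable _ _)
    simp only [one_smul, zero_smul, sub_zero] at hI
    rw [← hI, intervalIntegral.integral_of_le zero_le_one]
    have h2 : ‖∫ s in Ioc (0 : ℝ) 1, fderiv ℝ φ (x - s • h) (-h)‖ₑ ≤
        eLpNorm (fun s => fderiv ℝ φ (x - s • h) (-h)) 1 (volume.restrict (Ioc (0 : ℝ) 1)) := by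
      rw [eLpNorm_one_eq_lintegral_enorm]
      exact enorm_integral_le_lintegral_enorm _
    have : IsProbabilityMeasure (volume.restrict (Ioc (0 : ℝ) 1)) := ⟨by simp⟩
    have h3 := eLpNorm_le_eLpNorm_of_exponent_le (μ := volume.restrict (Ioc (0 : ℝ) 1))
      (p := 1) (q := 2) (by norm_num) hcs.aestronglyMeasurable
    calc _ ≤ eLpNorm (fun s => fderiv ℝ φ (x - s • h) (-h)) 2
          (volume.restrict (Ioc (0 : ℝ) 1)) ^ 2 := by gcongr; exact h2.trans h3
      _ = ∫⁻ s in Ioc (0 : ℝ) 1, ‖fderiv ℝ φ (x - s • h) (-h)‖ₑ ^ 2 := eLpNorm_two_sq _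
      _ ≤ ∫⁻ s in Ioc (0 : ℝ) 1, ‖h‖ₑ ^ 2 * ‖fderiv ℝ φ (x - s • h)‖ₑ ^ 2 := by
          refine lintegral_mono fun s => ?_
          rw [← mul_pow]
          gcongr
          refine (ContinuousLinearMap.le_opENorm _ _).trans ?_
          rw [enorm_neg, mul_comm]
      _ = _ := lintegral_const_mul _ (by fun_prop)
  rw [← ENNReal.pow_le_pow_left_iff (n := 2) (by norm_num), mul_pow, eLpNorm_two_sq,
    eLpNorm_two_sq]
  calc _ ≤ ∫⁻ x, ‖h‖ₑ ^ 2 * ∫⁻ s in Ioc (0 : ℝ) 1, ‖fderiv ℝ φ (x - s • h)‖ₑ ^ 2 :=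
        lintegral_mono hpt
    _ = ‖h‖ₑ ^ 2 * ∫⁻ x, ∫⁻ s in Ioc (0 : ℝ) 1, ‖fderiv ℝ φ (x - s • h)‖ₑ ^ 2 := by
        apply lintegral_const_mul
        apply Measurable.lintegral_prod_right' (f := fun p : E3 × ℝ =>
          ‖fderiv ℝ φ (p.1 - p.2 • h)‖ₑ ^ 2)
        exact (Continuous.measurable (by fun_prop))
    _ = ‖h‖ₑ ^ 2 * ∫⁻ s in Ioc (0 : ℝ) 1, ∫⁻ x, ‖fderiv ℝ φ (x - s • h)‖ₑ ^ 2 := by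
        rw [lintegral_lintegral_swap]
        exact (Continuous.aemeasurable (by fun_prop))
    _ = ‖h‖ₑ ^ 2 * ∫⁻ s in Ioc (0 : ℝ) 1, ∫⁻ x, ‖fderiv ℝ φ x‖ₑ ^ 2 := by
        congr 2
        ext s
        exact lintegral_sub_right_eq_self (fun x => ‖fderiv ℝ φ x‖ₑ ^ 2) _
    _ = _ := by simp

/-- Integration by parts for a `C¹` compactly supported function against a smooth field. -/
theorem integral_fderiv_apply_eq_neg_of_smooth {ψ : E3 → ℝ} (hψ : ContDiff ℝ 1 ψ)
    (hψc : HasCompactSupport ψ) {v : E3 → E3} (hv : ContDiff ℝ 1 v) :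
    ∫ x, fderiv ℝ ψ x (v x) = - ∫ x, ψ x * traceCLM (fderiv ℝ v x) := by
  have hψ' : Continuous (fderiv ℝ ψ) := hψ.continuous_fderiv (by simp)
  have hv' : Continuous (fderiv ℝ v) := hv.continuous_fderiv (by simp)
  have hvc := hv.continuous
  have hψ'c : HasCompactSupport (fderiv ℝ ψ) := hψc.fderiv ℝ
  have hcomp : ∀ i : Fin 3, ∀ x, fderiv ℝ (fun y => v y i) x (EuclideanSpace.single i 1)
      = fderiv ℝ v x (EuclideanSpace.single i 1) i := by
    intro i x
    have : HasFDerivAt (fun y => v y i)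
        ((EuclideanSpace.proj (𝕜 := ℝ) i : E3 →L[ℝ] ℝ).comp (fderiv ℝ v x)) x :=
      (EuclideanSpace.proj (𝕜 := ℝ) i : E3 →L[ℝ] ℝ).hasFDerivAt.comp x
        ((hv.differentiable (by simp)) x).hasFDerivAt
    rw [this.fderiv]; rfl
  have hvi : ∀ i : Fin 3, Continuous fun x => v x i := fun i => by fun_prop
  have hdvi : ∀ i : Fin 3, Continuous fun x => fderiv ℝ v x (EuclideanSpace.single i 1) i :=
    fun i => by fun_prop
  have hI1 : ∀ i : Fin 3, Integrable fun x => v x i * fderiv ℝ ψ x (EuclideanSpace.single i 1) :=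
    fun i => (Continuous.integrable_of_hasCompactSupport (by fun_prop)
      ((hψ'c.comp_left (g := fun A : E3 →L[ℝ] ℝ => A (EuclideanSpace.single i 1))
        (by simp)).mul_left))
  have hI2 : ∀ i : Fin 3, Integrable fun x =>
      fderiv ℝ v x (EuclideanSpace.single i 1) i * ψ x :=
    fun i => (Continuous.integrable_of_hasCompactSupport (by
      have := hψ.continuous; have := hdvi i; fun_prop) hψc.mul_left)
  have hI3 : ∀ i : Fin 3, Integrable fun x => v x i * ψ x :=
    fun i => (Continuous.integrable_of_hasCompactSupport (by
      have := hψ.continuous; fun_prop) hψc.mul_left)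
  have hparts : ∀ i : Fin 3, ∫ x, v x i * fderiv ℝ ψ x (EuclideanSpace.single i 1) =
      - ∫ x, fderiv ℝ v x (EuclideanSpace.single i 1) i * ψ x := by
    intro i
    have := integral_mul_fderiv_eq_neg_fderiv_mul_of_integrable (μ := (volume : Measure E3))
      (f := fun x => v x i) (g := ψ) (v := EuclideanSpace.single i 1)
      (by simpa only [hcomp] using hI2 i) (hI1 i) (hI3 i)
      (fun x _ => by
        have := (hv.differentiable (by simp)) x
        fun_prop) (fun x _ => (hψ.differentiable (by simp)) x)
    simpa only [hcomp] using this
  have hbasis : ∀ y : E3, y = ∑ i : Fin 3, y i • EuclideanSpace.single i (1 : ℝ) := by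
    intro y
    have := (EuclideanSpace.basisFun (Fin 3) ℝ).sum_repr y
    simpa using this.symm
  have e1 : ∀ x, fderiv ℝ ψ x (v x) =
      ∑ i : Fin 3, v x i * fderiv ℝ ψ x (EuclideanSpace.single i 1) := by
    intro x
    conv_lhs => rw [hbasis (v x)]
    simp
  have e2 : ∀ x, ψ x * traceCLM (fderiv ℝ v x) =
      ∑ i : Fin 3, fderiv ℝ v x (EuclideanSpace.single i 1) i * ψ x := by
    intro x
    rw [traceCLM_apply, mul_comm, Finset.sum_mul]
  simp_rw [e1, e2]
  rw [integral_finsetSum _ fun i _ => hI1 i, integral_finsetSum _ fun i _ => hI2 i,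
    ← Finset.sum_neg_distrib]
  exact Finset.sum_congr rfl fun i _ => hparts i

theorem lintegral_enorm_mul_enorm_le {α F F' : Type*} [MeasurableSpace α] {μ : Measure α}
    [NormedAddCommGroup F] [NormedAddCommGroup F'] {a : α → F} {b : α → F'}
    (ha : AEStronglyMeasurable a μ) (hb : AEStronglyMeasurable b μ) :
    ∫⁻ x, ‖a x‖ₑ * ‖b x‖ₑ ∂μ ≤ eLpNorm a 2 μ * eLpNorm b 2 μ := by
  have h := ENNReal.lintegral_mul_le_Lp_mul_Lq μ (p := 2) (q := 2)
    (by constructor <;> norm_num) ha.enorm hb.enorm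
  rw [eLpNorm_eq_lintegral_rpow_enorm_toReal (by norm_num) (by norm_num),
    eLpNorm_eq_lintegral_rpow_enorm_toReal (by norm_num) (by norm_num)]
  simpa using h

theorem integrable_of_enorm_le_mul {α F F' F'' : Type*} [MeasurableSpace α] {μ : Measure α}
    [NormedAddCommGroup F] [NormedAddCommGroup F'] [NormedAddCommGroup F'']
    {a : α → F} {b : α → F'} {c : α → F''} (ha : MemLp a 2 μ) (hb : MemLp b 2 μ)
    (hc : AEStronglyMeasurable c μ) (h : ∀ x, ‖c x‖ ≤ ‖a x‖ * ‖b x‖) : Integrable c μ := by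
  refine ⟨hc, ?_⟩
  refine lt_of_le_of_lt (lintegral_mono fun x => ?_)
    ((lintegral_enorm_mul_enorm_le ha.1 hb.1).trans_lt (ENNReal.mul_lt_top ha.2 hb.2))
  rw [← ofReal_norm, ← ofReal_norm, ← ofReal_norm, ← ENNReal.ofReal_mul (norm_nonneg _)]
  exact ENNReal.ofReal_le_ofReal (h x)

theorem tendsto_integral_of_lintegral_enorm_sub {α F : Type*} [MeasurableSpace α]
    {μ : Measure α} [NormedAddCommGroup F] [NormedSpace ℝ F] {f : ℕ → α → F} {g : α → F}
    (hf : ∀ n, Integrable (f n) μ) (hg : Integrable g μ)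
    (h : Tendsto (fun n => ∫⁻ x, ‖f n x - g x‖ₑ ∂μ) atTop (𝓝 0)) :
    Tendsto (fun n => ∫ x, f n x ∂μ) atTop (𝓝 (∫ x, g x ∂μ)) :=
  tendsto_integral_of_L1 g hg.1 (Filter.Eventually.of_forall hf) h

theorem eq_of_tendsto_zero_mul {C : ℝ≥0∞} (hC : C ≠ ⊤) {a : ℕ → ℝ≥0∞}
    (ha : Tendsto a atTop (𝓝 0)) : Tendsto (fun n => C * a n) atTop (𝓝 0) := by
  simpa using ENNReal.Tendsto.const_mul ha (Or.inr hC)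

theorem memLp_of_smooth {F : Type*} [NormedAddCommGroup F] {φ : E3 → F} (hφ : Continuous φ)
    (hc : HasCompactSupport φ) : MemLp φ 2 volume :=
  hφ.memLp_of_hasCompactSupport hc

theorem eLpNorm_le_add_eLpNorm_sub {α F : Type*} [MeasurableSpace α] [NormedAddCommGroup F]
    {μ : Measure α} {f g : α → F} (hf : AEStronglyMeasurable f μ)
    (hg : AEStronglyMeasurable g μ) :
    eLpNorm g 2 μ ≤ eLpNorm f 2 μ + eLpNorm (fun x => g x - f x) 2 μ := by
  have e : g = f + fun x => g x - f x := by ext1 x; simp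
  calc eLpNorm g 2 μ = eLpNorm (f + fun x => g x - f x) 2 μ := by rw [← e]
    _ ≤ _ := eLpNorm_add_le hf (hg.sub hf) (by norm_num)

theorem eLpNorm_apply_le {α F F' : Type*} [MeasurableSpace α] [NormedAddCommGroup F]
    [NormedSpace ℝ F] [NormedAddCommGroup F'] [NormedSpace ℝ F'] {μ : Measure α}
    (A : α → F →L[ℝ] F') (h : F) :
    eLpNorm (fun x => A x h) 2 μ ≤ ‖h‖ₑ * eLpNorm A 2 μ := by
  have := eLpNorm_le_nnreal_smul_eLpNorm_of_ae_le_mul (f := fun x => A x h) (g := A) (μ := μ)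
    (c := ‖h‖₊) (Filter.Eventually.of_forall fun x => by
      rw [mul_comm]; exact ContinuousLinearMap.le_opNNNorm _ _) 2
  simpa [ENNReal.smul_def, enorm_eq_nnnorm] using this

namespace IsH1

variable {v : E3 → E3} {G : E3 → E3 →L[ℝ] E3}

/-- The smooth estimate passes to the limit: replacing `v` by an approximant costs the approximation
error twice, once for `v` and once for its translate. -/
theorem eLpNorm_translate_sub_le (hv : IsH1 v G) (h : E3) :
    eLpNorm (fun x => v (x - h) - v x) 2 volume ≤ ‖h‖ₑ * eLpNorm G 2 volume := by
  obtain ⟨φ, hφ, h1, h2⟩ := hv.approx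
  have hφm : ∀ n, AEStronglyMeasurable (φ n) (volume : Measure E3) :=
    fun n => (hφ n).1.continuous.aestronglyMeasurable
  have hφ'm : ∀ n, AEStronglyMeasurable (fderiv ℝ (φ n)) (volume : Measure E3) :=
    fun n => ((hφ n).1.continuous_fderiv (by simp)).aestronglyMeasurable
  have hmp := measurePreserving_sub_right (volume : Measure E3) h
  have hbound : ∀ n, eLpNorm (fun x => v (x - h) - v x) 2 volume ≤
      2 * eLpNorm (fun x => φ n x - v x) 2 volume + ‖h‖ₑ *
        (eLpNorm G 2 volume + eLpNorm (fun x => fderiv ℝ (φ n) x - G x) 2 volume) := by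
    intro n
    have hw : AEStronglyMeasurable (fun x => φ n x - v x) volume := (hφm n).sub hv.memLp.1
    have hws : AEStronglyMeasurable (fun x => φ n (x - h) - v (x - h)) volume :=
      hw.comp_measurePreserving hmp
    have hφs : AEStronglyMeasurable (fun x => φ n (x - h)) volume :=
      (hφm n).comp_measurePreserving hmp
    have e : (fun x => v (x - h) - v x) = ((fun x => φ n x - v x) -
        (fun x => φ n (x - h) - v (x - h))) + (fun x => φ n (x - h) - φ n x) := by
      ext1 x
      simp only [Pi.add_apply, Pi.sub_apply]
      abel
    rw [e]
    refine (eLpNorm_add_le (hw.sub hws) (hφs.sub (hφm n)) (by norm_num)).trans ?_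
    gcongr
    · refine (eLpNorm_sub_le hw hws (by norm_num)).trans ?_
      rw [eLpNorm_sub_translate hw, two_mul]
    · refine (eLpNorm_translate_sub_le_of_smooth (hφ n).1 h).trans ?_
      gcongr
      exact eLpNorm_le_add_eLpNorm_sub hv.memLp_grad.1 (hφ'm n)
  have hlim : Tendsto (fun n => 2 * eLpNorm (fun x => φ n x - v x) 2 volume + ‖h‖ₑ *
      (eLpNorm G 2 volume + eLpNorm (fun x => fderiv ℝ (φ n) x - G x) 2 volume)) atTop
      (𝓝 (2 * 0 + ‖h‖ₑ * (eLpNorm G 2 volume + 0))) :=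
    (ENNReal.Tendsto.const_mul h1 (by simp)).add
      (ENNReal.Tendsto.const_mul (tendsto_const_nhds.add h2) (by simp))
  refine (ge_of_tendsto' hlim hbound).trans ?_
  simp

/-- Needed to apply the translation estimate to the error `v - ψ` of a smooth approximation, whose
gradient is small in `L²`. -/
theorem sub_smooth (hv : IsH1 v G) {ψ : E3 → E3} (hψ : ContDiff ℝ ∞ ψ)
    (hψc : HasCompactSupport ψ) : IsH1 (fun x => v x - ψ x) (fun x => G x - fderiv ℝ ψ x) := by
  obtain ⟨φ, hφ, h1, h2⟩ := hv.approx
  refine ⟨hv.memLp.sub (memLp_of_smooth hψ.continuous hψc), hv.memLp_grad.sub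
    (memLp_of_smooth (hψ.continuous_fderiv (by simp)) (hψc.fderiv ℝ)),
    fun n x => φ n x - ψ x, fun n => ⟨(hφ n).1.sub hψ, (hφ n).2.sub hψc⟩, ?_, ?_⟩
  · simpa only [sub_sub_sub_cancel_right] using h1
  · refine h2.congr fun n => ?_
    congr 1
    ext1 x
    rw [fderiv_fun_sub ((hφ n).1.differentiable (by simp) x) (hψ.differentiable (by simp) x),
      sub_sub_sub_cancel_right]

/-- `h ↦ v(· - h)` is differentiable at `0` in `L²`. -/
theorem eLpNorm_translate_sub_add_le (hv : IsH1 v G) {τ : ℝ≥0∞} (hτ : τ ≠ 0) :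
    ∃ δ > 0, ∀ h : E3, ‖h‖ < δ →
      eLpNorm (fun x => v (x - h) - v x + G x h) 2 volume ≤ τ * ‖h‖ₑ := by
  obtain ⟨φ, hφ, -, h2⟩ := hv.approx
  -- A quarter for each of three errors: translation of `v - ψ`, the gradient difference applied to
  -- `h`, and the first-order Taylor remainder of the smooth field `ψ`.
  have hτ4 : 0 < τ / 4 := ENNReal.div_pos hτ (by norm_num)
  obtain ⟨n, hn⟩ := ((tendsto_order.1 h2).2 _ hτ4).exists
  set ψ := φ n
  obtain ⟨hψ, hψc⟩ := hφ n
  have hψ' : Continuous (fderiv ℝ ψ) := hψ.continuous_fderiv (by simp)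
  have hψ'c : HasCompactSupport (fderiv ℝ ψ) := hψc.fderiv ℝ
  -- For `‖h‖ < 1` the Taylor remainder is supported in this fixed compact set, so a uniform bound
  -- on it becomes an `L²` bound at the cost of `volume K ^ (1 / 2)`.
  set K : Set E3 := Metric.cthickening 1 (tsupport ψ) with hK
  have hKc : IsCompact K := hψc.isCompact.cthickening
  have hKvol : volume K ^ (1 / 2 : ℝ) ≠ ⊤ :=
    ENNReal.rpow_ne_top_of_nonneg (by norm_num) hKc.measure_lt_top.ne
  obtain ⟨c, hc0, hc⟩ : ∃ c : ℝ, 0 < c ∧ ENNReal.ofReal c * volume K ^ (1 / 2 : ℝ) ≤ τ / 4 := by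
    rcases eq_or_ne τ ⊤ with rfl | hτt
    · exact ⟨1, one_pos, by simp [ENNReal.top_div]⟩
    · set M := (volume K ^ (1 / 2 : ℝ)).toReal
      refine ⟨(τ / 4).toReal / (M + 1), ?_, ?_⟩
      · have : 0 < (τ / 4).toReal := ENNReal.toReal_pos hτ4.ne'
          (ENNReal.div_lt_top hτt (by norm_num)).ne
        positivity
      · rw [← ENNReal.ofReal_toReal hKvol, ← ENNReal.ofReal_mul (by positivity)]
        conv_rhs => rw [← ENNReal.ofReal_toReal (ENNReal.div_lt_top hτt (by norm_num)).ne]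
        apply ENNReal.ofReal_le_ofReal
        rw [div_mul_eq_mul_div, div_le_iff₀ (by positivity)]
        gcongr
        linarith
  obtain ⟨δ, hδ0, hδ⟩ := Metric.uniformContinuous_iff.mp
    (hψ'c.uniformContinuous_of_continuous hψ') c hc0
  refine ⟨min δ 1, by positivity, fun h hh => ?_⟩
  have hhδ : ‖h‖ < δ := hh.trans_le (min_le_left _ _)
  have hh1 : ‖h‖ < 1 := hh.trans_le (min_le_right _ _)
  have hpt : ∀ x, ‖ψ (x - h) - ψ x + fderiv ℝ ψ x h‖ ≤ c * ‖h‖ := by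
    intro x
    have := (convex_segment (x - h) x).norm_image_sub_le_of_norm_hasFDerivWithin_le'
      (f := ψ) (f' := fderiv ℝ ψ) (φ := fderiv ℝ ψ x) (C := c)
      (fun y _ => ((hψ.differentiable (by simp)) y).hasFDerivAt.hasFDerivWithinAt)
      (fun y hy => by
        rw [← dist_eq_norm]
        refine (hδ ?_).le
        exact Metric.mem_ball.mp ((convex_ball x δ).segment_subset
          (by simpa using hhδ) (Metric.mem_ball_self hδ0) hy)) (right_mem_segment ℝ _ _) (left_mem_segment ℝ _ _)
    simpa using this
  have hsupp : ∀ x, x ∉ K → ψ (x - h) - ψ x + fderiv ℝ ψ x h = 0 := by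
    intro x hx
    have hx1 : x ∉ tsupport ψ := fun h' => hx (Metric.self_subset_cthickening _ h')
    have hx2 : x - h ∉ tsupport ψ := fun h' => hx
      (Metric.mem_cthickening_of_dist_le x (x - h) 1 _ h' (by simpa using hh1.le))
    rw [image_eq_zero_of_notMem_tsupport hx1, image_eq_zero_of_notMem_tsupport hx2,
      image_eq_zero_of_notMem_tsupport (f := fderiv ℝ ψ)
        (fun h' => hx1 (tsupport_fderiv_subset ℝ h'))]
    simp
  have hsm : eLpNorm (fun x => ψ (x - h) - ψ x + fderiv ℝ ψ x h) 2 volume ≤ τ / 4 * ‖h‖ₑ := by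
    calc _ ≤ eLpNorm (K.indicator fun _ => c * ‖h‖) 2 volume := by
          refine eLpNorm_mono fun x => ?_
          by_cases hx : x ∈ K
          · rw [indicator_of_mem hx, Real.norm_of_nonneg (by positivity)]
            exact hpt x
          · rw [hsupp x hx]
            simp
      _ ≤ ‖c * ‖h‖‖ₑ * volume K ^ (1 / (2 : ℝ≥0∞).toReal) := eLpNorm_indicator_const_le _ _
      _ = ENNReal.ofReal c * volume K ^ (1 / 2 : ℝ) * ‖h‖ₑ := by
          rw [enorm_mul, enorm_norm, Real.enorm_of_nonneg hc0.le]
          simp only [ENNReal.toReal_ofNat]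
          ring
      _ ≤ _ := by gcongr
  have hd := hv.sub_smooth hψ hψc
  have hd1 := hd.eLpNorm_translate_sub_le h
  have hns : eLpNorm (fun x => G x - fderiv ℝ ψ x) 2 volume ≤ τ / 4 := by
    rw [← eLpNorm_neg]
    refine le_trans (le_of_eq ?_) hn.le
    congr 1
    ext1 x
    simp [ψ]
  have hmp := measurePreserving_sub_right (volume : Measure E3) h
  have hm1 : AEStronglyMeasurable (fun x => (v (x - h) - ψ (x - h)) - (v x - ψ x)) volume :=
    (hd.memLp.1.comp_measurePreserving hmp).sub hd.memLp.1
  have happ : ∀ {A : E3 → E3 →L[ℝ] E3}, AEStronglyMeasurable A volume →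
      AEStronglyMeasurable (fun x => A x h) volume := fun hA =>
    (ContinuousLinearMap.apply ℝ E3 h).continuous.comp_aestronglyMeasurable hA
  have hm2 : AEStronglyMeasurable (fun x => (G x - fderiv ℝ ψ x) h) volume :=
    happ hd.memLp_grad.1
  have hm3 : AEStronglyMeasurable (fun x => ψ (x - h) - ψ x + fderiv ℝ ψ x h) volume := by
    have := hψ.continuous
    exact Continuous.aestronglyMeasurable (by fun_prop)
  have e : (fun x => v (x - h) - v x + G x h) =
      ((fun x => (v (x - h) - ψ (x - h)) - (v x - ψ x)) + fun x => (G x - fderiv ℝ ψ x) h)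
        + (fun x => ψ (x - h) - ψ x + fderiv ℝ ψ x h) := by
    ext1 x
    simp only [Pi.add_apply, sub_apply]
    abel
  rw [e]
  refine (eLpNorm_add_le (hm1.add hm2) hm3 (by norm_num)).trans ?_
  have h3 : eLpNorm (fun x => (G x - fderiv ℝ ψ x) h) 2 volume ≤ ‖h‖ₑ * (τ / 4) :=
    (eLpNorm_apply_le _ h).trans (by gcongr)
  have h4 : eLpNorm (fun x => (v (x - h) - ψ (x - h)) - (v x - ψ x)) 2 volume ≤
      ‖h‖ₑ * (τ / 4) := hd1.trans (by gcongr)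
  have h5 := (eLpNorm_add_le hm1 hm2 (by norm_num)).trans (add_le_add h4 h3)
  refine (add_le_add h5 hsm).trans ?_
  calc (‖h‖ₑ * (τ / 4) + ‖h‖ₑ * (τ / 4)) + τ / 4 * ‖h‖ₑ = 3 * (τ / 4 * ‖h‖ₑ) := by ring
    _ ≤ 4 * (τ / 4 * ‖h‖ₑ) := by gcongr; norm_num
    _ = 4 * (τ / 4) * ‖h‖ₑ := by ring
    _ = τ * ‖h‖ₑ := by rw [ENNReal.mul_div_cancel (by norm_num) (by norm_num)]

/-- Both sides are continuous in the approximating sequence, so the smooth case suffices. The test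
function is only `C¹` because it will be `b` of a mollified density times a cutoff, with `b` only
`C¹`. -/
theorem integral_fderiv_apply_eq_neg (hv : IsH1 v G) {ψ : E3 → ℝ} (hψ : ContDiff ℝ 1 ψ)
    (hψc : HasCompactSupport ψ) :
    ∫ x, fderiv ℝ ψ x (v x) = - ∫ x, ψ x * traceCLM (G x) := by
  obtain ⟨φ, hφ, h1, h2⟩ := hv.approx
  have hψ' : MemLp (fderiv ℝ ψ) 2 volume :=
    memLp_of_smooth (hψ.continuous_fderiv (by simp)) (hψc.fderiv ℝ)
  obtain ⟨c, hc0, hc⟩ := exists_abs_traceCLM_le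
  have hψL : MemLp (fun x => c * ψ x) 2 volume :=
    (memLp_of_smooth hψ.continuous hψc).const_mul _
  have hφL : ∀ n, MemLp (φ n) 2 volume :=
    fun n => memLp_of_smooth (hφ n).1.continuous (hφ n).2
  have hφL' : ∀ n, MemLp (fderiv ℝ (φ n)) 2 volume :=
    fun n => memLp_of_smooth ((hφ n).1.continuous_fderiv (by simp)) ((hφ n).2.fderiv ℝ)
  have hm1 : ∀ {w : E3 → E3}, MemLp w 2 volume →
      AEStronglyMeasurable (fun x => fderiv ℝ ψ x (w x)) volume := fun hw =>
    isBoundedBilinearMap_apply.continuous.comp_aestronglyMeasurable (hψ'.1.prodMk hw.1)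
  have hm2 : ∀ {w : E3 → E3 →L[ℝ] E3}, MemLp w 2 volume →
      AEStronglyMeasurable (fun x => ψ x * traceCLM (w x)) volume := fun hw =>
    hψ.continuous.aestronglyMeasurable.mul (traceCLM.continuous.comp_aestronglyMeasurable hw.1)
  have hi1 : ∀ {w : E3 → E3}, MemLp w 2 volume →
      Integrable (fun x => fderiv ℝ ψ x (w x)) volume := fun hw =>
    integrable_of_enorm_le_mul hψ' hw (hm1 hw) fun x => ContinuousLinearMap.le_opNorm _ _
  have hb2 : ∀ x (A : E3 →L[ℝ] E3), ‖ψ x * traceCLM A‖ ≤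
      ‖c * ψ x‖ * ‖A‖ := fun x A => by
    rw [norm_mul, norm_mul, Real.norm_of_nonneg hc0, mul_comm c, mul_assoc]
    gcongr
    exact hc A
  have hi2 : ∀ {w : E3 → E3 →L[ℝ] E3}, MemLp w 2 volume →
      Integrable (fun x => ψ x * traceCLM (w x)) volume := fun hw =>
    integrable_of_enorm_le_mul hψL hw (hm2 hw) fun x => hb2 x _
  have hl1 : Tendsto (fun n => ∫ x, fderiv ℝ ψ x (φ n x)) atTop
      (𝓝 (∫ x, fderiv ℝ ψ x (v x))) := by
    apply tendsto_integral_of_lintegral_enorm_sub (fun n => hi1 (hφL n)) (hi1 hv.memLp)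
    refine tendsto_of_tendsto_of_tendsto_of_le_of_le tendsto_const_nhds
      (eq_of_tendsto_zero_mul hψ'.2.ne h1) (fun _ => zero_le) fun n => ?_
    refine le_trans (lintegral_mono fun x => ?_)
      (lintegral_enorm_mul_enorm_le hψ'.1 ((hφL n).sub hv.memLp).1)
    rw [← map_sub]
    exact ContinuousLinearMap.le_opENorm _ _
  have hl2 : Tendsto (fun n => ∫ x, ψ x * traceCLM (fderiv ℝ (φ n) x)) atTop
      (𝓝 (∫ x, ψ x * traceCLM (G x))) := by
    apply tendsto_integral_of_lintegral_enorm_sub (fun n => hi2 (hφL' n)) (hi2 hv.memLp_grad)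
    refine tendsto_of_tendsto_of_tendsto_of_le_of_le tendsto_const_nhds
      (eq_of_tendsto_zero_mul hψL.2.ne h2) (fun _ => zero_le) fun n => ?_
    refine le_trans (lintegral_mono fun x => ?_)
      (lintegral_enorm_mul_enorm_le hψL.1 ((hφL' n).sub hv.memLp_grad).1)
    rw [← mul_sub, ← map_sub, ← ofReal_norm, ← ofReal_norm, ← ofReal_norm,
      ← ENNReal.ofReal_mul (norm_nonneg _)]
    exact ENNReal.ofReal_le_ofReal (hb2 x _)
  refine tendsto_nhds_unique hl1 (hl2.neg.congr fun n => ?_)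
  exact (integral_fderiv_apply_eq_neg_of_smooth hψ hψc
    ((hφ n).1.of_le (by exact_mod_cast le_top))).symm

end IsH1

/-! ### Mollification and the DiPerna–Lions commutator -/

/-- A fixed smooth bump function supported in the unit ball. -/
noncomputable def unitBump : ContDiffBump (0 : E3) := ⟨1 / 2, 1, by norm_num, by norm_num⟩

/-- The standard mollifier at scale `ε`. -/
noncomputable def mollifier (ε : ℝ) (x : E3) : ℝ :=
  (ε ^ 3)⁻¹ * unitBump.normed volume (ε⁻¹ • x)

theorem mollifier_contDiff (ε : ℝ) : ContDiff ℝ ∞ (mollifier ε) :=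
  contDiff_const.mul (unitBump.contDiff_normed.comp (contDiff_const_smul _))

theorem mollifier_nonneg {ε : ℝ} (hε : 0 < ε) (x : E3) : 0 ≤ mollifier ε x :=
  mul_nonneg (by positivity) (unitBump.nonneg_normed _)

theorem tsupport_mollifier_subset {ε : ℝ} (hε : 0 < ε) :
    tsupport (mollifier ε) ⊆ Metric.closedBall 0 ε := by
  apply closure_minimal _ Metric.isClosed_closedBall
  intro x hx
  by_contra hn
  apply hx
  have : unitBump.normed volume (ε⁻¹ • x) = 0 := by
    rw [← Function.notMem_support, unitBump.support_normed_eq]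
    intro h'
    apply hn
    rw [mem_ball_zero_iff, norm_smul, norm_inv, Real.norm_of_nonneg hε.le] at h'
    change ε⁻¹ * ‖x‖ < 1 at h'
    rw [mem_closedBall_zero_iff]
    rw [inv_mul_lt_iff₀ hε, mul_one] at h'
    exact h'.le
  simp [mollifier, this]

theorem mollifier_hasCompactSupport {ε : ℝ} (hε : 0 < ε) : HasCompactSupport (mollifier ε) :=
  HasCompactSupport.of_support_subset_isCompact (isCompact_closedBall 0 ε)
    ((subset_tsupport _).trans (tsupport_mollifier_subset hε))

theorem continuous_fderiv_mollifier (ε : ℝ) : Continuous (fderiv ℝ (mollifier ε)) :=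
  (mollifier_contDiff ε).continuous_fderiv (by simp)

theorem integral_mollifier {ε : ℝ} (hε : 0 < ε) : ∫ x, mollifier ε x = 1 := by
  unfold mollifier
  rw [integral_const_mul, Measure.integral_comp_inv_smul volume (unitBump.normed volume) ε,
    unitBump.integral_normed]
  have : Module.finrank ℝ E3 = 3 := by simp
  rw [this, abs_of_pos (by positivity)]
  simp [hε.ne']

theorem lintegral_enorm_mollifier {ε : ℝ} (hε : 0 < ε) : ∫⁻ x, ‖mollifier ε x‖ₑ = 1 := by
  have h := ofReal_integral_eq_lintegral_ofReal
    ((mollifier_contDiff ε).continuous.integrable_of_hasCompactSupport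
      (mollifier_hasCompactSupport hε) (μ := volume))
    (Filter.Eventually.of_forall (mollifier_nonneg hε))
  rw [integral_mollifier hε, ENNReal.ofReal_one] at h
  rw [h]
  exact lintegral_congr fun x => Real.enorm_of_nonneg (mollifier_nonneg hε x)

/-- Scale invariance: the gradient is `O(ε⁻⁴)`, `‖h‖ ≤ ε` on the support, and the support has volume
`O(ε³)`. -/
theorem exists_lintegral_fderiv_mollifier_le : ∃ C : ℝ≥0∞, C ≠ ⊤ ∧ ∀ ε : ℝ, 0 < ε →
    ∫⁻ h, ‖fderiv ℝ (mollifier ε) h‖ₑ * ‖h‖ₑ ≤ C := by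
  have hs : ContDiff ℝ ∞ (unitBump.normed (volume : Measure E3)) := unitBump.contDiff_normed
  obtain ⟨M, hM⟩ := (unitBump.hasCompactSupport_normed.fderiv ℝ).exists_bound_of_continuous
    (hs.continuous_fderiv (by simp) : Continuous (fderiv ℝ (unitBump.normed (volume : Measure E3))))
  have hM0 : 0 ≤ M := (norm_nonneg _).trans (hM 0)
  refine ⟨ENNReal.ofReal M * volume (Metric.closedBall (0 : E3) 1),
    ENNReal.mul_ne_top ENNReal.ofReal_ne_top (isCompact_closedBall _ _).measure_lt_top.ne,
    fun ε hε => ?_⟩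
  have hd : ∀ x, ‖fderiv ℝ (mollifier ε) x‖ ≤ (ε ^ 3)⁻¹ * (M * ε⁻¹) := by
    intro x
    have h1 : HasFDerivAt (mollifier ε) ((ε ^ 3)⁻¹ •
        (fderiv ℝ (unitBump.normed (volume : Measure E3)) (ε⁻¹ • x)).comp
          (ε⁻¹ • ContinuousLinearMap.id ℝ E3)) x :=
      (((hs.differentiable (by simp)) _).hasFDerivAt.comp x
        ((hasFDerivAt_id x).const_smul ε⁻¹)).const_mul _
    rw [h1.fderiv, norm_smul, Real.norm_of_nonneg (by positivity)]
    gcongr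
    refine (ContinuousLinearMap.opNorm_comp_le _ _).trans ?_
    gcongr
    · exact hM _
    · rw [norm_smul, norm_inv, Real.norm_of_nonneg hε.le]
      exact mul_le_of_le_one_right (by positivity) ContinuousLinearMap.norm_id_le
  have hpt : ∀ h, ‖fderiv ℝ (mollifier ε) h‖ₑ * ‖h‖ₑ ≤
      (Metric.closedBall (0 : E3) ε).indicator (fun _ => ENNReal.ofReal ((ε ^ 3)⁻¹ * M)) h := by
    intro h
    by_cases hh : h ∈ Metric.closedBall (0 : E3) ε
    · rw [indicator_of_mem hh, ← ofReal_norm, ← ofReal_norm, ← ENNReal.ofReal_mul (norm_nonneg _)]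
      apply ENNReal.ofReal_le_ofReal
      rw [mem_closedBall_zero_iff] at hh
      calc _ ≤ (ε ^ 3)⁻¹ * (M * ε⁻¹) * ε := by gcongr; exact hd h
        _ = _ := by field_simp
    · have : fderiv ℝ (mollifier ε) h = 0 := image_eq_zero_of_notMem_tsupport fun h' => hh
        (tsupport_mollifier_subset hε (tsupport_fderiv_subset ℝ h'))
      simp [this, enorm_eq_nnnorm]
  calc _ ≤ ∫⁻ h, (Metric.closedBall (0 : E3) ε).indicator
        (fun _ => ENNReal.ofReal ((ε ^ 3)⁻¹ * M)) h := lintegral_mono hpt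
    _ = ENNReal.ofReal ((ε ^ 3)⁻¹ * M) * volume (Metric.closedBall (0 : E3) ε) := by
        rw [lintegral_indicator measurableSet_closedBall, setLIntegral_const]
    _ = ENNReal.ofReal ((ε ^ 3)⁻¹ * M) *
        (ENNReal.ofReal (ε ^ 3) * volume (Metric.closedBall (0 : E3) 1)) := by
        rw [Measure.addHaar_closedBall' _ _ hε.le]
        simp
    _ = _ := by
        rw [← mul_assoc, ← ENNReal.ofReal_mul (by positivity)]
        congr 2
        field_simp
    _ ≤ _ := le_rfl

/-- These first moments of the kernel gradient do not depend on `ε`; they are the reason why the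
commutator tends to `f` times the divergence. -/
theorem integral_fderiv_mollifier_apply {ε : ℝ} (hε : 0 < ε) (A : E3 →L[ℝ] E3) :
    ∫ h, fderiv ℝ (mollifier ε) h (A h) = - traceCLM A := by
  rw [integral_fderiv_apply_eq_neg_of_smooth ((mollifier_contDiff ε).of_le
    (by exact_mod_cast le_top)) (mollifier_hasCompactSupport hε) A.contDiff]
  simp_rw [A.fderiv]
  rw [integral_mul_const, integral_mollifier hε, one_mul]

/-- Mollification of `f` at scale `ε`. -/
noncomputable def mollify (ε : ℝ) (f : E3 → ℝ) (x : E3) : ℝ :=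
  ∫ h, mollifier ε h * f (x - h)

/-- The DiPerna–Lions commutator of mollification and transport by `v`. -/
noncomputable def transportCommutator (ε : ℝ) (f : E3 → ℝ) (v : E3 → E3) (x : E3) : ℝ :=
  ∫ h, f (x - h) * fderiv ℝ (mollifier ε) h (v (x - h) - v x)

theorem memLp_sub_left {F : Type*} [NormedAddCommGroup F] {f : E3 → F} (hf : MemLp f 2 volume)
    (x : E3) : MemLp (fun h => f (x - h)) 2 volume :=
  hf.comp_measurePreserving (Measure.measurePreserving_sub_left volume x)

theorem memLp_mollifier {ε : ℝ} (hε : 0 < ε) : MemLp (mollifier ε) 2 volume :=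
  memLp_of_smooth (mollifier_contDiff ε).continuous (mollifier_hasCompactSupport hε)

theorem integrable_mollifier_mul {ε : ℝ} (hε : 0 < ε) {f : E3 → ℝ} (hf : MemLp f 2 volume)
    (x : E3) : Integrable (fun h => mollifier ε h * f (x - h)) :=
  integrable_of_enorm_le_mul (memLp_mollifier hε) (memLp_sub_left hf x)
    ((memLp_mollifier hε).1.mul (memLp_sub_left hf x).1) fun _ => (norm_mul _ _).le

/-- Tonelli form of Minkowski's inequality for kernels. -/
theorem lintegral_enorm_integral_le {q : E3 → E3 → ℝ} (hq : Measurable (Function.uncurry q)) :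
    ∫⁻ x, ‖∫ h, q x h‖ₑ ≤ ∫⁻ h, ∫⁻ x, ‖q x h‖ₑ := by
  rw [← lintegral_lintegral_swap (by exact hq.enorm.aemeasurable)]
  exact lintegral_mono fun x => enorm_integral_le_lintegral_enorm _

/-- Mollified functions are only ever estimated after multiplication by a fixed `L²` weight `H`.
Tonelli in `h` and Cauchy–Schwarz in `x` are then enough. -/
theorem lintegral_enorm_mollify_mul_le {ε : ℝ} (hε : 0 < ε) {f : E3 → ℝ}
    (hf : MemLp f 2 volume) (hfm : Measurable f) {H : E3 → ℝ}
    (hH : MemLp H 2 volume) (hHm : Measurable H) :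
    ∫⁻ x, ‖mollify ε f x * H x‖ₑ ≤ eLpNorm f 2 volume * eLpNorm H 2 volume := by
  have hmm := (mollifier_contDiff ε).continuous.measurable
  calc ∫⁻ x, ‖mollify ε f x * H x‖ₑ = ∫⁻ x, ‖∫ h, mollifier ε h * f (x - h) * H x‖ₑ := by
        simp_rw [integral_mul_const]; rfl
    _ ≤ ∫⁻ h, ∫⁻ x, ‖mollifier ε h * f (x - h) * H x‖ₑ :=
        lintegral_enorm_integral_le (by fun_prop)
    _ ≤ ∫⁻ h, ‖mollifier ε h‖ₑ * (eLpNorm f 2 volume * eLpNorm H 2 volume) := by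
        refine lintegral_mono fun h => ?_
        simp_rw [mul_assoc, enorm_mul]
        rw [lintegral_const_mul _ (by fun_prop)]
        gcongr
        rw [← eLpNorm_sub_translate hf.1 h]
        exact lintegral_enorm_mul_enorm_le (hfm.comp (measurable_sub_const h)).aestronglyMeasurable
          hH.1
    _ = _ := by
        rw [lintegral_mul_const _ (by fun_prop), lintegral_enorm_mollifier hε, one_mul]

theorem lintegral_mollify_sub_mul_le {ε : ℝ} (hε : 0 < ε) {f : E3 → ℝ} (hf : MemLp f 2 volume)
    (hfm : Measurable f) {H : E3 → ℝ} (hH : MemLp H 2 volume) (hHm : Measurable H)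
    {τ : ℝ≥0∞} (hτ : ∀ h : E3, ‖h‖ ≤ ε → eLpNorm (fun x => f (x - h) - f x) 2 volume ≤ τ) :
    ∫⁻ x, ‖mollify ε f x * H x - f x * H x‖ₑ ≤ τ * eLpNorm H 2 volume := by
  have hmm := (mollifier_contDiff ε).continuous.measurable
  calc ∫⁻ x, ‖mollify ε f x * H x - f x * H x‖ₑ
      = ∫⁻ x, ‖∫ h, mollifier ε h * (f (x - h) - f x) * H x‖ₑ := by
        refine lintegral_congr fun x => ?_
        congr 1
        simp_rw [mul_sub]
        rw [integral_mul_const, integral_sub (integrable_mollifier_mul hε hf x)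
          (((mollifier_contDiff ε).continuous.integrable_of_hasCompactSupport
            (mollifier_hasCompactSupport hε)).mul_const _), integral_mul_const,
          integral_mollifier hε, one_mul, sub_mul]
        rfl
    _ ≤ ∫⁻ h, ∫⁻ x, ‖mollifier ε h * (f (x - h) - f x) * H x‖ₑ :=
        lintegral_enorm_integral_le (by fun_prop)
    _ ≤ ∫⁻ h, ‖mollifier ε h‖ₑ * (τ * eLpNorm H 2 volume) := by
        refine lintegral_mono fun h => ?_
        by_cases hh : ‖h‖ ≤ ε
        · simp_rw [mul_assoc, enorm_mul]
          rw [lintegral_const_mul _ (by fun_prop)]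
          gcongr
          refine (lintegral_enorm_mul_enorm_le
            ((hfm.comp (measurable_sub_const h)).sub hfm).aestronglyMeasurable hH.1).trans ?_
          gcongr
          exact hτ h hh
        · have : mollifier ε h = 0 := image_eq_zero_of_notMem_tsupport fun h' => hh
            (mem_closedBall_zero_iff.mp (tsupport_mollifier_subset hε h'))
          simp [this]
    _ = _ := by
        rw [lintegral_mul_const _ (by fun_prop), lintegral_enorm_mollifier hε, one_mul]

theorem tendsto_lintegral_mollify_mul {ε : ℕ → ℝ} (hε : ∀ n, 0 < ε n)
    (hε0 : Tendsto ε atTop (𝓝 0)) {f : E3 → ℝ} (hf : MemLp f 2 volume)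
    (hfm : Measurable f) {H : E3 → ℝ} (hH : MemLp H 2 volume) (hHm : Measurable H) :
    Tendsto (fun n => ∫⁻ x, ‖mollify (ε n) f x * H x - f x * H x‖ₑ) atTop (𝓝 0) := by
  have h0 : Tendsto (fun t : ℝ≥0∞ => t * eLpNorm H 2 volume) (𝓝 0) (𝓝 0) := by
    simpa using ENNReal.Tendsto.mul_const (tendsto_id (α := ℝ≥0∞) (x := 𝓝 0)) (Or.inr hH.2.ne)
  rw [ENNReal.tendsto_nhds_zero]
  intro c hc
  obtain ⟨τ, hτ0, hτ⟩ : ∃ τ : ℝ≥0∞, 0 < τ ∧ τ * eLpNorm H 2 volume ≤ c := by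
    have := ((ENNReal.tendsto_nhds_zero.mp h0 c hc).filter_mono
      (nhdsWithin_le_nhds (s := Ioi 0))).and self_mem_nhdsWithin
    obtain ⟨τ, h1, h2⟩ := this.exists
    exact ⟨τ, h2, h1⟩
  obtain ⟨δ, hδ0, hδ⟩ := Metric.eventually_nhds_iff.mp
    (ENNReal.tendsto_nhds_zero.mp (tendsto_eLpNorm_translate_sub hf) τ hτ0)
  filter_upwards [(tendsto_order.1 hε0).2 δ hδ0] with n hn
  exact (lintegral_mollify_sub_mul_le (hε n) hf hfm hH hHm fun h hh =>
    hδ (by simpa using hh.trans_lt hn)).trans hτ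

theorem integrable_commutator_kernel {ε : ℝ} (hε : 0 < ε) {f : E3 → ℝ} (hf : MemLp f 2 volume)
    {v : E3 → E3} (hv : MemLp v 2 volume) (x : E3) :
    Integrable (fun h => f (x - h) * fderiv ℝ (mollifier ε) h (v (x - h))) := by
  obtain ⟨M, hM⟩ := ((mollifier_hasCompactSupport hε).fderiv ℝ).exists_bound_of_continuous
    (continuous_fderiv_mollifier ε)
  have hm : AEStronglyMeasurable (fun h => fderiv ℝ (mollifier ε) h (v (x - h))) volume :=
    isBoundedBilinearMap_apply.continuous.comp_aestronglyMeasurable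
      ((continuous_fderiv_mollifier ε).aestronglyMeasurable.prodMk (memLp_sub_left hv x).1)
  refine integrable_of_enorm_le_mul (memLp_sub_left hf x)
    ((memLp_sub_left hv x).const_smul M) ((memLp_sub_left hf x).1.mul hm) fun h => ?_
  rw [norm_mul, Pi.smul_apply, norm_smul]
  gcongr
  refine (ContinuousLinearMap.le_opNorm _ _).trans ?_
  gcongr
  exact (hM h).trans (le_abs_self M)

theorem integrable_commutator_kernel_const {ε : ℝ} (hε : 0 < ε) {f : E3 → ℝ}
    (hf : MemLp f 2 volume) (a : E3) (x : E3) :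
    Integrable (fun h => f (x - h) * fderiv ℝ (mollifier ε) h a) := by
  have hc : MemLp (fun h => fderiv ℝ (mollifier ε) h a) 2 volume :=
    memLp_of_smooth (by have := continuous_fderiv_mollifier ε; fun_prop)
      (((mollifier_hasCompactSupport hε).fderiv ℝ).comp_left
        (g := fun A : E3 →L[ℝ] ℝ => A a) (by simp))
  exact integrable_of_enorm_le_mul (memLp_sub_left hf x) hc ((memLp_sub_left hf x).1.mul hc.1)
    fun _ => (norm_mul _ _).le

theorem measurable_fderiv_mollifier_apply {α : Type*} [MeasurableSpace α] {ε : ℝ}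
    {p : α → E3} {q : α → E3} (hp : Measurable p) (hq : Measurable q) :
    Measurable fun a => fderiv ℝ (mollifier ε) (p a) (q a) :=
  (isBoundedBilinearMap_apply (𝕜 := ℝ) (E := E3) (F := ℝ)).continuous.measurable.comp
    (((continuous_fderiv_mollifier ε).measurable.comp hp).prodMk hq)

/-- The velocity increment costs `‖h‖` times the norm of the gradient, and this factor `‖h‖`
compensates the singularity of the kernel gradient. The bound is uniform in `ε`. -/
theorem lintegral_transportCommutator_le {C : ℝ≥0∞} {ε : ℝ}
    (hC : ∫⁻ h, ‖fderiv ℝ (mollifier ε) h‖ₑ * ‖h‖ₑ ≤ C) {f : E3 → ℝ}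
    (hfm : Measurable f) {v : E3 → E3} {G : E3 → E3 →L[ℝ] E3} (hvm : Measurable v)
    (hv : IsH1 v G) :
    ∫⁻ x, ‖transportCommutator ε f v x‖ₑ ≤ C * (eLpNorm f 2 volume * eLpNorm G 2 volume) := by
  have hmm := (continuous_fderiv_mollifier ε).measurable
  calc _ ≤ ∫⁻ h, ∫⁻ x, ‖f (x - h) * fderiv ℝ (mollifier ε) h (v (x - h) - v x)‖ₑ := by
        refine lintegral_enorm_integral_le ?_
        refine Measurable.mul (by fun_prop) ?_
        exact measurable_fderiv_mollifier_apply (by fun_prop) (by fun_prop)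
    _ ≤ ∫⁻ h, ‖fderiv ℝ (mollifier ε) h‖ₑ * ‖h‖ₑ *
          (eLpNorm f 2 volume * eLpNorm G 2 volume) := by
        refine lintegral_mono fun h => ?_
        calc _ ≤ ∫⁻ x, ‖fderiv ℝ (mollifier ε) h‖ₑ * (‖f (x - h)‖ₑ * ‖v (x - h) - v x‖ₑ) := by
              refine lintegral_mono fun x => ?_
              rw [enorm_mul, mul_left_comm]
              gcongr
              exact ContinuousLinearMap.le_opENorm _ _
          _ ≤ ‖fderiv ℝ (mollifier ε) h‖ₑ * (eLpNorm f 2 volume * (‖h‖ₑ * eLpNorm G 2 volume)) := by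
              rw [lintegral_const_mul _ (by fun_prop)]
              gcongr
              refine (lintegral_enorm_mul_enorm_le
                (hfm.comp (measurable_sub_const h)).aestronglyMeasurable
                ((hvm.comp (measurable_sub_const h)).sub hvm).aestronglyMeasurable).trans ?_
              refine mul_le_mul' ?_ (hv.eLpNorm_translate_sub_le h)
              exact (eLpNorm_sub_translate hfm.aestronglyMeasurable h).le
          _ = _ := by ring
    _ ≤ _ := by
        rw [lintegral_mul_const _ (by fun_prop)]
        gcongr

/-- By the first-moment identity, `-f x * traceCLM (G x)` equals the integral of `f x` times the
kernel gradient at `h` applied to `G x h`. Putting it under the integral leaves `f (x - h)` times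
the first-order remainder of `v`, minus `f (x - h) - f x` times `G x h`; each is small relative to
`‖h‖`. -/
theorem lintegral_transportCommutator_sub_le {C : ℝ≥0∞} {ε : ℝ} (hε : 0 < ε)
    (hC : ∫⁻ h, ‖fderiv ℝ (mollifier ε) h‖ₑ * ‖h‖ₑ ≤ C) {f : E3 → ℝ} (hf : MemLp f 2 volume)
    (hfm : Measurable f) {v : E3 → E3} {G : E3 → E3 →L[ℝ] E3} (hvm : Measurable v)
    (hGm : Measurable G) (hv : IsH1 v G) {τ : ℝ≥0∞}
    (hτ : ∀ h : E3, ‖h‖ ≤ ε → eLpNorm (fun x => f (x - h) - f x) 2 volume ≤ τ)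
    (hτ' : ∀ h : E3, ‖h‖ ≤ ε →
      eLpNorm (fun x => v (x - h) - v x + G x h) 2 volume ≤ τ * ‖h‖ₑ) :
    ∫⁻ x, ‖transportCommutator ε f v x - f x * traceCLM (G x)‖ₑ ≤
      C * ((eLpNorm f 2 volume + eLpNorm G 2 volume) * τ) := by
  have hmm := (continuous_fderiv_mollifier ε).measurable
  have hGh : Measurable fun p : E3 × E3 => G p.1 p.2 :=
    (isBoundedBilinearMap_apply (𝕜 := ℝ) (E := E3) (F := E3)).continuous.measurable.comp
      ((hGm.comp measurable_fst).prodMk measurable_snd)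
  have hGx : ∀ h, Measurable fun x => G x h := fun h =>
    hGh.comp (measurable_id.prodMk measurable_const)
  calc ∫⁻ x, ‖transportCommutator ε f v x - f x * traceCLM (G x)‖ₑ
      = ∫⁻ x, ‖∫ h, (f (x - h) * fderiv ℝ (mollifier ε) h (v (x - h) - v x)
          + f x * fderiv ℝ (mollifier ε) h (G x h))‖ₑ := by
        refine lintegral_congr fun x => ?_
        congr 1
        rw [integral_add, integral_const_mul, integral_fderiv_mollifier_apply hε]
        · simp only [transportCommutator]
          ring
        · simp_rw [map_sub, mul_sub]
          exact (integrable_commutator_kernel hε hf hv.memLp x).sub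
            (integrable_commutator_kernel_const hε hf _ x)
        · refine Integrable.const_mul (Continuous.integrable_of_hasCompactSupport ?_ ?_) _
          · have := continuous_fderiv_mollifier ε
            fun_prop
          · refine HasCompactSupport.of_support_subset_isCompact
              (mollifier_hasCompactSupport hε).isCompact fun h hh => ?_
            by_contra hn
            apply hh
            beta_reduce
            rw [image_eq_zero_of_notMem_tsupport (f := fderiv ℝ (mollifier ε))
              (fun h' => hn (tsupport_fderiv_subset ℝ h'))]
            simp
    _ ≤ ∫⁻ h, ∫⁻ x, ‖f (x - h) * fderiv ℝ (mollifier ε) h (v (x - h) - v x)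
          + f x * fderiv ℝ (mollifier ε) h (G x h)‖ₑ := by
        refine lintegral_enorm_integral_le ?_
        refine Measurable.add (Measurable.mul (by fun_prop) ?_) (Measurable.mul (by fun_prop) ?_)
        · exact measurable_fderiv_mollifier_apply (by fun_prop) (by fun_prop)
        · exact measurable_fderiv_mollifier_apply (by fun_prop) hGh
    _ ≤ ∫⁻ h, ‖fderiv ℝ (mollifier ε) h‖ₑ * ‖h‖ₑ *
          ((eLpNorm f 2 volume + eLpNorm G 2 volume) * τ) := by
        refine lintegral_mono fun h => ?_
        by_cases hh : ‖h‖ ≤ ε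
        · calc _ ≤ ∫⁻ x, ‖fderiv ℝ (mollifier ε) h‖ₑ * (‖f (x - h)‖ₑ * ‖v (x - h) - v x + G x h‖ₑ
                  + ‖f (x - h) - f x‖ₑ * ‖G x h‖ₑ) := by
                refine lintegral_mono fun x => ?_
                have e : f (x - h) * fderiv ℝ (mollifier ε) h (v (x - h) - v x)
                    + f x * fderiv ℝ (mollifier ε) h (G x h) =
                    f (x - h) * fderiv ℝ (mollifier ε) h (v (x - h) - v x + G x h)
                    - (f (x - h) - f x) * fderiv ℝ (mollifier ε) h (G x h) := by
                  rw [map_add]; ring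
                rw [e]
                refine enorm_sub_le.trans ?_
                rw [enorm_mul, enorm_mul, mul_add, mul_left_comm, mul_left_comm _ ‖f (x - h) - f x‖ₑ]
                gcongr
                · exact ContinuousLinearMap.le_opENorm _ _
                · exact ContinuousLinearMap.le_opENorm _ _
            _ ≤ ‖fderiv ℝ (mollifier ε) h‖ₑ * (eLpNorm f 2 volume * (τ * ‖h‖ₑ)
                  + τ * (‖h‖ₑ * eLpNorm G 2 volume)) := by
                have := hGx h
                rw [lintegral_const_mul _ (by fun_prop), lintegral_add_left (by fun_prop)]
                gcongr
                · refine (lintegral_enorm_mul_enorm_le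
                    (hfm.comp (measurable_sub_const h)).aestronglyMeasurable
                    (((hvm.comp (measurable_sub_const h)).sub hvm).add
                      this).aestronglyMeasurable).trans ?_
                  exact mul_le_mul' (eLpNorm_sub_translate hfm.aestronglyMeasurable h).le (hτ' h hh)
                · refine (lintegral_enorm_mul_enorm_le
                    ((hfm.comp (measurable_sub_const h)).sub hfm).aestronglyMeasurable
                    this.aestronglyMeasurable).trans ?_
                  exact mul_le_mul' (hτ h hh) (eLpNorm_apply_le _ h)
            _ = _ := by ring
        · have : fderiv ℝ (mollifier ε) h = 0 := image_eq_zero_of_notMem_tsupport fun h' => hh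
            (mem_closedBall_zero_iff.mp (tsupport_mollifier_subset hε (tsupport_fderiv_subset ℝ h')))
          simp [this]
    _ ≤ _ := by
        rw [lintegral_mul_const _ (by fun_prop)]
        gcongr

/-- Continuity of translations in `L²` for `f`, together with their differentiability for `v`,
supplies one `τ` that serves for both smallness conditions. -/
theorem tendsto_lintegral_transportCommutator {ε : ℕ → ℝ} (hε : ∀ n, 0 < ε n)
    (hε0 : Tendsto ε atTop (𝓝 0)) {f : E3 → ℝ} (hf : MemLp f 2 volume)
    (hfm : Measurable f) {v : E3 → E3} {G : E3 → E3 →L[ℝ] E3} (hvm : Measurable v)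
    (hGm : Measurable G) (hv : IsH1 v G) :
    Tendsto (fun n => ∫⁻ x, ‖transportCommutator (ε n) f v x - f x * traceCLM (G x)‖ₑ)
      atTop (𝓝 0) := by
  obtain ⟨C, hCt, hC⟩ := exists_lintegral_fderiv_mollifier_le
  have hfin : C * (eLpNorm f 2 volume + eLpNorm G 2 volume) ≠ ⊤ :=
    ENNReal.mul_ne_top hCt (ENNReal.add_ne_top.mpr ⟨hf.2.ne, hv.memLp_grad.2.ne⟩)
  have h0 : Tendsto (fun t : ℝ≥0∞ => C * (eLpNorm f 2 volume + eLpNorm G 2 volume) * t)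
      (𝓝 0) (𝓝 0) := by
    simpa using ENNReal.Tendsto.const_mul (tendsto_id (α := ℝ≥0∞) (x := 𝓝 0)) (Or.inr hfin)
  rw [ENNReal.tendsto_nhds_zero]
  intro c hc
  obtain ⟨τ, hτ0, hτ⟩ : ∃ τ : ℝ≥0∞, 0 < τ ∧
      C * (eLpNorm f 2 volume + eLpNorm G 2 volume) * τ ≤ c := by
    have := ((ENNReal.tendsto_nhds_zero.mp h0 c hc).filter_mono
      (nhdsWithin_le_nhds (s := Ioi 0))).and self_mem_nhdsWithin
    obtain ⟨τ, h1, h2⟩ := this.exists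
    exact ⟨τ, h2, h1⟩
  obtain ⟨δ, hδ0, hδ⟩ := Metric.eventually_nhds_iff.mp
    (ENNReal.tendsto_nhds_zero.mp (tendsto_eLpNorm_translate_sub hf) τ hτ0)
  obtain ⟨δ', hδ'0, hδ'⟩ := hv.eLpNorm_translate_sub_add_le hτ0.ne'
  filter_upwards [(tendsto_order.1 hε0).2 δ hδ0, (tendsto_order.1 hε0).2 δ' hδ'0] with n hn hn'
  refine (lintegral_transportCommutator_sub_le (hε n) (hC _ (hε n)) hf hfm hvm hGm hv
    (fun h hh => hδ (by simpa using hh.trans_lt hn)) fun h hh => hδ' h (hh.trans_lt hn')).trans ?_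
  rwa [← mul_assoc]

theorem mollify_eq_convolution (ε : ℝ) (f : E3 → ℝ) :
    mollify ε f = convolution (mollifier ε) f (ContinuousLinearMap.lsmul ℝ ℝ) volume := by
  ext x
  simp [mollify, convolution]

theorem contDiff_mollify {ε : ℝ} (hε : 0 < ε) {f : E3 → ℝ} (hf : MemLp f 2 volume) :
    ContDiff ℝ 1 (mollify ε f) := by
  rw [mollify_eq_convolution]
  exact (mollifier_hasCompactSupport hε).contDiff_convolution_left _
    ((mollifier_contDiff ε).of_le (by exact_mod_cast le_top))
    (hf.locallyIntegrable (by norm_num))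

theorem fderiv_mollify_apply {ε : ℝ} (hε : 0 < ε) {f : E3 → ℝ} (hf : MemLp f 2 volume)
    (x a : E3) :
    fderiv ℝ (mollify ε f) x a = ∫ h, f (x - h) * fderiv ℝ (mollifier ε) h a := by
  have hli := hf.locallyIntegrable (by norm_num)
  have h := (mollifier_hasCompactSupport hε).hasFDerivAt_convolution_left
    (ContinuousLinearMap.lsmul ℝ ℝ) (μ := volume)
    ((mollifier_contDiff ε).of_le (by exact_mod_cast le_top) : ContDiff ℝ 1 (mollifier ε)) hli x
  rw [← mollify_eq_convolution] at h
  rw [h.fderiv, convolution]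
  rw [ContinuousLinearMap.integral_apply]
  · refine integral_congr_ae (Filter.Eventually.of_forall fun y => ?_)
    simp [mul_comm]
  · exact ((mollifier_hasCompactSupport hε).fderiv ℝ).convolutionExists_left _
      (continuous_fderiv_mollifier ε) hli x

theorem integral_mul_mollifier_sub {ε : ℝ} (f : E3 → ℝ) (x : E3) :
    ∫ y, f y * mollifier ε (x - y) = mollify ε f x := by
  rw [mollify, ← integral_sub_left_eq_self (fun y => mollifier ε y * f (x - y)) volume x]
  refine integral_congr_ae (Filter.Eventually.of_forall fun y => ?_)
  simp [mul_comm]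

theorem fderiv_mollifier_sub (ε : ℝ) (x y : E3) :
    fderiv ℝ (fun y => mollifier ε (x - y)) y = - fderiv ℝ (mollifier ε) (x - y) := by
  have h1 : HasFDerivAt (fun y => x - y) (-ContinuousLinearMap.id ℝ E3) y :=
    (hasFDerivAt_id y).const_sub x
  have := (((mollifier_contDiff ε).differentiable (by simp)) (x - y)).hasFDerivAt.comp y h1
  rw [show (fun y => mollifier ε (x - y)) = mollifier ε ∘ fun y => x - y from rfl, this.fderiv]
  ext a
  simp

/-- After substituting `h = x - y`, split the velocity as `v x` plus an increment: the frozen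
velocity differentiates the mollified density, and the increment gives the commutator. -/
theorem integral_mul_fderiv_mollifier_sub {ε : ℝ} (hε : 0 < ε) {f : E3 → ℝ}
    (hf : MemLp f 2 volume) {v : E3 → E3} (hv : MemLp v 2 volume) (x : E3) :
    ∫ y, f y * fderiv ℝ (fun y => mollifier ε (x - y)) y (v y) =
      - transportCommutator ε f v x - fderiv ℝ (mollify ε f) x (v x) := by
  simp_rw [fderiv_mollifier_sub]
  rw [← integral_sub_left_eq_self _ volume x, fderiv_mollify_apply hε hf, transportCommutator]
  simp_rw [map_sub, mul_sub]
  rw [integral_sub (integrable_commutator_kernel hε hf hv x)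
    (integrable_commutator_kernel_const hε hf _ x)]
  simp only [sub_sub_cancel, neg_apply, mul_neg, integral_neg]
  ring

theorem measurable_mollify {ε : ℝ} {f : E3 → ℝ} (hf : Measurable f) :
    Measurable (mollify ε f) := by
  have hm := (mollifier_contDiff ε).continuous.measurable
  have : StronglyMeasurable (Function.uncurry fun x h : E3 => mollifier ε h * f (x - h)) :=
    Measurable.stronglyMeasurable (by fun_prop)
  exact this.integral_prod_right.measurable

theorem measurable_transportCommutator {ε : ℝ} {f : E3 → ℝ} (hf : Measurable f) {v : E3 → E3}
    (hv : Measurable v) : Measurable (transportCommutator ε f v) := by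
  have hm : Measurable fun p : E3 × E3 =>
      f (p.1 - p.2) * fderiv ℝ (mollifier ε) p.2 (v (p.1 - p.2) - v p.1) :=
    Measurable.mul (by fun_prop) (measurable_fderiv_mollifier_apply (by fun_prop) (by fun_prop))
  exact hm.stronglyMeasurable.integral_prod_right'.measurable

theorem memLp_fderiv_apply {ψ : E3 → ℝ} (hψ : ContDiff ℝ 1 ψ) (hψc : HasCompactSupport ψ)
    {v : E3 → E3} (hv : MemLp v 2 volume) : MemLp (fun x => fderiv ℝ ψ x (v x)) 2 volume := by
  obtain ⟨M, hM⟩ := (hψc.fderiv ℝ).exists_bound_of_continuous (hψ.continuous_fderiv (by simp))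
  refine MemLp.of_le (g := fun x => M • v x) (hv.const_smul M)
    (isBoundedBilinearMap_apply.continuous.comp_aestronglyMeasurable
      ((hψ.continuous_fderiv (by simp)).aestronglyMeasurable.prodMk hv.1))
    (Filter.Eventually.of_forall fun x => (ContinuousLinearMap.le_opNorm _ _).trans ?_)
  rw [norm_smul]
  gcongr
  exact (hM x).trans (le_abs_self M)

theorem memLp_mul_traceCLM {ψ : E3 → ℝ} (hψ : Continuous ψ) (hψc : HasCompactSupport ψ)
    {G : E3 → E3 →L[ℝ] E3} (hG : MemLp G 2 volume) :
    MemLp (fun x => ψ x * traceCLM (G x)) 2 volume := by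
  obtain ⟨M, hM⟩ := hψc.exists_bound_of_continuous hψ
  obtain ⟨c, hc0, hc⟩ := exists_abs_traceCLM_le
  refine MemLp.of_le (g := fun x => (M * c) • G x) (hG.const_smul (M * c))
    (hψ.aestronglyMeasurable.mul (traceCLM.continuous.comp_aestronglyMeasurable hG.1))
    (Filter.Eventually.of_forall fun x => ?_)
  have hM0 : 0 ≤ M := (norm_nonneg _).trans (hM 0)
  rw [norm_mul, norm_smul, Real.norm_of_nonneg (mul_nonneg hM0 hc0), mul_assoc]
  gcongr
  · exact hM x
  · exact hc _

theorem integrable_of_lintegral_le {α : Type*} [MeasurableSpace α] {μ : Measure α} {f : α → ℝ}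
    (hf : Measurable f) {C : ℝ≥0∞} (hC : C ≠ ⊤) (h : ∫⁻ x, ‖f x‖ₑ ∂μ ≤ C) : Integrable f μ :=
  ⟨hf.aestronglyMeasurable, lt_of_le_of_lt h hC.lt_top⟩

/-! ### The renormalized identity at a fixed time and its limit -/

section Static

variable {b b' : ℝ → ℝ} {L : ℝ≥0} {f g : E3 → ℝ} {v : E3 → E3} {G : E3 → E3 →L[ℝ] E3}
  {ψ θ : E3 → ℝ}

theorem norm_le_of_lipschitz_zero (hL : LipschitzWith L b) (hb0 : b 0 = 0) (x : ℝ) :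
    ‖b x‖ ≤ L * ‖x‖ := by
  simpa [hb0] using hL.dist_le_mul x 0

theorem norm_deriv_le_of_lipschitz (hb : ∀ x, HasDerivAt b (b' x) x) (hL : LipschitzWith L b)
    (x : ℝ) : ‖b' x‖ ≤ L := by
  rw [← (hb x).deriv]
  exact _root_.norm_deriv_le_of_lipschitz hL

/-- The bounds here and in `integrable_bounded_mul_commutator` do not involve `ε`. Taken on time
slices, they give the dominating function in time for the limit in `TransportSolution.renormalized`.
-/
theorem integrable_mollify_comp_mul {ε : ℝ} (hε : 0 < ε) (hL : LipschitzWith L b) (hb0 : b 0 = 0)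
    (hf : MemLp f 2 volume) (hfm : Measurable f) {H : E3 → ℝ} (hH : MemLp H 2 volume)
    (hHm : Measurable H) :
    Integrable (fun x => b (mollify ε f x) * H x) ∧
    ∫⁻ x, ‖b (mollify ε f x) * H x‖ₑ ≤ L * (eLpNorm f 2 volume * eLpNorm H 2 volume) := by
  have hbound : ∫⁻ x, ‖b (mollify ε f x) * H x‖ₑ ≤
      L * (eLpNorm f 2 volume * eLpNorm H 2 volume) := by
    calc _ ≤ ∫⁻ x, L * ‖mollify ε f x * H x‖ₑ := by
          refine lintegral_mono fun x => ?_
          rw [enorm_mul, enorm_mul, ← mul_assoc]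
          gcongr
          rw [enorm_eq_nnnorm, enorm_eq_nnnorm, ← ENNReal.coe_mul, ENNReal.coe_le_coe]
          exact norm_le_of_lipschitz_zero hL hb0 _
      _ ≤ _ := by
          have := measurable_mollify (ε := ε) hfm
          rw [lintegral_const_mul _ (by fun_prop)]
          gcongr
          exact lintegral_enorm_mollify_mul_le hε hf hfm hH hHm
  refine ⟨integrable_of_lintegral_le ?_ ?_ hbound, hbound⟩
  · exact (hL.continuous.measurable.comp (measurable_mollify hfm)).mul hHm
  · exact ENNReal.mul_ne_top (by simp) (ENNReal.mul_ne_top hf.2.ne hH.2.ne)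

theorem integrable_bounded_mul_commutator {C : ℝ≥0∞} (hCt : C ≠ ⊤) {ε : ℝ} (hε : 0 < ε)
    (hC : ∫⁻ h, ‖fderiv ℝ (mollifier ε) h‖ₑ * ‖h‖ₑ ≤ C)
    (hb'c : Continuous b') (hb' : ∀ x, ‖b' x‖ ≤ L)
    (hf : MemLp f 2 volume) (hfm : Measurable f) (hg : MemLp g 2 volume) (hgm : Measurable g)
    (hvm : Measurable v) (hv : IsH1 v G) (hψ : Continuous ψ) (hψc : HasCompactSupport ψ)
    {M : ℝ≥0} (hM : ∀ x, ‖ψ x‖ ≤ M) :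
    Integrable (fun x => b' (mollify ε f x) *
      ((transportCommutator ε f v x + mollify ε g x) * ψ x)) ∧
    ∫⁻ x, ‖b' (mollify ε f x) * ((transportCommutator ε f v x + mollify ε g x) * ψ x)‖ₑ ≤
      L * (M * (C * (eLpNorm f 2 volume * eLpNorm G 2 volume)) +
        eLpNorm g 2 volume * eLpNorm ψ 2 volume) := by
  have hRm := measurable_transportCommutator (ε := ε) hfm hvm
  have hψm := hψ.measurable
  have hmm := measurable_mollify (ε := ε) hgm
  have hψL := memLp_of_smooth hψ hψc
  have hbound : ∫⁻ x, ‖b' (mollify ε f x) *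
      ((transportCommutator ε f v x + mollify ε g x) * ψ x)‖ₑ ≤
      L * (M * (C * (eLpNorm f 2 volume * eLpNorm G 2 volume)) +
        eLpNorm g 2 volume * eLpNorm ψ 2 volume) := by
    calc _ ≤ ∫⁻ x, L * (M * ‖transportCommutator ε f v x‖ₑ + ‖mollify ε g x * ψ x‖ₑ) := by
          refine lintegral_mono fun x => ?_
          rw [enorm_mul, add_mul]
          gcongr
          · rw [enorm_eq_nnnorm, ENNReal.coe_le_coe]; exact hb' _
          · refine (enorm_add_le _ _).trans ?_
            gcongr
            rw [enorm_mul, mul_comm]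
            gcongr
            rw [enorm_eq_nnnorm, ENNReal.coe_le_coe]; exact hM _
      _ = L * (M * (∫⁻ x, ‖transportCommutator ε f v x‖ₑ) +
          ∫⁻ x, ‖mollify ε g x * ψ x‖ₑ) := by
          rw [lintegral_const_mul _ (by fun_prop), lintegral_add_left (by fun_prop),
            lintegral_const_mul _ (by fun_prop)]
      _ ≤ _ := by
          gcongr
          · exact lintegral_transportCommutator_le hC hfm hvm hv
          · exact lintegral_enorm_mollify_mul_le hε hg hgm hψL hψm
  refine ⟨integrable_of_lintegral_le ?_ ?_ hbound, hbound⟩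
  · exact (hb'c.measurable.comp (measurable_mollify hfm)).mul ((hRm.add hmm).mul hψm)
  · have h1 := hf.2.ne
    have h2 := hg.2.ne
    have h3 := hv.memLp_grad.2.ne
    have h4 := hψL.2.ne
    finiteness

/-- Integration by parts in space for the mollified and renormalized equation. -/
theorem integral_mollified_renormalized {ε : ℝ} (hε : 0 < ε)
    (hb : ∀ x, HasDerivAt b (b' x) x) (hb'c : Continuous b') (hL : LipschitzWith L b)
    (hb0 : b 0 = 0)
    (hf : MemLp f 2 volume) (hfm : Measurable f) (hg : MemLp g 2 volume) (hgm : Measurable g)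
    (hvm : Measurable v) (hGm : Measurable G) (hv : IsH1 v G)
    (hψ : ContDiff ℝ 1 ψ) (hψc : HasCompactSupport ψ)
    (hθ : Continuous θ) (hθc : HasCompactSupport θ) :
    ∫ x, (b (mollify ε f x) * θ x + b' (mollify ε f x) *
      ((∫ y, f y * fderiv ℝ (fun y => mollifier ε (x - y)) y (v y))
        - ∫ y, g y * mollifier ε (x - y)) * ψ x)
    = ∫ x, (b (mollify ε f x) * (θ x + fderiv ℝ ψ x (v x) + ψ x * traceCLM (G x))
      - b' (mollify ε f x) * ((transportCommutator ε f v x + mollify ε g x) * ψ x)) := by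
  obtain ⟨C, hCt, hC⟩ := exists_lintegral_fderiv_mollifier_le
  obtain ⟨M, hM⟩ := hψc.exists_bound_of_continuous hψ.continuous
  have hM0 : 0 ≤ M := (norm_nonneg _).trans (hM 0)
  have hm : ContDiff ℝ 1 (mollify ε f) := contDiff_mollify hε hf
  have hbC : ContDiff ℝ 1 b := by
    rw [contDiff_one_iff_deriv]
    refine ⟨fun x => (hb x).differentiableAt, ?_⟩
    rwa [show deriv b = b' from funext fun x => (hb x).deriv]
  have hbm : ContDiff ℝ 1 fun x => b (mollify ε f x) := hbC.comp hm
  have hΨ : ContDiff ℝ 1 fun x => b (mollify ε f x) * ψ x := hbm.mul hψ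
  have hΨc : HasCompactSupport fun x => b (mollify ε f x) * ψ x := hψc.mul_left
  have hdΨ : ∀ x a, fderiv ℝ (fun x => b (mollify ε f x) * ψ x) x a =
      b (mollify ε f x) * fderiv ℝ ψ x a +
        b' (mollify ε f x) * fderiv ℝ (mollify ε f) x a * ψ x := by
    intro x a
    have h1 : HasFDerivAt (fun x => b (mollify ε f x)) (b' (mollify ε f x) •
        fderiv ℝ (mollify ε f) x) x :=
      (hb _).comp_hasFDerivAt x ((hm.differentiable (by simp)) x).hasFDerivAt
    rw [(h1.fun_mul ((hψ.differentiable (by simp)) x).hasFDerivAt).fderiv]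
    simp only [add_apply, smul_apply, smul_eq_mul]
    ring
  -- With `b(mollify ε f) ψ` as test function, the derivative of the mollified density, which has no
  -- uniform bound in `ε`, is traded for the divergence of `v` and the gradient of `ψ`.
  have hparts := hv.integral_fderiv_apply_eq_neg hΨ hΨc
  simp_rw [hdΨ] at hparts
  have hDψ := memLp_fderiv_apply hψ hψc hv.memLp
  have hDψm : Measurable fun x => fderiv ℝ ψ x (v x) :=
    (isBoundedBilinearMap_apply (𝕜 := ℝ) (E := E3) (F := ℝ)).continuous.measurable.comp
      ((hψ.continuous_fderiv (by simp)).measurable.prodMk hvm)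
  have htr := memLp_mul_traceCLM hψ.continuous hψc hv.memLp_grad
  have htrm : Measurable fun x => ψ x * traceCLM (G x) :=
    hψ.continuous.measurable.mul (traceCLM.continuous.measurable.comp hGm)
  have hI1 : Integrable fun x => b (mollify ε f x) * fderiv ℝ ψ x (v x) :=
    (integrable_mollify_comp_mul hε hL hb0 hf hfm hDψ hDψm).1
  have hI2 : Integrable fun x => b (mollify ε f x) * (ψ x * traceCLM (G x)) :=
    (integrable_mollify_comp_mul hε hL hb0 hf hfm htr htrm).1
  have hI3 : Integrable fun x => b (mollify ε f x) * θ x :=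
    (integrable_mollify_comp_mul hε hL hb0 hf hfm (memLp_of_smooth hθ hθc) hθ.measurable).1
  -- Integrability comes by difference: the full derivative of `b(mollify ε f) ψ` along `v` is
  -- integrable, and so is its other summand.
  have hI4 : Integrable fun x => b' (mollify ε f x) * fderiv ℝ (mollify ε f) x (v x) * ψ x := by
    have hint : Integrable fun x => fderiv ℝ (fun x => b (mollify ε f x) * ψ x) x (v x) := by
      have hk := memLp_of_smooth (hΨ.continuous_fderiv (by simp)) (hΨc.fderiv ℝ)
      exact integrable_of_enorm_le_mul hk hv.memLp (memLp_fderiv_apply hΨ hΨc hv.memLp).1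
        fun x => ContinuousLinearMap.le_opNorm _ _
    refine (hint.sub hI1).congr (Filter.Eventually.of_forall fun x => ?_)
    simp only [Pi.sub_apply, hdΨ]
    ring
  have hI5 := (integrable_bounded_mul_commutator (M := ⟨M, hM0⟩) hCt hε (hC ε hε) hb'c
    (norm_deriv_le_of_lipschitz hb hL) hf hfm hg hgm hvm hv hψ.continuous hψc hM).1
  have e1 : ∀ x, b (mollify ε f x) * θ x + b' (mollify ε f x) *
      ((∫ y, f y * fderiv ℝ (fun y => mollifier ε (x - y)) y (v y))
        - ∫ y, g y * mollifier ε (x - y)) * ψ x =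
      b (mollify ε f x) * θ x - b' (mollify ε f x) * fderiv ℝ (mollify ε f) x (v x) * ψ x
      - b' (mollify ε f x) * ((transportCommutator ε f v x + mollify ε g x) * ψ x) := by
    intro x
    rw [integral_mul_fderiv_mollifier_sub hε hf hv.memLp, integral_mul_mollifier_sub]
    ring
  have e2 : ∀ x, b (mollify ε f x) * (θ x + fderiv ℝ ψ x (v x) + ψ x * traceCLM (G x))
      - b' (mollify ε f x) * ((transportCommutator ε f v x + mollify ε g x) * ψ x) =
      b (mollify ε f x) * θ x + b (mollify ε f x) * fderiv ℝ ψ x (v x)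
      + b (mollify ε f x) * (ψ x * traceCLM (G x))
      - b' (mollify ε f x) * ((transportCommutator ε f v x + mollify ε g x) * ψ x) := by
    intro x
    ring
  simp_rw [e1, e2]
  have hs1 : Integrable fun x => b (mollify ε f x) * θ x -
      b' (mollify ε f x) * fderiv ℝ (mollify ε f) x (v x) * ψ x := hI3.sub hI4
  rw [integral_sub hs1 hI5, integral_sub ((hI3.fun_add hI1).fun_add hI2) hI5,
    integral_sub hI3 hI4, integral_add (hI3.fun_add hI1) hI2, integral_add hI3 hI1]
  rw [integral_add hI1 hI4] at hparts
  simp_rw [mul_assoc (b _) (ψ _)] at hparts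
  linarith

theorem tendsto_integral_mollify_comp_mul {ε : ℕ → ℝ} (hε : ∀ n, 0 < ε n)
    (hε0 : Tendsto ε atTop (𝓝 0)) (hL : LipschitzWith L b) (hb0 : b 0 = 0)
    (hf : MemLp f 2 volume) (hfm : Measurable f) {H : E3 → ℝ} (hH : MemLp H 2 volume)
    (hHm : Measurable H) :
    Tendsto (fun n => ∫ x, b (mollify (ε n) f x) * H x) atTop (𝓝 (∫ x, b (f x) * H x)) := by
  have hint : Integrable fun x => b (f x) * H x := by
    refine integrable_of_enorm_le_mul (a := fun x => (L : ℝ) * f x) (hf.const_mul _) hH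
      ((hL.continuous.measurable.comp hfm).mul hHm).aestronglyMeasurable fun x => ?_
    rw [norm_mul, norm_mul]
    gcongr
    simpa using norm_le_of_lipschitz_zero hL hb0 (f x)
  refine tendsto_integral_of_lintegral_enorm_sub
    (fun n => (integrable_mollify_comp_mul (hε n) hL hb0 hf hfm hH hHm).1) hint ?_
  refine tendsto_of_tendsto_of_tendsto_of_le_of_le tendsto_const_nhds
    (eq_of_tendsto_zero_mul (C := L) (by simp)
      (tendsto_lintegral_mollify_mul hε hε0 hf hfm hH hHm)) (fun _ => zero_le) fun n => ?_
  beta_reduce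
  rw [← lintegral_const_mul' _ _ (by simp)]
  refine lintegral_mono fun x => ?_
  rw [← sub_mul, ← sub_mul, enorm_mul, enorm_mul, ← mul_assoc]
  gcongr
  rw [← edist_eq_enorm_sub, ← edist_eq_enorm_sub]
  exact hL _ _

/-- Passage to the limit in `∫ b'(fₙ) Sₙ` when `Sₙ → S` in `L¹` and `fₙ → f` in `L¹` with
weight `ψ`, with `S` vanishing where `ψ` does. -/
theorem tendsto_integral_comp_mul {α : Type*} [MeasurableSpace α] {μ : Measure α}
    (hb'c : Continuous b') (hb' : ∀ x, ‖b' x‖ ≤ L)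
    {fn Sn : ℕ → α → ℝ} {f S ψ : α → ℝ} (hfn : ∀ n, Measurable (fn n)) (hf : Measurable f)
    (hSn : ∀ n, Integrable (Sn n) μ) (hS : Integrable S μ) (hψ : Measurable ψ)
    (hlimS : Tendsto (fun n => ∫⁻ x, ‖Sn n x - S x‖ₑ ∂μ) atTop (𝓝 0))
    (hlimf : Tendsto (fun n => ∫⁻ x, ‖fn n x * ψ x - f x * ψ x‖ₑ ∂μ) atTop (𝓝 0))
    (hSψ : ∀ x, ψ x = 0 → S x = 0) :
    Tendsto (fun n => ∫ x, b' (fn n x) * Sn n x ∂μ) atTop (𝓝 (∫ x, b' (f x) * S x ∂μ)) := by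
  have hI : ∀ {k s : α → ℝ}, Measurable k → Integrable s μ →
      Integrable (fun x => b' (k x) * s x) μ := fun hk hs =>
    hs.bdd_mul (hb'c.measurable.comp hk).aestronglyMeasurable
      (Filter.Eventually.of_forall fun x => hb' _)
  have h1 : Tendsto (fun n => ∫ x, b' (fn n x) * S x ∂μ) atTop (𝓝 (∫ x, b' (f x) * S x ∂μ)) := by
    -- Only weighted `L¹` convergence of `fn` is known. A further subsequence converges a.e. where
    -- `ψ ≠ 0`, and where `ψ = 0` the factor `S` vanishes.
    refine tendsto_of_subseq_tendsto fun ns hns => ?_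
    have hm : TendstoInMeasure μ (fun n x => fn (ns n) x * ψ x) atTop fun x => f x * ψ x :=
      tendstoInMeasure_of_tendsto_eLpNorm (p := 1) one_ne_zero
        (fun n => ((hfn _).mul hψ).aestronglyMeasurable) (hf.mul hψ).aestronglyMeasurable
        (by simpa [eLpNorm_one_eq_lintegral_enorm, Function.comp_def] using hlimf.comp hns)
    obtain ⟨ms, -, hms⟩ := hm.exists_seq_tendsto_ae
    refine ⟨ms, ?_⟩
    refine tendsto_integral_of_dominated_convergence (fun x => L * ‖S x‖)
      (fun n => (hI (hfn _) hS).1) (hS.norm.const_mul _) (fun n => ?_) ?_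
    · refine Filter.Eventually.of_forall fun x => ?_
      rw [norm_mul]
      gcongr
      exact hb' _
    · filter_upwards [hms] with x hx
      by_cases h0 : ψ x = 0
      · simp [hSψ x h0]
      · have : Tendsto (fun n => fn (ns (ms n)) x) atTop (𝓝 (f x)) := by
          have := hx.mul_const (ψ x)⁻¹
          simpa [mul_assoc, h0] using this
        exact ((hb'c.tendsto _).comp this).mul_const _
  -- Splitting `Sn = (Sn - S) + S`, the first part needs only boundedness of `b'` and the second is
  -- the case already treated.
  have h2 : Tendsto (fun n => ∫ x, b' (fn n x) * (Sn n x - S x) ∂μ) atTop (𝓝 0) := by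
    have := tendsto_integral_of_lintegral_enorm_sub (μ := μ)
      (f := fun n x => b' (fn n x) * (Sn n x - S x)) (g := fun _ => (0 : ℝ))
      (fun n => hI (hfn n) ((hSn n).sub hS)) (integrable_zero _ _ _) ?_
    · simpa using this
    · refine tendsto_of_tendsto_of_tendsto_of_le_of_le tendsto_const_nhds
        (eq_of_tendsto_zero_mul (C := L) (by simp) hlimS) (fun _ => zero_le) fun n => ?_
      beta_reduce
      rw [← lintegral_const_mul' _ _ (by simp)]
      refine lintegral_mono fun x => ?_
      rw [sub_zero, enorm_mul]
      gcongr
      rw [enorm_eq_nnnorm, ENNReal.coe_le_coe]; exact hb' _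
  have h3 := h2.add h1
  rw [zero_add] at h3
  refine h3.congr fun n => ?_
  have hd : Integrable (fun x => Sn n x - S x) μ := (hSn n).sub hS
  rw [← integral_add (hI (hfn n) hd) (hI (hfn n) hS)]
  refine integral_congr_ae (Filter.Eventually.of_forall fun x => ?_)
  ring

theorem tendsto_integral_bounded_mul_commutator {ε : ℕ → ℝ} (hε : ∀ n, 0 < ε n)
    (hε0 : Tendsto ε atTop (𝓝 0)) (hb'c : Continuous b') (hb' : ∀ x, ‖b' x‖ ≤ L)
    (hf : MemLp f 2 volume) (hfm : Measurable f) (hg : MemLp g 2 volume) (hgm : Measurable g)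
    (hvm : Measurable v) (hGm : Measurable G) (hv : IsH1 v G)
    (hψ : Continuous ψ) (hψc : HasCompactSupport ψ) :
    Tendsto (fun n => ∫ x, b' (mollify (ε n) f x) *
      ((transportCommutator (ε n) f v x + mollify (ε n) g x) * ψ x)) atTop
      (𝓝 (∫ x, b' (f x) * ((f x * traceCLM (G x) + g x) * ψ x))) := by
  obtain ⟨C, hCt, hC⟩ := exists_lintegral_fderiv_mollifier_le
  obtain ⟨M, hM⟩ := hψc.exists_bound_of_continuous hψ
  have hM0 : 0 ≤ M := (norm_nonneg _).trans (hM 0)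
  have hψL := memLp_of_smooth hψ hψc
  have hψm := hψ.measurable
  have htr := memLp_mul_traceCLM hψ hψc hv.memLp_grad
  have htm : Measurable fun x => traceCLM (G x) := traceCLM.continuous.measurable.comp hGm
  have hRm := fun n => measurable_transportCommutator (ε := ε n) hfm hvm
  have hgεm := fun n => measurable_mollify (ε := ε n) hgm
  have hS : Integrable fun x => (f x * traceCLM (G x) + g x) * ψ x := by
    simp_rw [add_mul]
    refine Integrable.add ?_ ?_
    · refine integrable_of_enorm_le_mul hf htr ((hfm.mul htm).mul hψm).aestronglyMeasurable
        fun x => ?_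
      rw [← norm_mul]
      exact le_of_eq (by congr 1; ring)
    · exact integrable_of_enorm_le_mul hg hψL (hgm.mul hψm).aestronglyMeasurable
        fun x => (norm_mul _ _).le
  have hSn : ∀ n, Integrable fun x =>
      (transportCommutator (ε n) f v x + mollify (ε n) g x) * ψ x := by
    intro n
    -- The constant weight `1` isolates the integrability of the commutator term.
    have := (integrable_bounded_mul_commutator (b' := fun _ => 1) (L := 1) (M := ⟨M, hM0⟩) hCt
      (hε n) (hC _ (hε n)) continuous_const (by simp) hf hfm hg hgm hvm hv hψ hψc hM).1
    simpa using this
  refine tendsto_integral_comp_mul hb'c hb' (fun n => measurable_mollify hfm) hfm hSn hS hψm ?_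
    (tendsto_lintegral_mollify_mul hε hε0 hf hfm hψL hψm) (fun x hx => by simp [hx])
  have hlim : Tendsto (fun n => ENNReal.ofReal M *
      (∫⁻ x, ‖transportCommutator (ε n) f v x - f x * traceCLM (G x)‖ₑ) +
      ∫⁻ x, ‖mollify (ε n) g x * ψ x - g x * ψ x‖ₑ) atTop (𝓝 0) := by
    simpa using (eq_of_tendsto_zero_mul (C := ENNReal.ofReal M) (by simp)
      (tendsto_lintegral_transportCommutator hε hε0 hf hfm hvm hGm hv)).add
      (tendsto_lintegral_mollify_mul hε hε0 hg hgm hψL hψm)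
  refine tendsto_of_tendsto_of_tendsto_of_le_of_le tendsto_const_nhds hlim
    (fun _ => zero_le) fun n => ?_
  beta_reduce
  have hRn := hRm n
  rw [← lintegral_const_mul' _ _ (by simp), ← lintegral_add_left (by fun_prop)]
  refine lintegral_mono fun x => ?_
  have e : (transportCommutator (ε n) f v x + mollify (ε n) g x) * ψ x -
      (f x * traceCLM (G x) + g x) * ψ x =
      ψ x * (transportCommutator (ε n) f v x - f x * traceCLM (G x)) +
      (mollify (ε n) g x * ψ x - g x * ψ x) := by ring
  rw [e]
  refine (enorm_add_le _ _).trans ?_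
  gcongr
  rw [enorm_mul]
  gcongr
  rw [← ofReal_norm]
  exact ENNReal.ofReal_le_ofReal (hM x)

end Static

/-! ### Transport equations on the whole space and their renormalization -/

/-- `∂ₜw + div(w U) = -g` on `(0,T) × ℝ³` with initial value `w₀`, for square integrable data and
a velocity field `U` with square integrable gradient `G`. -/
structure TransportSolution (T : ℝ) (w g : ℝ × E3 → ℝ) (U : ℝ × E3 → E3)
    (G : ℝ × E3 → E3 →L[ℝ] E3) (w₀ : E3 → ℝ) : Prop where
  measurable_w : Measurable w
  measurable_g : Measurable g
  measurable_U : Measurable U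
  measurable_G : Measurable G
  measurable_init : Measurable w₀
  memLp_w : MemLp w 2 ((volume.restrict (Ioo 0 T)).prod volume)
  memLp_g : MemLp g 2 ((volume.restrict (Ioo 0 T)).prod volume)
  memLp_U : MemLp U 2 ((volume.restrict (Ioo 0 T)).prod volume)
  memLp_G : MemLp G 2 ((volume.restrict (Ioo 0 T)).prod volume)
  memLp_init : MemLp w₀ 2 volume
  isH1 : ∀ᵐ t ∂(volume.restrict (Ioo 0 T)), IsH1 (fun x => U (t, x)) (fun x => G (t, x))
  weak : ∀ χ : ℝ → ℝ, IsTestFunction (Iio T) χ → ∀ ψ : E3 → ℝ, IsTestFunction univ ψ →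
    (∫ t in Ioo 0 T, (deriv χ t * (∫ x, w (t, x) * ψ x) +
      χ t * ((∫ x, w (t, x) * fderiv ℝ ψ x (U (t, x))) - ∫ x, g (t, x) * ψ x)))
      + χ 0 * ∫ x, w₀ x * ψ x = 0

/-- The square of the spatial `L²` norm as a function of time. -/
noncomputable def sliceEnergy {F : Type*} [NormedAddCommGroup F] (f : ℝ × E3 → F) (t : ℝ) : ℝ≥0∞ :=
  ∫⁻ x, ‖f (t, x)‖ₑ ^ 2

theorem eLpNorm_slice_sq {F : Type*} [NormedAddCommGroup F] (f : ℝ × E3 → F) (t : ℝ) :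
    eLpNorm (fun x => f (t, x)) 2 volume ^ 2 = sliceEnergy f t :=
  eLpNorm_two_sq _

theorem measurable_sliceEnergy {F : Type*} [NormedAddCommGroup F] [MeasurableSpace F]
    [BorelSpace F] [SecondCountableTopology F] {f : ℝ × E3 → F} (hf : Measurable f) :
    Measurable (sliceEnergy f) :=
  Measurable.lintegral_prod_right' (f := fun p => ‖f p‖ₑ ^ 2) (by fun_prop)

theorem lintegral_sliceEnergy {F : Type*} [NormedAddCommGroup F] [MeasurableSpace F]
    [BorelSpace F] [SecondCountableTopology F] {f : ℝ × E3 → F} (hf : Measurable f)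
    {T : ℝ} (hL : MemLp f 2 ((volume.restrict (Ioo 0 T)).prod volume)) :
    ∫⁻ t in Ioo 0 T, sliceEnergy f t ≠ ⊤ := by
  have h := eLpNorm_two_sq (μ := (volume.restrict (Ioo 0 T)).prod volume) f
  rw [lintegral_prod _ (by fun_prop)] at h
  change ∫⁻ t in Ioo 0 T, ∫⁻ x, ‖f (t, x)‖ₑ ^ 2 ≠ ⊤
  rw [← h]
  exact ENNReal.pow_ne_top hL.2.ne

theorem ae_memLp_slice {F : Type*} [NormedAddCommGroup F] [MeasurableSpace F]
    [BorelSpace F] [SecondCountableTopology F] {f : ℝ × E3 → F} (hf : Measurable f)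
    {T : ℝ} (hL : MemLp f 2 ((volume.restrict (Ioo 0 T)).prod volume)) :
    ∀ᵐ t ∂(volume.restrict (Ioo 0 T)), MemLp (fun x => f (t, x)) 2 volume := by
  filter_upwards [ae_lt_top (measurable_sliceEnergy hf) (lintegral_sliceEnergy hf hL)] with t ht
  refine ⟨(hf.comp measurable_prodMk_left).aestronglyMeasurable, ?_⟩
  rw [← eLpNorm_slice_sq] at ht
  by_contra hn
  rw [not_lt, top_le_iff] at hn
  simp [hn] at ht

theorem ennreal_mul_le_sq_add_sq (x y : ℝ≥0∞) : x * y ≤ x ^ 2 + y ^ 2 := by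
  rcases le_total x y with h | h
  · calc x * y ≤ y * y := by gcongr
      _ ≤ _ := by rw [← sq]; exact le_add_self
  · calc x * y ≤ x * x := by gcongr
      _ ≤ _ := by rw [← sq]; exact le_self_add

theorem ennreal_le_one_add_sq (x : ℝ≥0∞) : x ≤ 1 + x ^ 2 := by
  simpa using ennreal_mul_le_sq_add_sq 1 x

/-- All slices are supported in the projection of one compact set, so one constant controls them
uniformly in time. -/
theorem exists_slice_bound {φ : ℝ × E3 → ℝ} (hφ : Continuous φ) (hc : HasCompactSupport φ) :
    ∃ B : ℝ≥0, (∀ p, ‖φ p‖ ≤ B) ∧ ∀ t, (∫⁻ x, ‖φ (t, x)‖ₑ ≤ B) ∧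
      eLpNorm (fun x => φ (t, x)) 2 volume ≤ B := by
  obtain ⟨M, hM⟩ := hc.exists_bound_of_continuous hφ
  have hM0 : 0 ≤ M := (norm_nonneg _).trans (hM 0)
  set K : Set E3 := Prod.snd '' tsupport φ with hK
  have hKc : IsCompact K := hc.isCompact.image continuous_snd
  have hpt : ∀ t x, ‖φ (t, x)‖ ≤ ‖K.indicator (fun _ => M) x‖ := by
    intro t x
    by_cases hx : x ∈ K
    · rw [indicator_of_mem hx, Real.norm_of_nonneg hM0]; exact hM _
    · rw [image_eq_zero_of_notMem_tsupport (f := φ) fun h => hx ⟨_, h, rfl⟩]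
      simp
  have h1 : ∀ t, ∫⁻ x, ‖φ (t, x)‖ₑ ≤ ENNReal.ofReal M * volume K := by
    intro t
    calc _ ≤ ∫⁻ x, ‖K.indicator (fun _ => M) x‖ₑ := lintegral_mono fun x => by
          rw [← ofReal_norm, ← ofReal_norm]; exact ENNReal.ofReal_le_ofReal (hpt t x)
      _ = ∫⁻ x, K.indicator (fun _ => ENNReal.ofReal M) x := by
          refine lintegral_congr fun x => ?_
          by_cases hx : x ∈ K <;> simp [hx, Real.enorm_of_nonneg hM0]
      _ = _ := by rw [lintegral_indicator hKc.measurableSet, setLIntegral_const]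
  have h2 : ∀ t, eLpNorm (fun x => φ (t, x)) 2 volume ≤
      eLpNorm (K.indicator fun _ => M) 2 volume := fun t => eLpNorm_mono (hpt t)
  have hf1 : ENNReal.ofReal M * volume K ≠ ⊤ :=
    ENNReal.mul_ne_top (by simp) hKc.measure_lt_top.ne
  have hf2 : eLpNorm (K.indicator fun _ => M) 2 (volume : Measure E3) ≠ ⊤ :=
    (memLp_indicator_const 2 hKc.measurableSet M (Or.inr hKc.measure_lt_top.ne)).2.ne
  refine ⟨M.toNNReal + (ENNReal.ofReal M * volume K).toNNReal +
    (eLpNorm (K.indicator fun _ => M) 2 (volume : Measure E3)).toNNReal, fun p => ?_, fun t =>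
    ⟨(h1 t).trans ?_, (h2 t).trans ?_⟩⟩
  · refine (hM p).trans ?_
    rw [NNReal.coe_add, NNReal.coe_add, Real.coe_toNNReal M hM0]
    have := (ENNReal.ofReal M * volume K).toNNReal.coe_nonneg
    have := (eLpNorm (K.indicator fun _ => M) 2 (volume : Measure E3)).toNNReal.coe_nonneg
    linarith
  · rw [ENNReal.coe_add, ENNReal.coe_add, ENNReal.coe_toNNReal hf1]
    exact le_add_right le_add_self
  · rw [ENNReal.coe_add, ENNReal.coe_toNNReal hf2]
    exact le_add_self

theorem enorm_integral_mul_le {F F' : Type*} [NormedAddCommGroup F] [NormedAddCommGroup F']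
    {a : E3 → F} {b : E3 → F'} {c : E3 → ℝ} (ha : AEStronglyMeasurable a volume)
    (hb : AEStronglyMeasurable b volume) {M : ℝ≥0∞} (hM : M ≠ ⊤)
    (h : ∀ x, ‖c x‖ₑ ≤ M * (‖a x‖ₑ * ‖b x‖ₑ)) :
    ‖∫ x, c x‖ₑ ≤ M * (eLpNorm a 2 volume * eLpNorm b 2 volume) := by
  refine (enorm_integral_le_lintegral_enorm _).trans ((lintegral_mono h).trans ?_)
  rw [lintegral_const_mul' _ _ hM]
  gcongr
  exact lintegral_enorm_mul_enorm_le ha hb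

namespace TransportSolution

variable {T : ℝ} {w g : ℝ × E3 → ℝ} {U : ℝ × E3 → E3} {G : ℝ × E3 → E3 →L[ℝ] E3} {w₀ : E3 → ℝ}

/-- The sum of all slice energies, a bound for every term of the equation at time `t`. -/
noncomputable def energy (w g : ℝ × E3 → ℝ) (U : ℝ × E3 → E3) (G : ℝ × E3 → E3 →L[ℝ] E3)
    (t : ℝ) : ℝ≥0∞ :=
  1 + sliceEnergy w t + sliceEnergy g t + sliceEnergy U t + sliceEnergy G t

theorem measurable_energy (h : TransportSolution T w g U G w₀) : Measurable (energy w g U G) := by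
  have h1 := measurable_sliceEnergy h.measurable_w
  have h2 := measurable_sliceEnergy h.measurable_g
  have h3 := measurable_sliceEnergy h.measurable_U
  have h4 := measurable_sliceEnergy h.measurable_G
  unfold energy
  fun_prop

theorem lintegral_energy (h : TransportSolution T w g U G w₀) :
    ∫⁻ t in Ioo 0 T, energy w g U G t ≠ ⊤ := by
  have h1 := measurable_sliceEnergy h.measurable_w
  have h2 := measurable_sliceEnergy h.measurable_g
  have h3 := measurable_sliceEnergy h.measurable_U
  have h4 := measurable_sliceEnergy h.measurable_G
  unfold energy
  rw [lintegral_add_left (by fun_prop), lintegral_add_left (by fun_prop),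
    lintegral_add_left (by fun_prop), lintegral_add_left (by fun_prop)]
  have e1 := lintegral_sliceEnergy h.measurable_w h.memLp_w
  have e2 := lintegral_sliceEnergy h.measurable_g h.memLp_g
  have e3 := lintegral_sliceEnergy h.measurable_U h.memLp_U
  have e4 := lintegral_sliceEnergy h.measurable_G h.memLp_G
  simp [e1, e2, e3, e4]

theorem le_energy (t : ℝ) : 1 ≤ energy w g U G t ∧
    eLpNorm (fun x => w (t, x)) 2 volume ^ 2 ≤ energy w g U G t ∧
    eLpNorm (fun x => g (t, x)) 2 volume ^ 2 ≤ energy w g U G t ∧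
    eLpNorm (fun x => U (t, x)) 2 volume ^ 2 ≤ energy w g U G t ∧
    eLpNorm (fun x => G (t, x)) 2 volume ^ 2 ≤ energy w g U G t := by
  simp only [eLpNorm_slice_sq, energy]
  refine ⟨?_, ?_, ?_, ?_, le_add_self⟩
  · exact le_add_right (le_add_right (le_add_right le_self_add))
  · exact le_add_right (le_add_right (le_add_right le_add_self))
  · exact le_add_right (le_add_right le_add_self)
  · exact le_add_right le_add_self

theorem mul_le_energy {x y : ℝ≥0∞} {t : ℝ} (hx : x ^ 2 ≤ energy w g U G t)
    (hy : y ^ 2 ≤ energy w g U G t) : x * y ≤ 2 * energy w g U G t := by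
  rw [two_mul]
  exact (ennreal_mul_le_sq_add_sq x y).trans (add_le_add hx hy)

/-- The summand `1` in `energy` serves terms that are linear in a single norm. -/
theorem le_two_mul_energy {x : ℝ≥0∞} {t : ℝ} (hx : x ^ 2 ≤ energy w g U G t) :
    x ≤ 2 * energy w g U G t := by
  rw [two_mul]
  exact (ennreal_le_one_add_sq x).trans (add_le_add (le_energy t).1 hx)

/-- The time derivative of the mollified solution. -/
noncomputable def mollifiedRate (w g : ℝ × E3 → ℝ) (U : ℝ × E3 → E3) (ε : ℝ) (p : ℝ × E3) : ℝ :=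
  (∫ y, w (p.1, y) * fderiv ℝ (fun y => mollifier ε (p.2 - y)) y (U (p.1, y)))
    - ∫ y, g (p.1, y) * mollifier ε (p.2 - y)

theorem measurable_mollify_slice {ε : ℝ} {f : ℝ × E3 → ℝ} (hf : Measurable f) :
    Measurable fun p : ℝ × E3 => mollify ε (fun y => f (p.1, y)) p.2 := by
  have hm := (mollifier_contDiff ε).continuous.measurable
  have : Measurable fun q : (ℝ × E3) × E3 => mollifier ε q.2 * f (q.1.1, q.1.2 - q.2) := by
    fun_prop
  exact this.stronglyMeasurable.integral_prod_right'.measurable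

theorem measurable_mollifiedRate (h : TransportSolution T w g U G w₀) (ε : ℝ) :
    Measurable (mollifiedRate w g U ε) := by
  have hm := (mollifier_contDiff ε).continuous.measurable
  have hw := h.measurable_w
  have hg := h.measurable_g
  have hU := h.measurable_U
  have h1 : Measurable fun q : (ℝ × E3) × E3 => w (q.1.1, q.2) *
      fderiv ℝ (fun y => mollifier ε (q.1.2 - y)) q.2 (U (q.1.1, q.2)) := by
    simp_rw [fderiv_mollifier_sub, neg_apply]
    exact Measurable.mul (by fun_prop)
      (measurable_fderiv_mollifier_apply (by fun_prop) (by fun_prop)).neg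
  have h2 : Measurable fun q : (ℝ × E3) × E3 => g (q.1.1, q.2) * mollifier ε (q.1.2 - q.2) := by
    fun_prop
  exact h1.stronglyMeasurable.integral_prod_right'.measurable.sub
    h2.stronglyMeasurable.integral_prod_right'.measurable

/-- The constant depends on `ε` through the kernel; it is used only for integrability in time at
fixed `ε`. -/
theorem exists_mollified_bound {ε : ℝ} (hε : 0 < ε) (h : TransportSolution T w g U G w₀) :
    ∃ B : ℝ≥0, ∀ p : ℝ × E3, ‖mollify ε (fun y => w (p.1, y)) p.2‖ₑ ≤ B * energy w g U G p.1 ∧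
      ‖mollifiedRate w g U ε p‖ₑ ≤ B * energy w g U G p.1 := by
  obtain ⟨M, hM⟩ := ((mollifier_hasCompactSupport hε).fderiv ℝ).exists_bound_of_continuous
    (continuous_fderiv_mollifier ε)
  have hM0 : 0 ≤ M := (norm_nonneg _).trans (hM 0)
  have hmol := memLp_mollifier hε
  set N := eLpNorm (mollifier ε) 2 volume with hN
  have hNx : ∀ x, eLpNorm (fun y => mollifier ε (x - y)) 2 volume = N := fun x =>
    eLpNorm_comp_measurePreserving hmol.1 (Measure.measurePreserving_sub_left volume x)
  have hNm : ∀ x, AEStronglyMeasurable (fun y => mollifier ε (x - y)) volume := fun x =>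
    (memLp_sub_left hmol x).1
  have hNt : N ≠ ⊤ := hmol.2.ne
  have hs : ∀ {F : Type} [NormedAddCommGroup F] [MeasurableSpace F] [BorelSpace F]
      [SecondCountableTopology F] {f : ℝ × E3 → F}, Measurable f → ∀ t,
      AEStronglyMeasurable (fun x => f (t, x)) (volume : Measure E3) := fun hf t =>
    (hf.comp measurable_prodMk_left).aestronglyMeasurable
  have key : ∀ {f : ℝ × E3 → ℝ}, Measurable f → ∀ p : ℝ × E3,
      ‖∫ y, f (p.1, y) * mollifier ε (p.2 - y)‖ₑ ≤
        eLpNorm (fun x => f (p.1, x)) 2 volume * N := by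
    intro f hf p
    have := enorm_integral_mul_le (M := 1) (hs hf p.1) (hNm p.2) (by simp)
      (c := fun y => f (p.1, y) * mollifier ε (p.2 - y)) fun x => by rw [one_mul, enorm_mul]
    rwa [one_mul, hNx] at this
  refine ⟨2 * N.toNNReal + 2 * M.toNNReal, fun p => ?_⟩
  obtain ⟨e0, e1, e2, e3, e4⟩ := le_energy (w := w) (g := g) (U := U) (G := G) p.1
  have hMe : (M.toNNReal : ℝ≥0∞) = ENNReal.ofReal M := rfl
  rw [ENNReal.coe_add, ENNReal.coe_mul, ENNReal.coe_mul, ENNReal.coe_toNNReal hNt, hMe,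
    ENNReal.coe_ofNat]
  constructor
  · rw [← integral_mul_mollifier_sub]
    refine (key h.measurable_w p).trans ?_
    calc _ ≤ 2 * energy w g U G p.1 * N := by gcongr; exact le_two_mul_energy e1
      _ = 2 * N * energy w g U G p.1 := by ring
      _ ≤ _ := by gcongr; exact le_self_add
  · unfold mollifiedRate
    refine enorm_sub_le.trans ?_
    rw [add_mul, add_comm (2 * N * _)]
    gcongr
    · have := enorm_integral_mul_le (M := ENNReal.ofReal M) (hs h.measurable_w p.1)
        (hs h.measurable_U p.1) (by simp)
        (c := fun y => w (p.1, y) * fderiv ℝ (fun y => mollifier ε (p.2 - y)) y (U (p.1, y)))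
        fun x => by
          rw [enorm_mul, mul_left_comm]
          gcongr
          refine (ContinuousLinearMap.le_opENorm _ _).trans ?_
          gcongr
          rw [fderiv_mollifier_sub, ← ofReal_norm, norm_neg]
          exact ENNReal.ofReal_le_ofReal (hM _)
      refine this.trans ?_
      calc _ ≤ ENNReal.ofReal M * (2 * energy w g U G p.1) :=
            mul_le_mul' le_rfl (mul_le_energy e1 e3)
        _ = _ := by ring
    · refine (key h.measurable_g p).trans ?_
      calc _ ≤ 2 * energy w g U G p.1 * N := by gcongr; exact le_two_mul_energy e2
        _ = _ := by ring

theorem integrableOn_of_le_energy (h : TransportSolution T w g U G w₀) {f : ℝ → ℝ}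
    (hf : Measurable f) {B : ℝ≥0} (hB : ∀ t, ‖f t‖ₑ ≤ B * energy w g U G t) :
    IntegrableOn f (Ioo 0 T) := by
  refine integrable_of_lintegral_le hf (C := B * ∫⁻ t in Ioo 0 T, energy w g U G t)
    (ENNReal.mul_ne_top (by simp) h.lintegral_energy) ?_
  rw [← lintegral_const_mul _ h.measurable_energy]
  exact lintegral_mono hB

theorem isTestFunction_mollifier_sub {ε : ℝ} (hε : 0 < ε) (x : E3) :
    IsTestFunction univ fun y => mollifier ε (x - y) where
  smooth := (mollifier_contDiff ε).comp (contDiff_const.sub contDiff_id)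
  compact_support := (mollifier_hasCompactSupport hε).comp_homeomorph (Homeomorph.subLeft x)
  support_subset := subset_univ _

/-- For every `x`, the mollified solution is absolutely continuous in time. -/
theorem ae_mollify_eq (hT : 0 < T) (h : TransportSolution T w g U G w₀) {ε : ℝ} (hε : 0 < ε)
    (x : E3) : IntervalIntegrable (fun t => mollifiedRate w g U ε (t, x)) volume 0 T ∧
    ∀ᵐ t ∂(volume.restrict (Ioo 0 T)), mollify ε (fun y => w (t, y)) x =
      mollify ε w₀ x + ∫ s in (0 : ℝ)..t, mollifiedRate w g U ε (s, x) := by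
  obtain ⟨B, hB⟩ := exists_mollified_bound hε h
  have hF : IntegrableOn (fun t => mollifiedRate w g U ε (t, x)) (Ioo 0 T) :=
    h.integrableOn_of_le_energy ((h.measurable_mollifiedRate ε).comp measurable_prodMk_right)
      fun t => (hB (t, x)).2
  have hf : IntegrableOn (fun t => mollify ε (fun y => w (t, y)) x) (Ioo 0 T) :=
    h.integrableOn_of_le_energy ((measurable_mollify_slice h.measurable_w).comp
      (measurable_prodMk_right (y := x))) fun t => (hB (t, x)).1
  refine ⟨by rwa [intervalIntegrable_iff_integrableOn_Ioo_of_le hT.le], ?_⟩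
  refine ae_eq_primitive_of_weak_deriv hT hf hF fun χ hχ => ?_
  -- For fixed `x`, the kernel centred at `x` as spatial test function turns the equation into a
  -- weak ordinary differential equation in `t`.
  have := h.weak χ hχ _ (isTestFunction_mollifier_sub hε x)
  simpa only [mollifiedRate, integral_mul_mollifier_sub] using this

/-- At each `x` the chain rule in time is the one-dimensional one; the integrability claim allows
Fubini to exchange the order of the integrals. -/
theorem renormalized_mollified (hT : 0 < T) (h : TransportSolution T w g U G w₀) {ε : ℝ}
    (hε : 0 < ε) {b b' : ℝ → ℝ} {L : ℝ≥0} (hb : ∀ x, HasDerivAt b (b' x) x)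
    (hb'c : Continuous b') (hL : LipschitzWith L b) (hb0 : b 0 = 0) {φ : ℝ × E3 → ℝ}
    (hφ : ContDiff ℝ ∞ φ) (hφc : HasCompactSupport φ) (hφT : ∀ x, φ (T, x) = 0) :
    Integrable (fun p : ℝ × E3 => b (mollify ε (fun y => w (p.1, y)) p.2) * fderiv ℝ φ p (1, 0)
      + b' (mollify ε (fun y => w (p.1, y)) p.2) * mollifiedRate w g U ε p * φ p)
      ((volume.restrict (Ioo 0 T)).prod volume) ∧
    ∫ t in Ioo 0 T, ∫ x, (b (mollify ε (fun y => w (t, y)) x) * fderiv ℝ φ (t, x) (1, 0)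
      + b' (mollify ε (fun y => w (t, y)) x) * mollifiedRate w g U ε (t, x) * φ (t, x))
      = - ∫ x, b (mollify ε w₀ x) * φ (0, x) := by
  obtain ⟨B, hB⟩ := exists_mollified_bound hε h
  have hφ' : Continuous fun p => fderiv ℝ φ p ((1 : ℝ), (0 : E3)) := by
    have := hφ.continuous_fderiv (by simp)
    fun_prop
  have hφ'c : HasCompactSupport fun p => fderiv ℝ φ p ((1 : ℝ), (0 : E3)) :=
    (hφc.fderiv ℝ).comp_left (g := fun A : ℝ × E3 →L[ℝ] ℝ => A (1, 0)) (by simp)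
  obtain ⟨B₁, hB₁, hB₁'⟩ := exists_slice_bound hφ.continuous hφc
  obtain ⟨B₂, hB₂, hB₂'⟩ := exists_slice_bound hφ' hφ'c
  have hmol := measurable_mollify_slice (ε := ε) h.measurable_w
  have hrate := h.measurable_mollifiedRate ε
  set J : ℝ × E3 → ℝ := fun p => b (mollify ε (fun y => w (p.1, y)) p.2) * fderiv ℝ φ p (1, 0)
      + b' (mollify ε (fun y => w (p.1, y)) p.2) * mollifiedRate w g U ε p * φ p with hJ
  have hJm : Measurable J :=
    ((hL.continuous.measurable.comp hmol).mul hφ'.measurable).add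
      (((hb'c.measurable.comp hmol).mul hrate).mul hφ.continuous.measurable)
  have hJi : Integrable J ((volume.restrict (Ioo 0 T)).prod volume) := by
    refine integrable_of_lintegral_le hJm
      (C := ∫⁻ t in Ioo 0 T, (L * B * (B₂ + B₁) : ℝ≥0∞) * energy w g U G t) ?_ ?_
    · rw [lintegral_const_mul _ h.measurable_energy]
      exact ENNReal.mul_ne_top (by finiteness) h.lintegral_energy
    rw [lintegral_prod _ (by fun_prop)]
    refine lintegral_mono fun t => ?_
    calc ∫⁻ x, ‖J (t, x)‖ₑ ≤ ∫⁻ x, L * B * energy w g U G t *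
          (‖fderiv ℝ φ (t, x) (1, 0)‖ₑ + ‖φ (t, x)‖ₑ) := by
          refine lintegral_mono fun x => ?_
          refine (enorm_add_le _ _).trans ?_
          rw [mul_add, enorm_mul, enorm_mul, enorm_mul]
          refine add_le_add (mul_le_mul' ?_ le_rfl) (mul_le_mul' ?_ le_rfl)
          · rw [mul_assoc]
            refine le_trans ?_ (mul_le_mul_right (hB (t, x)).1 (L : ℝ≥0∞))
            rw [enorm_eq_nnnorm, enorm_eq_nnnorm, ← ENNReal.coe_mul, ENNReal.coe_le_coe]
            exact norm_le_of_lipschitz_zero hL hb0 _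
          · rw [mul_assoc]
            refine mul_le_mul' ?_ (hB (t, x)).2
            rw [enorm_eq_nnnorm, ENNReal.coe_le_coe]
            exact norm_deriv_le_of_lipschitz hb hL _
      _ = L * B * energy w g U G t *
          ((∫⁻ x, ‖fderiv ℝ φ (t, x) (1, 0)‖ₑ) + ∫⁻ x, ‖φ (t, x)‖ₑ) := by
          have := hφ.continuous.measurable
          have := hφ'.measurable
          rw [lintegral_const_mul _ (by fun_prop), lintegral_add_left (by fun_prop)]
      _ ≤ L * B * energy w g U G t * (B₂ + B₁) := by
          exact mul_le_mul' le_rfl (add_le_add (hB₂' t).1 (hB₁' t).1)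
      _ = _ := by ring
  refine ⟨hJi, ?_⟩
  rw [integral_integral_swap (f := fun t x => J (t, x)) hJi, ← integral_neg]
  refine integral_congr_ae (Filter.Eventually.of_forall fun x => ?_)
  beta_reduce
  obtain ⟨hFi, hae⟩ := h.ae_mollify_eq hT hε x
  have hφx : ContDiff ℝ 1 fun t => φ (t, x) :=
    (hφ.of_le (by exact_mod_cast le_top)).comp (contDiff_id.prodMk contDiff_const)
  have hd : ∀ t, deriv (fun t => φ (t, x)) t = fderiv ℝ φ (t, x) (1, 0) := fun t =>
    (((hφ.differentiable (by simp)) (t, x)).hasFDerivAt.comp_hasDerivAt t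
      ((hasDerivAt_id t).prodMk (hasDerivAt_const t x))).deriv
  rw [← integral_chain_rule_of_primitive hFi hb hL hφx (hφT x),
    intervalIntegral.integral_of_le hT.le, integral_Ioc_eq_integral_Ioo]
  refine integral_congr_ae ?_
  filter_upwards [hae] with t ht
  simp only [hJ]
  rw [← ht, hd]

/-- The renormalized transport equation. -/
theorem renormalized (hT : 0 < T) (h : TransportSolution T w g U G w₀)
    {b b' : ℝ → ℝ} {L : ℝ≥0} (hb : ∀ x, HasDerivAt b (b' x) x)
    (hb'c : Continuous b') (hL : LipschitzWith L b) (hb0 : b 0 = 0) {φ : ℝ × E3 → ℝ}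
    (hφ : ContDiff ℝ ∞ φ) (hφc : HasCompactSupport φ) (hφT : ∀ x, φ (T, x) = 0) :
    ∫ t in Ioo 0 T, ∫ x, (b (w (t, x)) * (fderiv ℝ φ (t, x) (1, 0) +
        fderiv ℝ φ (t, x) (0, U (t, x)) + φ (t, x) * traceCLM (G (t, x)))
      - b' (w (t, x)) * ((w (t, x) * traceCLM (G (t, x)) + g (t, x)) * φ (t, x)))
      = - ∫ x, b (w₀ x) * φ (0, x) := by
  set ε : ℕ → ℝ := fun n => 1 / ((n : ℝ) + 1) with hεdef
  have hε : ∀ n, 0 < ε n := fun n => by positivity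
  have hε0 : Tendsto ε atTop (𝓝 0) := tendsto_one_div_add_atTop_nhds_zero_nat
  have hb' := norm_deriv_le_of_lipschitz hb hL
  obtain ⟨C, hCt, hC⟩ := exists_lintegral_fderiv_mollifier_le
  obtain ⟨c, hc0, hc⟩ := exists_abs_traceCLM_le
  have hφ'0 : Continuous (fderiv ℝ φ) := hφ.continuous_fderiv (by simp)
  have hφ' : Continuous fun p => fderiv ℝ φ p ((1 : ℝ), (0 : E3)) := by fun_prop
  have hφ'c : HasCompactSupport fun p => fderiv ℝ φ p ((1 : ℝ), (0 : E3)) :=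
    (hφc.fderiv ℝ).comp_left (g := fun A : ℝ × E3 →L[ℝ] ℝ => A (1, 0)) (by simp)
  obtain ⟨B₁, hB₁, hB₁'⟩ := exists_slice_bound hφ.continuous hφc
  obtain ⟨B₂, hB₂, hB₂'⟩ := exists_slice_bound hφ' hφ'c
  obtain ⟨M, hM⟩ := (hφc.fderiv ℝ).exists_bound_of_continuous hφ'0
  have hM0 : 0 ≤ M := (norm_nonneg _).trans (hM 0)
  have hslice : ∀ t, ContDiff ℝ 1 fun x => φ (t, x) := fun t =>
    (hφ.of_le (by exact_mod_cast le_top)).comp (contDiff_const.prodMk contDiff_id)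
  have hcomp : ∀ {k : ℝ × E3 → ℝ}, HasCompactSupport k → ∀ t : ℝ,
      HasCompactSupport fun x => k (t, x) := fun {k} hk t =>
    HasCompactSupport.of_support_subset_isCompact (hk.isCompact.image continuous_snd)
      fun x hx => ⟨(t, x), subset_tsupport _ hx, rfl⟩
  have hslice' : ∀ t x a, fderiv ℝ (fun x => φ (t, x)) x a = fderiv ℝ φ (t, x) (0, a) := by
    intro t x a
    have := ((hφ.differentiable (by simp)) (t, x)).hasFDerivAt.comp x
      ((hasFDerivAt_const t x).prodMk (hasFDerivAt_id x))
    rw [show (fun x => φ (t, x)) = φ ∘ fun x => (t, x) from rfl, this.fderiv]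
    rfl
  set H : ℝ × E3 → ℝ := fun p => fderiv ℝ φ p (1, 0) + fderiv ℝ φ p (0, U p) +
    φ p * traceCLM (G p) with hH
  -- The slice integral after integration by parts in space: in this form every factor has a limit
  -- as `ε n → 0`.
  set K : ℕ → ℝ → ℝ := fun n t => ∫ x, (b (mollify (ε n) (fun y => w (t, y)) x) * H (t, x)
    - b' (mollify (ε n) (fun y => w (t, y)) x) *
      ((transportCommutator (ε n) (fun y => w (t, y)) (fun y => U (t, y)) x +
        mollify (ε n) (fun y => g (t, y)) x) * φ (t, x))) with hK
  have hwm : ∀ t, Measurable fun x => w (t, x) := fun t =>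
    h.measurable_w.comp measurable_prodMk_left
  have hgm : ∀ t, Measurable fun x => g (t, x) := fun t =>
    h.measurable_g.comp measurable_prodMk_left
  have hUm : ∀ t, Measurable fun x => U (t, x) := fun t =>
    h.measurable_U.comp measurable_prodMk_left
  have hGm : ∀ t, Measurable fun x => G (t, x) := fun t =>
    h.measurable_G.comp measurable_prodMk_left
  have hHm : Measurable H := by
    refine (hφ'.measurable.add ?_).add (hφ.continuous.measurable.mul
      (traceCLM.continuous.measurable.comp h.measurable_G))
    exact (isBoundedBilinearMap_apply (𝕜 := ℝ) (E := ℝ × E3) (F := ℝ)).continuous.measurable.comp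
      (hφ'0.measurable.prodMk (measurable_const.prodMk h.measurable_U))
  have hHtm : ∀ t, Measurable fun x => H (t, x) := fun t => hHm.comp measurable_prodMk_left
  have hHL : ∀ t, MemLp (fun x => U (t, x)) 2 volume → MemLp (fun x => G (t, x)) 2 volume →
      MemLp (fun x => H (t, x)) 2 volume ∧ eLpNorm (fun x => H (t, x)) 2 volume ≤
        B₂ + ENNReal.ofReal M * eLpNorm (fun x => U (t, x)) 2 volume +
        ENNReal.ofReal (B₁ * c) * eLpNorm (fun x => G (t, x)) 2 volume := by
    intro t hU hG
    have m1 : MemLp (fun x => fderiv ℝ φ (t, x) (1, 0)) 2 volume :=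
      memLp_of_smooth (hφ'.comp (by fun_prop)) (hcomp hφ'c t)
    have m2 : MemLp (fun x => fderiv ℝ φ (t, x) (0, U (t, x))) 2 volume := by
      simpa only [hslice'] using memLp_fderiv_apply (hslice t) (hcomp hφc t) hU
    have m3 : MemLp (fun x => φ (t, x) * traceCLM (G (t, x))) 2 volume :=
      memLp_mul_traceCLM (hslice t).continuous (hcomp hφc t) hG
    refine ⟨(m1.add m2).add m3, ?_⟩
    refine (eLpNorm_add_le (m1.add m2).1 m3.1 (by norm_num)).trans (add_le_add
      ((eLpNorm_add_le m1.1 m2.1 (by norm_num)).trans (add_le_add (hB₂' t).2 ?_)) ?_)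
    · refine eLpNorm_le_mul_eLpNorm_of_ae_le_mul (Filter.Eventually.of_forall fun x => ?_) _
      refine (ContinuousLinearMap.le_opNorm _ _).trans ?_
      gcongr
      · exact hM _
      · simp
    · refine eLpNorm_le_mul_eLpNorm_of_ae_le_mul (Filter.Eventually.of_forall fun x => ?_) _
      rw [norm_mul, mul_assoc]
      gcongr
      · exact hB₁ _
      · exact hc _
  have hgood : ∀ᵐ t ∂(volume.restrict (Ioo 0 T)), MemLp (fun x => w (t, x)) 2 volume ∧
      MemLp (fun x => g (t, x)) 2 volume ∧ IsH1 (fun x => U (t, x)) (fun x => G (t, x)) := by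
    filter_upwards [ae_memLp_slice h.measurable_w h.memLp_w,
      ae_memLp_slice h.measurable_g h.memLp_g, h.isH1] with t h1 h2 h3
    exact ⟨h1, h2, h3⟩
  have hKJ : ∀ n, (fun t => ∫ x, (b (mollify (ε n) (fun y => w (t, y)) x) *
        fderiv ℝ φ (t, x) (1, 0) + b' (mollify (ε n) (fun y => w (t, y)) x) *
        mollifiedRate w g U (ε n) (t, x) * φ (t, x))) =ᵐ[volume.restrict (Ioo 0 T)] K n := by
    intro n
    filter_upwards [hgood] with t ht
    have := integral_mollified_renormalized (hε n) hb hb'c hL hb0 ht.1 (hwm t) ht.2.1 (hgm t)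
      (hUm t) (hGm t) ht.2.2 (hslice t) (hcomp hφc t)
      (hφ'.comp (Continuous.prodMk_right t)) (hcomp hφ'c t)
    simp only [hslice'] at this
    exact this
  have hKint : ∀ n, ∫ t in Ioo 0 T, K n t = - ∫ x, b (mollify (ε n) w₀ x) * φ (0, x) := by
    intro n
    rw [← (h.renormalized_mollified hT (hε n) hb hb'c hL hb0 hφ hφc hφT).2]
    exact (integral_congr_ae (hKJ n)).symm
  -- Collects the slice bounds of the two halves of `K`. It does not depend on `n`, because the
  -- bounds on the mollified terms and on the commutator are uniform in `ε`.
  set D : ℝ≥0 := L * (2 * B₂ + 2 * M.toNNReal + 2 * (B₁ * c).toNNReal) +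
    L * (B₁ * (C.toNNReal * 2) + 2 * B₁) with hD
  have hbound : ∀ n, ∀ᵐ t ∂(volume.restrict (Ioo 0 T)), ‖K n t‖ₑ ≤ D * energy w g U G t := by
    intro n
    filter_upwards [hgood] with t ht
    obtain ⟨e0, e1, e2, e3, e4⟩ := le_energy (w := w) (g := g) (U := U) (G := G) t
    obtain ⟨hHt, hHb⟩ := hHL t ht.2.2.memLp ht.2.2.memLp_grad
    obtain ⟨i1, n1⟩ := integrable_mollify_comp_mul (hε n) hL hb0 ht.1 (hwm t) hHt (hHtm t)
    obtain ⟨i2, n2⟩ := integrable_bounded_mul_commutator hCt (hε n) (hC _ (hε n)) hb'c hb' ht.1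
      (hwm t) ht.2.1 (hgm t) (hUm t) ht.2.2 (hslice t).continuous (hcomp hφc t)
      (fun x => hB₁ (t, x))
    have hKs : K n t = _ := integral_sub i1 i2
    rw [hKs]
    refine enorm_sub_le.trans ?_
    have s1 : ‖∫ x, b (mollify (ε n) (fun y => w (t, y)) x) * H (t, x)‖ₑ ≤
        L * (2 * B₂ + 2 * ENNReal.ofReal M + 2 * ENNReal.ofReal (B₁ * c)) *
          energy w g U G t := by
      refine (enorm_integral_le_lintegral_enorm _).trans (n1.trans ?_)
      rw [mul_assoc]
      refine mul_le_mul' le_rfl ?_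
      calc _ ≤ eLpNorm (fun x => w (t, x)) 2 volume *
            (B₂ + ENNReal.ofReal M * eLpNorm (fun x => U (t, x)) 2 volume +
            ENNReal.ofReal (B₁ * c) * eLpNorm (fun x => G (t, x)) 2 volume) :=
            mul_le_mul' le_rfl hHb
        _ = B₂ * eLpNorm (fun x => w (t, x)) 2 volume + ENNReal.ofReal M *
            (eLpNorm (fun x => w (t, x)) 2 volume * eLpNorm (fun x => U (t, x)) 2 volume) +
            ENNReal.ofReal (B₁ * c) *
            (eLpNorm (fun x => w (t, x)) 2 volume * eLpNorm (fun x => G (t, x)) 2 volume) := by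
            ring
        _ ≤ B₂ * (2 * energy w g U G t) + ENNReal.ofReal M * (2 * energy w g U G t) +
            ENNReal.ofReal (B₁ * c) * (2 * energy w g U G t) :=
            add_le_add (add_le_add (mul_le_mul' le_rfl (le_two_mul_energy e1))
              (mul_le_mul' le_rfl (mul_le_energy e1 e3))) (mul_le_mul' le_rfl (mul_le_energy e1 e4))
        _ = _ := by ring
    have s2 : ‖∫ x, b' (mollify (ε n) (fun y => w (t, y)) x) *
        ((transportCommutator (ε n) (fun y => w (t, y)) (fun y => U (t, y)) x +
        mollify (ε n) (fun y => g (t, y)) x) * φ (t, x))‖ₑ ≤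
        L * (B₁ * (C * 2) + 2 * B₁) * energy w g U G t := by
      refine (enorm_integral_le_lintegral_enorm _).trans (n2.trans ?_)
      rw [mul_assoc]
      refine mul_le_mul' le_rfl ?_
      calc _ ≤ B₁ * (C * (2 * energy w g U G t)) + 2 * energy w g U G t * B₁ :=
            add_le_add (mul_le_mul' le_rfl (mul_le_mul' le_rfl (mul_le_energy e1 e4)))
              (mul_le_mul' (le_two_mul_energy e2) (hB₁' t).2)
        _ = _ := by ring
    refine (add_le_add s1 s2).trans (le_of_eq ?_)
    have hMe : (M.toNNReal : ℝ≥0∞) = ENNReal.ofReal M := rfl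
    have hce : ((B₁ * c : ℝ).toNNReal : ℝ≥0∞) = ENNReal.ofReal (B₁ * c) := rfl
    rw [← add_mul, hD, ← hMe, ← hce]
    simp only [ENNReal.coe_add, ENNReal.coe_mul, ENNReal.coe_toNNReal hCt, ENNReal.coe_ofNat]
  have hlim : ∀ᵐ t ∂(volume.restrict (Ioo 0 T)), Tendsto (fun n => K n t) atTop
      (𝓝 (∫ x, (b (w (t, x)) * H (t, x)
        - b' (w (t, x)) * ((w (t, x) * traceCLM (G (t, x)) + g (t, x)) * φ (t, x))))) := by
    filter_upwards [hgood] with t ht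
    obtain ⟨hHt, hHb⟩ := hHL t ht.2.2.memLp ht.2.2.memLp_grad
    have l1 := tendsto_integral_mollify_comp_mul hε hε0 hL hb0 ht.1 (hwm t) hHt (hHtm t)
    have l2 := tendsto_integral_bounded_mul_commutator hε hε0 hb'c hb' ht.1 (hwm t) ht.2.1
      (hgm t) (hUm t) (hGm t) ht.2.2 (hslice t).continuous (hcomp hφc t)
    have hi1 : Integrable fun x => b (w (t, x)) * H (t, x) := by
      refine integrable_of_enorm_le_mul (a := fun x => (L : ℝ) * w (t, x)) (ht.1.const_mul _) hHt
        ((hL.continuous.measurable.comp (hwm t)).mul (hHtm t)).aestronglyMeasurable fun x => ?_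
      rw [norm_mul, norm_mul]
      gcongr
      simpa using norm_le_of_lipschitz_zero hL hb0 (w (t, x))
    have hi2 : Integrable fun x => b' (w (t, x)) *
        ((w (t, x) * traceCLM (G (t, x)) + g (t, x)) * φ (t, x)) := by
      refine Integrable.bdd_mul (c := L) ?_
        (hb'c.measurable.comp (hwm t)).aestronglyMeasurable
        (Filter.Eventually.of_forall fun x => hb' _)
      have htm : Measurable fun x => traceCLM (G (t, x)) :=
        traceCLM.continuous.measurable.comp (hGm t)
      simp_rw [add_mul]
      have hφm := (hslice t).continuous.measurable
      refine Integrable.add ?_ ?_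
      · refine integrable_of_enorm_le_mul ht.1 (memLp_mul_traceCLM (hslice t).continuous
          (hcomp hφc t) ht.2.2.memLp_grad)
          (((hwm t).mul htm).mul hφm).aestronglyMeasurable fun x => ?_
        rw [← norm_mul]
        exact le_of_eq (by congr 1; ring)
      · exact integrable_of_enorm_le_mul ht.2.1 (memLp_of_smooth (hslice t).continuous
          (hcomp hφc t)) ((hgm t).mul hφm).aestronglyMeasurable fun x => (norm_mul _ _).le
    rw [integral_sub hi1 hi2]
    refine (l1.sub l2).congr fun n => ?_
    rw [← integral_sub (integrable_mollify_comp_mul (hε n) hL hb0 ht.1 (hwm t) hHt (hHtm t)).1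
      (integrable_bounded_mul_commutator hCt (hε n) (hC _ (hε n)) hb'c hb' ht.1
      (hwm t) ht.2.1 (hgm t) (hUm t) ht.2.2 (hslice t).continuous (hcomp hφc t)
      (fun x => hB₁ (t, x))).1]
  have hDE : ∀ t, energy w g U G t ≠ ⊤ → ∀ k : ℝ, ‖k‖ₑ ≤ D * energy w g U G t →
      ‖k‖ ≤ (D * energy w g U G t).toReal := by
    intro t ht k hk
    rw [← toReal_enorm]
    exact ENNReal.toReal_mono (ENNReal.mul_ne_top (by simp) ht) hk
  have hfin := ae_lt_top h.measurable_energy h.lintegral_energy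
  -- The spatial limit holds for a.e. fixed time; the time integral follows by domination with a
  -- multiple of the integrable `energy`.
  have hDCT := tendsto_integral_of_dominated_convergence
    (fun t => (D * energy w g U G t).toReal)
    (fun n => ((h.renormalized_mollified hT (hε n) hb hb'c hL hb0 hφ hφc
      hφT).1.integral_prod_left.1.congr (hKJ n)))
    (integrable_toReal_of_lintegral_ne_top (h.measurable_energy.const_mul _).aemeasurable (by
      rw [lintegral_const_mul _ h.measurable_energy]
      exact ENNReal.mul_ne_top (by simp) h.lintegral_energy))
    (fun n => by
      filter_upwards [hbound n, hfin] with t h1 h2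
      exact hDE t h2.ne _ h1) hlim
  simp_rw [hKint] at hDCT
  refine tendsto_nhds_unique hDCT (Tendsto.neg ?_)
  exact tendsto_integral_mollify_comp_mul hε hε0 hL hb0 h.memLp_init h.measurable_init
    (memLp_of_smooth (hslice 0).continuous (hcomp hφc 0)) (hslice 0).continuous.measurable

end TransportSolution

/-! ### Lipschitz boundary, boundary cutoffs and extension by zero -/

/-- Near a Lipschitz boundary, a translation of length comparable to the distance to the
complement, in one of finitely many directions, leaves the domain. -/
theorem HasLipschitzBoundary.exists_exterior_directions {Ω : Set E3} (hΩo : IsOpen Ω)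
    (hΩb : Bornology.IsBounded Ω) (hΩL : HasLipschitzBoundary Ω) :
    ∃ (V : Finset E3) (δ₀ : ℝ), 0 < δ₀ ∧ ∀ δ, 0 < δ → δ < δ₀ → ∀ x ∈ Ω,
      Metric.infDist x Ωᶜ < δ → ∃ e ∈ V, x - δ • e ∉ Ω := by
  have hcompact : IsCompact (frontier Ω) :=
    Metric.isCompact_of_isClosed_isBounded isClosed_frontier
      (hΩb.closure.subset frontier_subset_closure)
  have key : ∃ (V : Finset E3) (δ₀ : ℝ), 0 < δ₀ ∧ ∀ δ, 0 < δ → δ < δ₀ → ∀ x ∈ Ω,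
      (∃ z ∈ frontier Ω, dist x z < δ) → ∃ e ∈ V, x - δ • e ∉ Ω := by
    classical
    -- Compactness of the boundary leaves finitely many charts, hence finitely many directions and
    -- one threshold `δ₀`.
    refine hcompact.induction_on
      (p := fun s => ∃ (V : Finset E3) (δ₀ : ℝ), 0 < δ₀ ∧ ∀ δ, 0 < δ → δ < δ₀ → ∀ x ∈ Ω,
        (∃ z ∈ s, dist x z < δ) → ∃ e ∈ V, x - δ • e ∉ Ω) ?_ ?_ ?_ ?_
    · exact ⟨∅, 1, one_pos, fun δ _ _ x _ ⟨z, hz, _⟩ => absurd hz (notMem_empty z)⟩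
    · rintro s t hst ⟨V, δ₀, h0, h⟩
      exact ⟨V, δ₀, h0, fun δ h1 h2 x hx ⟨z, hz, hd⟩ => h δ h1 h2 x hx ⟨z, hst hz, hd⟩⟩
    · rintro s t ⟨V, δ₀, h0, h⟩ ⟨V', δ₀', h0', h'⟩
      refine ⟨V ∪ V', min δ₀ δ₀', lt_min h0 h0', fun δ h1 h2 x hx ⟨z, hz, hd⟩ => ?_⟩
      rcases hz with hz | hz
      · obtain ⟨e, he, hn⟩ := h δ h1 (h2.trans_le (min_le_left _ _)) x hx ⟨z, hz, hd⟩
        exact ⟨e, Finset.mem_union_left _ he, hn⟩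
      · obtain ⟨e, he, hn⟩ := h' δ h1 (h2.trans_le (min_le_right _ _)) x hx ⟨z, hz, hd⟩
        exact ⟨e, Finset.mem_union_right _ he, hn⟩
    · intro x₀ hx₀
      obtain ⟨e, γ, K, r, hr, hγ, hiff⟩ := hΩL x₀ hx₀
      set a : E3 := e.symm (EuclideanSpace.single 2 (1 : ℝ)) with ha
      have hna : ‖a‖ = 1 := by rw [ha, LinearIsometryEquiv.norm_map]; simp
      have hK0 : (0 : ℝ) ≤ K := K.coe_nonneg
      -- A boundary point `z` within `δ` of `x` satisfies `z₂ ≤ γ(z')`, so the height of `x` exceeds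
      -- `γ(x')` by at most `K δ + δ`; descending by `(K + 1) δ` leaves the domain. The bound on `δ`
      -- makes this descent shorter than `r / 4`, so the shifted point stays in the chart.
      refine ⟨Metric.ball x₀ (r / 4) ∩ frontier Ω, ?_, {((K : ℝ) + 1) • a},
        r / (4 * (K + 1)), by positivity, ?_⟩
      · rw [inter_comm]
        exact inter_mem_nhdsWithin _ (Metric.ball_mem_nhds _ (by positivity))
      rintro δ hδ0 hδ x hx ⟨z, ⟨hzb, hzf⟩, hd⟩
      refine ⟨_, Finset.mem_singleton_self _, fun hmem => ?_⟩
      rw [lt_div_iff₀ (by positivity)] at hδ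
      have hδr : δ < r / 4 := by nlinarith
      have hzΩ : z ∉ Ω := fun h => by
        rw [hΩo.frontier_eq] at hzf
        exact hzf.2 h
      have hxz : dist x x₀ < r / 2 := by
        have := dist_triangle x z x₀
        rw [Metric.mem_ball] at hzb
        linarith
      have hz' : ¬ γ !₂[e z 0, e z 1] < e z 2 := fun h => hzΩ ((hiff z (by
        rw [Metric.mem_ball] at hzb ⊢; linarith)).mpr h)
      have hs : dist (x - δ • ((K : ℝ) + 1) • a) x₀ < r := by
        have h1 := dist_triangle (x - δ • ((K : ℝ) + 1) • a) x x₀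
        have h2 : dist (x - δ • ((K : ℝ) + 1) • a) x = δ * (K + 1) := by
          rw [dist_eq_norm, sub_sub_cancel_left, norm_neg, norm_smul, norm_smul, hna,
            Real.norm_of_nonneg hδ0.le, Real.norm_of_nonneg (by positivity), mul_one]
        linarith
      have hm := (hiff _ (Metric.mem_ball.mpr hs)).mp hmem
      have hea : e a = EuclideanSpace.single 2 (1 : ℝ) := by simp [ha]
      have e0 : e (x - δ • ((K : ℝ) + 1) • a) 0 = e x 0 := by
        rw [map_sub, map_smul, map_smul, hea]; simp
      have e1 : e (x - δ • ((K : ℝ) + 1) • a) 1 = e x 1 := by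
        rw [map_sub, map_smul, map_smul, hea]; simp
      have e2 : e (x - δ • ((K : ℝ) + 1) • a) 2 = e x 2 - δ * (K + 1) := by
        rw [map_sub, map_smul, map_smul, hea]; simp
      rw [e0, e1, e2] at hm
      have hde : dist (e x) (e z) < δ := by rwa [e.dist_map]
      have hsq : dist (e x) (e z) ^ 2 = (e x 0 - e z 0) ^ 2 + (e x 1 - e z 1) ^ 2 +
          (e x 2 - e z 2) ^ 2 := by
        rw [EuclideanSpace.dist_eq, Real.sq_sqrt (Finset.sum_nonneg fun _ _ => sq_nonneg _),
          Fin.sum_univ_three]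
        simp [Real.dist_eq, sq_abs]
      have hsq2 : dist (!₂[e x 0, e x 1] : EuclideanSpace ℝ (Fin 2)) !₂[e z 0, e z 1] ^ 2 =
          (e x 0 - e z 0) ^ 2 + (e x 1 - e z 1) ^ 2 := by
        rw [EuclideanSpace.dist_eq, Real.sq_sqrt (Finset.sum_nonneg fun _ _ => sq_nonneg _),
          Fin.sum_univ_two]
        simp [Real.dist_eq, sq_abs]
      have hd2 : dist (!₂[e x 0, e x 1] : EuclideanSpace ℝ (Fin 2)) !₂[e z 0, e z 1] ≤ δ := by
        refine (abs_le_of_sq_le_sq' ?_ hδ0.le).2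
        have : dist (e x) (e z) ^ 2 ≤ δ ^ 2 := by gcongr
        nlinarith [sq_nonneg (e x 2 - e z 2)]
      have hd3 : e x 2 - e z 2 ≤ δ := by
        refine (abs_le_of_sq_le_sq' ?_ hδ0.le).2
        have : dist (e x) (e z) ^ 2 ≤ δ ^ 2 := by gcongr
        nlinarith [sq_nonneg (e x 0 - e z 0), sq_nonneg (e x 1 - e z 1)]
      have hγd := hγ.dist_le_mul !₂[e x 0, e x 1] !₂[e z 0, e z 1]
      rw [Real.dist_eq] at hγd
      have hγd' := (abs_le.mp hγd).1
      have : (K : ℝ) * dist (!₂[e x 0, e x 1] : EuclideanSpace ℝ (Fin 2)) !₂[e z 0, e z 1]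
          ≤ K * δ := by gcongr
      rw [not_lt] at hz'
      nlinarith
  obtain ⟨V, δ₀, h0, h⟩ := key
  refine ⟨V, δ₀, h0, fun δ h1 h2 x hx hd => h δ h1 h2 x hx ?_⟩
  have hne : Ω ≠ univ := fun hu => by
    rw [hu] at hΩb
    exact NormedSpace.unbounded_univ ℝ E3 hΩb
  obtain ⟨z, hz, he⟩ := exists_mem_frontier_infDist_compl_eq_dist hx hne
  exact ⟨z, hz, he ▸ hd⟩

/-- The points of `Ω` at distance less than `δ` from the complement. -/
def boundaryStrip (Ω : Set E3) (δ : ℝ) : Set E3 := {x | x ∈ Ω ∧ Metric.infDist x Ωᶜ < δ}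

theorem measurableSet_boundaryStrip {Ω : Set E3} (hΩo : IsOpen Ω) (δ : ℝ) :
    MeasurableSet (boundaryStrip Ω δ) :=
  hΩo.measurableSet.inter
    (measurableSet_lt (Metric.continuous_infDist_pt _).measurable measurable_const)

/-- The Poincaré inequality in the boundary strip. -/
theorem exists_eLpNorm_boundaryStrip_le {Ω : Set E3} (hΩo : IsOpen Ω)
    (hΩb : Bornology.IsBounded Ω) (hΩL : HasLipschitzBoundary Ω) :
    ∃ (C : ℝ≥0) (δ₀ : ℝ), 0 < δ₀ ∧ ∀ δ, 0 < δ → δ < δ₀ → ∀ (v : E3 → E3)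
      (G : E3 → E3 →L[ℝ] E3), IsH1 v G → (∀ x ∉ Ω, v x = 0) →
      eLpNorm ((boundaryStrip Ω δ).indicator v) 2 volume ≤
        C * (ENNReal.ofReal δ * eLpNorm G 2 volume) := by
  obtain ⟨V, δ₀, h0, h⟩ := hΩL.exists_exterior_directions hΩo hΩb
  refine ⟨∑ e ∈ V, ‖e‖₊, δ₀, h0, fun δ hδ0 hδ v G hv hv0 => ?_⟩
  have hm : ∀ e ∈ V, AEStronglyMeasurable (fun x => ‖v (x - δ • e) - v x‖) volume := fun e _ =>
    ((hv.memLp.1.comp_measurePreserving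
      (measurePreserving_sub_right volume (δ • e))).sub hv.memLp.1).norm
  calc eLpNorm ((boundaryStrip Ω δ).indicator v) 2 volume
      ≤ eLpNorm (∑ e ∈ V, fun x => ‖v (x - δ • e) - v x‖) 2 volume := by
        refine eLpNorm_mono_real fun x => ?_
        rw [Finset.sum_apply]
        by_cases hx : x ∈ boundaryStrip Ω δ
        · rw [indicator_of_mem hx]
          -- The shifted point is outside `Ω`, where `v = 0`, so `‖v x‖` is itself a translation
          -- difference. Summing over all directions avoids a measurable choice of `e`.
          obtain ⟨e, he, hn⟩ := h δ hδ0 hδ x hx.1 hx.2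
          have : ‖v x‖ = ‖v (x - δ • e) - v x‖ := by rw [hv0 _ hn]; simp
          rw [this]
          exact Finset.single_le_sum (f := fun e => ‖v (x - δ • e) - v x‖)
            (fun _ _ => norm_nonneg _) he
        · rw [indicator_of_notMem hx, norm_zero]
          exact Finset.sum_nonneg fun _ _ => norm_nonneg _
    _ ≤ ∑ e ∈ V, eLpNorm (fun x => ‖v (x - δ • e) - v x‖) 2 volume :=
        eLpNorm_sum_le hm (by norm_num)
    _ ≤ ∑ e ∈ V, ‖e‖ₑ * (ENNReal.ofReal δ * eLpNorm G 2 volume) := by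
        refine Finset.sum_le_sum fun e _ => ?_
        rw [eLpNorm_norm]
        refine (hv.eLpNorm_translate_sub_le (δ • e)).trans (le_of_eq ?_)
        rw [enorm_smul, Real.enorm_of_nonneg hδ0.le]
        ring
    _ = _ := by
        rw [← Finset.sum_mul]
        congr 1
        simp [enorm_eq_nnnorm]

/-- Take the piecewise linear ramp in the distance to the complement, rising from `0` at `δ/4` to
`1` at `δ/2`, and mollify it at scale `δ/8`. The result vanishes at distance at most `δ/8`, equals
`1` from `5δ/8` on, and keeps the Lipschitz constant `4/δ`. -/
theorem exists_boundary_cutoff {Ω : Set E3} (hΩb : Bornology.IsBounded Ω) {δ : ℝ} (hδ : 0 < δ) :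
    ∃ ζ : E3 → ℝ, IsTestFunction Ω ζ ∧ (∀ x, ‖ζ x‖ ≤ 1) ∧
      (∀ x, δ ≤ Metric.infDist x Ωᶜ → ζ x = 1) ∧
      (∀ x, ‖fderiv ℝ ζ x‖ ≤ 4 / δ) ∧ ∀ x, x ∉ boundaryStrip Ω δ → fderiv ℝ ζ x = 0 := by
  set d : E3 → ℝ := fun x => Metric.infDist x Ωᶜ with hd
  have hdl : ∀ x y, |d x - d y| ≤ dist x y := fun x y => by
    have := (Metric.lipschitz_infDist_pt Ωᶜ).dist_le_mul x y
    simpa [Real.dist_eq] using this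
  have hd0 : ∀ x ∉ Ω, d x = 0 := fun x hx => Metric.infDist_zero_of_mem hx
  set q : E3 → ℝ := fun x => max 0 (min 1 (4 / δ * d x - 1)) with hq
  have hql : ∀ x y, |q x - q y| ≤ 4 / δ * dist x y := by
    intro x y
    calc |q x - q y| ≤ |min 1 (4 / δ * d x - 1) - min 1 (4 / δ * d y - 1)| := by
          simpa using abs_max_sub_max_le_max 0 (min 1 (4 / δ * d x - 1)) 0
            (min 1 (4 / δ * d y - 1))
      _ ≤ |(4 / δ * d x - 1) - (4 / δ * d y - 1)| := by
          simpa using abs_min_sub_min_le_max 1 (4 / δ * d x - 1) 1 (4 / δ * d y - 1)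
      _ = 4 / δ * |d x - d y| := by
          rw [sub_sub_sub_cancel_right, ← mul_sub, abs_mul, abs_of_pos (by positivity)]
      _ ≤ _ := by gcongr; exact hdl x y
  have hq01 : ∀ x, 0 ≤ q x ∧ q x ≤ 1 := fun x =>
    ⟨le_max_left _ _, max_le zero_le_one (min_le_left _ _)⟩
  have hqc : Continuous q := by
    have : Continuous d := Metric.continuous_infDist_pt _
    fun_prop
  have hq0 : ∀ x, d x ≤ δ / 4 → q x = 0 := fun x hx => by
    refine max_eq_left ((min_le_right _ _).trans ?_)
    have : 4 / δ * d x ≤ 4 / δ * (δ / 4) := by gcongr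
    have h4 : 4 / δ * (δ / 4) = 1 := by field_simp
    linarith
  have hq1 : ∀ x, δ / 2 ≤ d x → q x = 1 := fun x hx => by
    have : 4 / δ * (δ / 2) ≤ 4 / δ * d x := by gcongr
    have h4 : 4 / δ * (δ / 2) = 2 := by field_simp; norm_num
    rw [hq]
    simp only
    rw [min_eq_left (by linarith), max_eq_right zero_le_one]
  have hε : 0 < δ / 8 := by positivity
  have hmi : Integrable (mollifier (δ / 8)) :=
    (mollifier_contDiff _).continuous.integrable_of_hasCompactSupport
      (mollifier_hasCompactSupport hε)
  have hmq : ∀ x, Integrable fun h => mollifier (δ / 8) h * q (x - h) := fun x =>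
    hmi.mul_bdd (c := 1) (hqc.comp (by fun_prop)).aestronglyMeasurable
      (Filter.Eventually.of_forall fun h => by
        rw [Real.norm_of_nonneg (hq01 _).1]; exact (hq01 _).2)
  have hm0 : ∀ h : E3, δ / 8 < ‖h‖ → mollifier (δ / 8) h = 0 := fun h hh =>
    image_eq_zero_of_notMem_tsupport fun h' => not_le.mpr hh
      (mem_closedBall_zero_iff.mp (tsupport_mollifier_subset hε h'))
  set ζ := mollify (δ / 8) q with hζ
  have hζs : ContDiff ℝ ∞ ζ := by
    rw [hζ, mollify_eq_convolution]
    exact (mollifier_hasCompactSupport hε).contDiff_convolution_left _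
      (mollifier_contDiff _) hqc.locallyIntegrable
  have hdsub : ∀ x h : E3, ‖h‖ ≤ δ / 8 → |d (x - h) - d x| ≤ δ / 8 := fun x h hh => by
    refine (hdl _ _).trans ?_
    rwa [dist_eq_norm, sub_sub_cancel_left, norm_neg]
  have hζ1 : ∀ x, 5 * δ / 8 ≤ d x → ζ x = 1 := by
    intro x hx
    rw [hζ, mollify, ← integral_mollifier hε]
    refine integral_congr_ae (Filter.Eventually.of_forall fun h => ?_)
    beta_reduce
    by_cases hh : ‖h‖ ≤ δ / 8
    · rw [hq1 (x - h) (by have := (abs_le.mp (hdsub x h hh)).1; linarith), mul_one]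
    · rw [hm0 h (not_le.mp hh), zero_mul]
  have hζ0 : ∀ x, d x ≤ δ / 8 → ζ x = 0 := by
    intro x hx
    rw [hζ, mollify]
    refine integral_eq_zero_of_ae (Filter.Eventually.of_forall fun h => ?_)
    simp only [Pi.zero_apply]
    by_cases hh : ‖h‖ ≤ δ / 8
    · rw [hq0 (x - h) (by have := (abs_le.mp (hdsub x h hh)).2; linarith), mul_zero]
    · rw [hm0 h (not_le.mp hh), zero_mul]
  have hsupp : tsupport ζ ⊆ {x | δ / 8 ≤ d x} := by
    refine closure_minimal (fun x hx => ?_)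
      (isClosed_le continuous_const (Metric.continuous_infDist_pt _))
    by_contra hn
    exact hx (hζ0 x (not_le.mp hn).le)
  have hsuppΩ : tsupport ζ ⊆ Ω := fun x hx => by
    by_contra hn
    have := hsupp hx
    simp only [Set.mem_ofPred_eq, hd0 x hn] at this
    linarith
  refine ⟨ζ, ⟨hζs, ?_, hsuppΩ⟩, fun x => ?_, fun x hx => hζ1 x ?_, fun x => ?_, fun x hx => ?_⟩
  · exact Metric.isCompact_of_isClosed_isBounded (isClosed_tsupport _) (hΩb.subset hsuppΩ)
  · calc ‖ζ x‖ ≤ ∫ h, ‖mollifier (δ / 8) h * q (x - h)‖ := norm_integral_le_integral_norm _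
      _ ≤ ∫ h, mollifier (δ / 8) h := by
          refine integral_mono (hmq x).norm hmi fun h => ?_
          simp only
          rw [norm_mul, Real.norm_of_nonneg (mollifier_nonneg hε h),
            Real.norm_of_nonneg (hq01 _).1]
          exact mul_le_of_le_one_right (mollifier_nonneg hε h) (hq01 _).2
      _ = 1 := integral_mollifier hε
  · change 5 * δ / 8 ≤ Metric.infDist x Ωᶜ
    linarith
  · have hlip : LipschitzWith (4 / δ).toNNReal ζ := by
      refine LipschitzWith.of_dist_le_mul fun x y => ?_
      rw [Real.coe_toNNReal _ (by positivity), Real.dist_eq, hζ, mollify, mollify,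
        ← integral_sub (hmq x) (hmq y), ← Real.norm_eq_abs]
      calc _ ≤ ∫ h, mollifier (δ / 8) h * (4 / δ * dist x y) := by
            refine norm_integral_le_of_norm_le (hmi.mul_const _)
              (Filter.Eventually.of_forall fun h => ?_)
            rw [← mul_sub, norm_mul, Real.norm_of_nonneg (mollifier_nonneg hε h)]
            refine mul_le_mul_of_nonneg_left ?_ (mollifier_nonneg hε h)
            refine (hql _ _).trans (le_of_eq ?_)
            rw [dist_sub_right]
        _ = _ := by rw [integral_mul_const, integral_mollifier hε, one_mul]
    have := norm_fderiv_le_of_lipschitz ℝ hlip (x₀ := x)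
    rwa [Real.coe_toNNReal _ (by positivity)] at this
  · by_cases hxΩ : x ∈ Ω
    · have hδx : δ ≤ d x := by
        by_contra hn
        exact hx ⟨hxΩ, not_le.mp hn⟩
      have hev : ζ =ᶠ[𝓝 x] fun _ => 1 := by
        have : ∀ᶠ y in 𝓝 x, 5 * δ / 8 < d y :=
          (Metric.continuous_infDist_pt _).continuousAt.eventually
            (lt_mem_nhds (by change _ < d x; linarith))
        exact this.mono fun y hy => hζ1 y hy.le
      rw [hev.fderiv_eq]
      simp
    · exact image_eq_zero_of_notMem_tsupport (f := fderiv ℝ ζ) fun h =>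
        hxΩ (hsuppΩ (tsupport_fderiv_subset ℝ h))

theorem infDist_compl_pos {Ω : Set E3} (hΩo : IsOpen Ω) (hΩb : Bornology.IsBounded Ω) {x : E3}
    (hx : x ∈ Ω) : 0 < Metric.infDist x Ωᶜ := by
  have hne : (Ωᶜ).Nonempty := by
    rw [nonempty_compl]
    intro hu
    rw [hu] at hΩb
    exact NormedSpace.unbounded_univ ℝ E3 hΩb
  exact (hΩo.isClosed_compl.notMem_iff_infDist_pos hne).1 fun h => h hx

theorem tendsto_eLpNorm_indicator_of_eventually_notMem {f : E3 → ℝ} (hf : MemLp f 2 volume)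
    {S : ℕ → Set E3} (hS : ∀ n, MeasurableSet (S n)) (h : ∀ x, ∀ᶠ n in atTop, x ∉ S n) :
    Tendsto (fun n => eLpNorm ((S n).indicator f) 2 volume) atTop (𝓝 0) := by
  have h2 : Tendsto (fun n => eLpNorm ((S n).indicator f) 2 volume ^ 2) atTop (𝓝 0) := by
    simp_rw [eLpNorm_two_sq]
    rw [show (0 : ℝ≥0∞) = ∫⁻ x : E3, 0 by simp]
    refine tendsto_lintegral_of_dominated_convergence' (fun x => ‖f x‖ₑ ^ 2) (fun n => ?_)
      (fun n => ?_) ?_ ?_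
    · exact ((hf.1.indicator (hS n)).enorm).pow_const 2
    · refine Eventually.of_forall fun x => ?_
      by_cases hx : x ∈ S n <;> simp [hx]
    · rw [← eLpNorm_two_sq]
      exact ENNReal.pow_ne_top hf.2.ne
    · refine Eventually.of_forall fun x => ?_
      refine tendsto_const_nhds.congr' ?_
      filter_upwards [h x] with n hn
      simp [hn]
  rw [ENNReal.tendsto_nhds_zero] at h2 ⊢
  intro ε hε
  have hε2 : 0 < ε ^ 2 := by positivity
  filter_upwards [h2 (ε ^ 2) hε2] with n hn
  exact (ENNReal.pow_le_pow_left_iff two_ne_zero).1 hn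

/-- Cutoff functions of `Ω` whose gradients do not see velocity fields in `W₀^{1,2}(Ω)`. -/
theorem exists_cutoff_sequence {Ω : Set E3} (hΩo : IsOpen Ω)
    (hΩb : Bornology.IsBounded Ω) (hΩL : HasLipschitzBoundary Ω) :
    ∃ (ζ : ℕ → E3 → ℝ) (C : ℝ≥0), (∀ n, IsTestFunction Ω (ζ n)) ∧ (∀ n x, ‖ζ n x‖ ≤ 1) ∧
      (∀ x ∈ Ω, ∀ᶠ n in atTop, ζ n x = 1) ∧
      ∀ (f : E3 → ℝ) (v : E3 → E3) (G : E3 → E3 →L[ℝ] E3), MemLp f 2 volume → IsH1 v G →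
        (∀ x ∉ Ω, v x = 0) →
        (∀ n, ∫⁻ x, ‖f x * fderiv ℝ (ζ n) x (v x)‖ₑ ≤
          C * (eLpNorm f 2 volume * eLpNorm G 2 volume)) ∧
        Tendsto (fun n => ∫⁻ x, ‖f x * fderiv ℝ (ζ n) x (v x)‖ₑ) atTop (𝓝 0) := by
  obtain ⟨C, δ₀, hδ₀, hC⟩ := exists_eLpNorm_boundaryStrip_le hΩo hΩb hΩL
  set δ : ℕ → ℝ := fun n => δ₀ / (n + 2) with hδ
  have hδ0 : ∀ n, 0 < δ n := fun n => by simp only [hδ]; positivity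
  have hδ1 : ∀ n, δ n < δ₀ := fun n => by
    simp only [hδ]
    rw [div_lt_iff₀ (by positivity)]
    nlinarith [(Nat.cast_nonneg n : (0 : ℝ) ≤ n)]
  have hδt : Tendsto δ atTop (𝓝 0) :=
    (tendsto_natCast_atTop_atTop.atTop_add tendsto_const_nhds).const_div_atTop δ₀
  choose ζ hζ hζn hζ1 hζd hζ0 using fun n => exists_boundary_cutoff hΩb (hδ0 n)
  have hev : ∀ x ∈ Ω, ∀ᶠ n in atTop, δ n < Metric.infDist x Ωᶜ := fun x hx =>
    hδt.eventually_lt_const (infDist_compl_pos hΩo hΩb hx)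
  -- The factor `4/δ` of the cutoff gradient cancels the `δ` of the Poincaré inequality. What is
  -- left to tend to zero is the `L²` norm of `f` on the strip.
  have key : ∀ (f : E3 → ℝ) (v : E3 → E3) (G : E3 → E3 →L[ℝ] E3), MemLp f 2 volume → IsH1 v G →
      (∀ x ∉ Ω, v x = 0) → ∀ n, ∫⁻ x, ‖f x * fderiv ℝ (ζ n) x (v x)‖ₑ ≤
        (4 * C : ℝ≥0) * (eLpNorm ((boundaryStrip Ω (δ n)).indicator f) 2 volume *
          eLpNorm G 2 volume) := by
    intro f v G hf hv hv0 n
    set S := boundaryStrip Ω (δ n) with hS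
    have hSm : MeasurableSet S := measurableSet_boundaryStrip hΩo (δ n)
    calc ∫⁻ x, ‖f x * fderiv ℝ (ζ n) x (v x)‖ₑ
        ≤ ∫⁻ x, ENNReal.ofReal (4 / δ n) * (‖S.indicator f x‖ₑ * ‖S.indicator v x‖ₑ) := by
          refine lintegral_mono fun x => ?_
          by_cases hx : x ∈ S
          · simp only [indicator_of_mem hx]
            rw [enorm_mul, mul_left_comm]
            refine mul_le_mul' le_rfl ((ContinuousLinearMap.le_opENorm _ _).trans ?_)
            refine mul_le_mul' ?_ le_rfl
            rw [← ofReal_norm]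
            exact ENNReal.ofReal_le_ofReal (hζd n x)
          · simp [hζ0 n x hx]
      _ = ENNReal.ofReal (4 / δ n) * ∫⁻ x, ‖S.indicator f x‖ₑ * ‖S.indicator v x‖ₑ :=
          lintegral_const_mul' _ _ (by simp)
      _ ≤ ENNReal.ofReal (4 / δ n) * (eLpNorm (S.indicator f) 2 volume *
            (C * (ENNReal.ofReal (δ n) * eLpNorm G 2 volume))) := by
          refine mul_le_mul' le_rfl ((lintegral_enorm_mul_enorm_le (hf.1.indicator hSm)
            (hv.memLp.1.indicator hSm)).trans ?_)
          exact mul_le_mul' le_rfl (hC _ (hδ0 n) (hδ1 n) v G hv hv0)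
      _ = (ENNReal.ofReal (4 / δ n) * ENNReal.ofReal (δ n)) * C *
            (eLpNorm (S.indicator f) 2 volume * eLpNorm G 2 volume) := by ring
      _ = _ := by
          rw [← ENNReal.ofReal_mul (div_nonneg (by norm_num) (hδ0 n).le),
            div_mul_cancel₀ _ (hδ0 n).ne']
          simp
  refine ⟨ζ, 4 * C, hζ, hζn, fun x hx => ?_, fun f v G hf hv hv0 => ⟨fun n => ?_, ?_⟩⟩
  · filter_upwards [hev x hx] with n hn
    exact hζ1 n x hn.le
  · refine (key f v G hf hv hv0 n).trans ?_
    exact mul_le_mul' le_rfl (mul_le_mul' (eLpNorm_indicator_le _) le_rfl)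
  · have ht := tendsto_eLpNorm_indicator_of_eventually_notMem hf
      (fun n => measurableSet_boundaryStrip hΩo (δ n)) (fun x => by
        by_cases hx : x ∈ Ω
        · filter_upwards [hev x hx] with n hn hS
          exact (hS.2.trans hn).false
        · exact Eventually.of_forall fun n hS => hx hS.1)
    refine tendsto_of_tendsto_of_tendsto_of_le_of_le tendsto_const_nhds ?_
      (fun n => bot_le) (key f v G hf hv hv0)
    have := ENNReal.Tendsto.const_mul (a := ((4 * C : ℝ≥0) : ℝ≥0∞))
      (ENNReal.Tendsto.mul_const (b := eLpNorm G 2 volume) ht (Or.inr hv.memLp_grad.2.ne))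
      (Or.inr ENNReal.coe_ne_top)
    simpa using this

theorem tendsto_integral_mul_cutoff {Ω : Set E3} {k : E3 → ℝ} (hk : Integrable k volume)
    (hk0 : ∀ x ∉ Ω, k x = 0) {ζ : ℕ → E3 → ℝ} (hζ : ∀ n, Continuous (ζ n))
    (hζn : ∀ n x, ‖ζ n x‖ ≤ 1) (hζ1 : ∀ x ∈ Ω, ∀ᶠ n in atTop, ζ n x = 1) :
    Tendsto (fun n => ∫ x, k x * ζ n x) atTop (𝓝 (∫ x, k x)) := by
  refine tendsto_integral_of_dominated_convergence (fun x => ‖k x‖)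
    (fun n => hk.1.mul (hζ n).aestronglyMeasurable) hk.norm (fun n => ?_) ?_
  · refine Eventually.of_forall fun x => ?_
    rw [norm_mul]
    exact mul_le_of_le_one_right (norm_nonneg _) (hζn n x)
  · refine Eventually.of_forall fun x => ?_
    refine tendsto_const_nhds.congr' ?_
    by_cases hx : x ∈ Ω
    · filter_upwards [hζ1 x hx] with n hn
      rw [hn, mul_one]
    · simp [hk0 x hx]

theorem fderiv_mul_apply {ψ ζ : E3 → ℝ} (hψ : ContDiff ℝ ∞ ψ) (hζ : ContDiff ℝ ∞ ζ) (x v : E3) :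
    fderiv ℝ (fun y => ψ y * ζ y) x v = ζ x * fderiv ℝ ψ x v + ψ x * fderiv ℝ ζ x v := by
  have h1 := (hψ.differentiable (by simp)).differentiableAt (x := x)
  have h2 := (hζ.differentiable (by simp)).differentiableAt (x := x)
  rw [fderiv_fun_mul h1 h2]
  simp only [add_apply, smul_apply, smul_eq_mul]
  ring

theorem IsTestFunction.mul_cutoff {Ω : Set E3} {ψ ζ : E3 → ℝ} (hψ : ContDiff ℝ ∞ ψ)
    (hζ : IsTestFunction Ω ζ) : IsTestFunction Ω fun x => ψ x * ζ x :=
  ⟨hψ.mul hζ.smooth, hζ.compact_support.mul_left,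
    (tsupport_mul_subset_right (f := ψ) (g := ζ)).trans hζ.support_subset⟩

theorem integrable_mul_fderiv_apply {f : E3 → ℝ} {v : E3 → E3} (hf : MemLp f 2 volume)
    (hv : MemLp v 2 volume) {ψ : E3 → ℝ} (hψ : ContDiff ℝ ∞ ψ) (hψc : HasCompactSupport ψ) :
    Integrable (fun x => f x * fderiv ℝ ψ x (v x)) volume := by
  exact hf.integrable_mul (memLp_fderiv_apply (hψ.of_le (by exact_mod_cast le_top)) hψc hv)

/-- The weak equation tested in the interior of `Ω` extends by zero to the whole space. -/
theorem transportSolution_of_interior {Ω : Set E3} (hΩo : IsOpen Ω)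
    (hΩb : Bornology.IsBounded Ω) (hΩL : HasLipschitzBoundary Ω) {T : ℝ} {w : ℝ × E3 → ℝ}
    {U : ℝ × E3 → E3} {G : ℝ × E3 → E3 →L[ℝ] E3} {w₀ : E3 → ℝ}
    (hwm : Measurable w) (hUm : Measurable U) (hGm : Measurable G) (hw₀m : Measurable w₀)
    (hw : MemLp w 2 ((volume.restrict (Ioo 0 T)).prod volume))
    (hU : MemLp U 2 ((volume.restrict (Ioo 0 T)).prod volume))
    (hG : MemLp G 2 ((volume.restrict (Ioo 0 T)).prod volume))
    (hw₀ : MemLp w₀ 2 volume)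
    (hH1 : ∀ᵐ t ∂(volume.restrict (Ioo 0 T)), IsH1 (fun x => U (t, x)) (fun x => G (t, x)))
    (hwz : ∀ t, ∀ x ∉ Ω, w (t, x) = 0) (hUz : ∀ t, ∀ x ∉ Ω, U (t, x) = 0)
    (hw₀z : ∀ x ∉ Ω, w₀ x = 0)
    (hweak : ∀ χ : ℝ → ℝ, IsTestFunction (Iio T) χ → ∀ ψ : E3 → ℝ, IsTestFunction Ω ψ →
      (∫ t in Ioo 0 T, (deriv χ t * (∫ x, w (t, x) * ψ x) +
        χ t * ∫ x, w (t, x) * fderiv ℝ ψ x (U (t, x)))) + χ 0 * ∫ x, w₀ x * ψ x = 0) :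
    TransportSolution T w 0 U G w₀ := by
  refine ⟨hwm, measurable_const, hUm, hGm, hw₀m, hw, MemLp.zero, hU, hG, hw₀, hH1,
    fun χ hχ ψ hψ => ?_⟩
  obtain ⟨ζ, C, hζ, hζn, hζ1, hζd⟩ := exists_cutoff_sequence hΩo hΩb hΩL
  have hψ2 : MemLp ψ 2 volume := memLp_of_smooth hψ.smooth.continuous hψ.compact_support
  have hζc : ∀ n, Continuous (ζ n) := fun n => (hζ n).smooth.continuous
  have hw₀lim : Tendsto (fun n => ∫ x, w₀ x * (ψ x * ζ n x)) atTop (𝓝 (∫ x, w₀ x * ψ x)) := by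
    simp_rw [← mul_assoc]
    exact tendsto_integral_mul_cutoff (hw₀.integrable_mul hψ2)
      (fun x hx => by simp [hw₀z x hx]) hζc hζn hζ1
  obtain ⟨M, hM⟩ := hψ.compact_support.exists_bound_of_continuous hψ.smooth.continuous
  have hψd : Continuous (fderiv ℝ ψ) := hψ.smooth.continuous_fderiv (by simp)
  obtain ⟨M', hM'⟩ := (hψ.compact_support.fderiv ℝ).exists_bound_of_continuous hψd
  obtain ⟨N, hN⟩ := hχ.compact_support.exists_bound_of_continuous hχ.smooth.continuous
  obtain ⟨N', hN'⟩ := hχ.compact_support.deriv.exists_bound_of_continuous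
    (hχ.smooth.continuous_deriv (by simp))
  have hs : ∀ {F : Type} [NormedAddCommGroup F] [MeasurableSpace F] [BorelSpace F]
      [SecondCountableTopology F] {f : ℝ × E3 → F}, Measurable f → ∀ t,
      AEStronglyMeasurable (fun x => f (t, x)) (volume : Measure E3) := fun hf t =>
    (hf.comp measurable_prodMk_left).aestronglyMeasurable
  -- The product rule separates the term that converges by dominated convergence from the one with
  -- the cutoff gradient, which tends to zero by `exists_cutoff_sequence`.
  have hsplit : ∀ n t x, w (t, x) * fderiv ℝ (fun y => ψ y * ζ n y) x (U (t, x)) =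
      w (t, x) * fderiv ℝ ψ x (U (t, x)) * ζ n x +
        ψ x * (w (t, x) * fderiv ℝ (ζ n) x (U (t, x))) := fun n t x => by
    rw [fderiv_mul_apply hψ.smooth (hζ n).smooth]
    ring
  -- the slice-wise limits
  have hA : ∀ᵐ t ∂(volume.restrict (Ioo 0 T)), Tendsto (fun n => ∫ x, w (t, x) * (ψ x * ζ n x))
      atTop (𝓝 (∫ x, w (t, x) * ψ x)) := by
    filter_upwards [ae_memLp_slice hwm hw] with t ht
    simp_rw [← mul_assoc]
    exact tendsto_integral_mul_cutoff (ht.integrable_mul hψ2)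
      (fun x hx => by simp [hwz t x hx]) hζc hζn hζ1
  have hB : ∀ᵐ t ∂(volume.restrict (Ioo 0 T)), Tendsto (fun n =>
      ∫ x, w (t, x) * fderiv ℝ (fun y => ψ y * ζ n y) x (U (t, x)))
      atTop (𝓝 (∫ x, w (t, x) * fderiv ℝ ψ x (U (t, x)))) := by
    filter_upwards [ae_memLp_slice hwm hw, hH1] with t ht hH
    have hi := integrable_mul_fderiv_apply ht hH.memLp hψ.smooth hψ.compact_support
    have hi2 : ∀ n, Integrable (fun x => ψ x * (w (t, x) * fderiv ℝ (ζ n) x (U (t, x)))) volume :=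
      fun n => (integrable_mul_fderiv_apply ht hH.memLp (hζ n).smooth
        (hζ n).compact_support).bdd_mul hψ.smooth.continuous.aestronglyMeasurable
        (Eventually.of_forall hM)
    have hi1 : ∀ n, Integrable (fun x => w (t, x) * fderiv ℝ ψ x (U (t, x)) * ζ n x) volume :=
      fun n => hi.mul_bdd (hζc n).aestronglyMeasurable (Eventually.of_forall (hζn n))
    have h1 := tendsto_integral_mul_cutoff hi (fun x hx => by simp [hwz t x hx]) hζc hζn hζ1
    have h2 : Tendsto (fun n => ∫ x, ψ x * (w (t, x) * fderiv ℝ (ζ n) x (U (t, x))))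
        atTop (𝓝 0) := by
      have := tendsto_integral_of_lintegral_enorm_sub hi2 (integrable_zero E3 ℝ volume) (by
        refine tendsto_of_tendsto_of_tendsto_of_le_of_le tendsto_const_nhds (h := fun n =>
          ENNReal.ofReal M * ∫⁻ x, ‖w (t, x) * fderiv ℝ (ζ n) x (U (t, x))‖ₑ) ?_
          (fun n => bot_le) (fun n => ?_)
        · have := ENNReal.Tendsto.const_mul (a := ENNReal.ofReal M)
            (hζd _ _ _ ht hH (hUz t)).2 (Or.inr ENNReal.ofReal_ne_top)
          simpa using this
        · dsimp only
          rw [← lintegral_const_mul' _ _ ENNReal.ofReal_ne_top]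
          refine lintegral_mono fun x => ?_
          simp only [Pi.zero_apply, sub_zero]
          rw [enorm_mul]
          refine mul_le_mul' ?_ le_rfl
          rw [← ofReal_norm]
          exact ENNReal.ofReal_le_ofReal (hM x))
      simpa using this
    have h3 := h1.add h2
    rw [add_zero] at h3
    refine h3.congr fun n => ?_
    rw [← integral_add (hi1 n) (hi2 n)]
    simp_rw [hsplit]
  -- the uniform bounds
  have hbd : ∃ B : ℝ≥0, ∀ᵐ t ∂(volume.restrict (Ioo 0 T)), ∀ n,
      ‖deriv χ t * (∫ x, w (t, x) * (ψ x * ζ n x)) +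
        χ t * ∫ x, w (t, x) * fderiv ℝ (fun y => ψ y * ζ n y) x (U (t, x))‖ₑ ≤
      B * TransportSolution.energy w 0 U G t := by
    refine ⟨2 * N'.toNNReal * (eLpNorm ψ 2 volume).toNNReal +
      N.toNNReal * (2 * M'.toNNReal + 2 * M.toNNReal * C), ?_⟩
    filter_upwards [ae_memLp_slice hwm hw, hH1] with t ht hH n
    obtain ⟨e0, e1, e2, e3, e4⟩ :=
      TransportSolution.le_energy (w := w) (g := 0) (U := U) (G := G) t
    set E := TransportSolution.energy w 0 U G t with hE
    have hζe : ∀ x, ‖ζ n x‖ₑ ≤ 1 := fun x => by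
      rw [← ofReal_norm, ← ENNReal.ofReal_one]
      exact ENNReal.ofReal_le_ofReal (hζn n x)
    have ha : ‖∫ x, w (t, x) * (ψ x * ζ n x)‖ₑ ≤ 2 * E * eLpNorm ψ 2 volume := by
      have := enorm_integral_mul_le (M := 1) ht.1 hψ2.1 (by simp)
        (c := fun x => w (t, x) * (ψ x * ζ n x)) fun x => by
          rw [one_mul, enorm_mul, enorm_mul]
          refine mul_le_mul' le_rfl ?_
          calc _ ≤ ‖ψ x‖ₑ * 1 := mul_le_mul' le_rfl (hζe x)
            _ = _ := mul_one _
      rw [one_mul] at this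
      exact this.trans (mul_le_mul' (TransportSolution.le_two_mul_energy e1) le_rfl)
    have hb : ‖∫ x, w (t, x) * fderiv ℝ (fun y => ψ y * ζ n y) x (U (t, x))‖ₑ ≤
        ENNReal.ofReal M' * (2 * E) + ENNReal.ofReal M * (C * (2 * E)) := by
      refine (enorm_integral_le_lintegral_enorm _).trans ?_
      calc _ ≤ ∫⁻ x, (ENNReal.ofReal M' * (‖w (t, x)‖ₑ * ‖U (t, x)‖ₑ) +
            ENNReal.ofReal M * ‖w (t, x) * fderiv ℝ (ζ n) x (U (t, x))‖ₑ) := by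
            refine lintegral_mono fun x => ?_
            rw [hsplit]
            refine (enorm_add_le _ _).trans (add_le_add ?_ ?_)
            · rw [enorm_mul, enorm_mul, mul_left_comm (ENNReal.ofReal M'), ]
              calc _ ≤ ‖w (t, x)‖ₑ * ‖fderiv ℝ ψ x (U (t, x))‖ₑ * 1 :=
                    mul_le_mul' le_rfl (hζe x)
                _ ≤ _ := by
                  rw [mul_one]
                  refine mul_le_mul' le_rfl ((ContinuousLinearMap.le_opENorm _ _).trans ?_)
                  refine mul_le_mul' ?_ le_rfl
                  rw [← ofReal_norm]
                  exact ENNReal.ofReal_le_ofReal (hM' x)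
            · rw [enorm_mul]
              refine mul_le_mul' ?_ le_rfl
              rw [← ofReal_norm]
              exact ENNReal.ofReal_le_ofReal (hM x)
        _ = ENNReal.ofReal M' * (∫⁻ x, ‖w (t, x)‖ₑ * ‖U (t, x)‖ₑ) +
            ENNReal.ofReal M * ∫⁻ x, ‖w (t, x) * fderiv ℝ (ζ n) x (U (t, x))‖ₑ := by
            rw [lintegral_add_left', lintegral_const_mul' _ _ ENNReal.ofReal_ne_top,
              lintegral_const_mul' _ _ ENNReal.ofReal_ne_top]
            exact (ht.1.enorm.mul hH.memLp.1.enorm).const_mul _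
        _ ≤ _ := by
            refine add_le_add (mul_le_mul' le_rfl ?_) (mul_le_mul' le_rfl ?_)
            · exact (lintegral_enorm_mul_enorm_le ht.1 hH.memLp.1).trans
                (TransportSolution.mul_le_energy e1 e3)
            · exact ((hζd _ _ _ ht hH (hUz t)).1 n).trans
                (mul_le_mul' le_rfl (TransportSolution.mul_le_energy e1 e4))
    have hNe : ‖χ t‖ₑ ≤ ENNReal.ofReal N := by
      rw [← ofReal_norm]; exact ENNReal.ofReal_le_ofReal (hN t)
    have hNe' : ‖deriv χ t‖ₑ ≤ ENNReal.ofReal N' := by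
      rw [← ofReal_norm]; exact ENNReal.ofReal_le_ofReal (hN' t)
    calc _ ≤ ENNReal.ofReal N' * (2 * E * eLpNorm ψ 2 volume) + ENNReal.ofReal N *
          (ENNReal.ofReal M' * (2 * E) + ENNReal.ofReal M * (C * (2 * E))) := by
          refine (enorm_add_le _ _).trans (add_le_add ?_ ?_)
          · rw [enorm_mul]; exact mul_le_mul' hNe' ha
          · rw [enorm_mul]; exact mul_le_mul' hNe hb
      _ = _ := by
          push_cast
          rw [ENNReal.coe_toNNReal hψ2.2.ne]
          simp only [ENNReal.ofReal]
          ring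
  obtain ⟨B, hB'⟩ := hbd
  have henm : Measurable (TransportSolution.energy w 0 U G) := by
    have h1 := measurable_sliceEnergy hwm
    have h2 : Measurable (sliceEnergy (0 : ℝ × E3 → ℝ)) := measurable_sliceEnergy measurable_const
    have h3 := measurable_sliceEnergy hUm
    have h4 := measurable_sliceEnergy hGm
    unfold TransportSolution.energy
    fun_prop
  have henf : ∫⁻ t in Ioo 0 T, TransportSolution.energy w 0 U G t ≠ ⊤ := by
    have h1 := measurable_sliceEnergy hwm
    have h2 : Measurable (sliceEnergy (0 : ℝ × E3 → ℝ)) := measurable_sliceEnergy measurable_const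
    have h3 := measurable_sliceEnergy hUm
    have h4 := measurable_sliceEnergy hGm
    unfold TransportSolution.energy
    rw [lintegral_add_left (by fun_prop), lintegral_add_left (by fun_prop),
      lintegral_add_left (by fun_prop), lintegral_add_left (by fun_prop)]
    have e1 := lintegral_sliceEnergy hwm hw
    have e2 := lintegral_sliceEnergy (f := (0 : ℝ × E3 → ℝ)) measurable_const
      (T := T) MemLp.zero
    have e3 := lintegral_sliceEnergy hUm hU
    have e4 := lintegral_sliceEnergy hGm hG
    simp [e1, e2, e3, e4]
  have hlim : Tendsto (fun n => ∫ t in Ioo 0 T, (deriv χ t * (∫ x, w (t, x) * (ψ x * ζ n x)) +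
        χ t * ∫ x, w (t, x) * fderiv ℝ (fun y => ψ y * ζ n y) x (U (t, x)))) atTop
      (𝓝 (∫ t in Ioo 0 T, (deriv χ t * (∫ x, w (t, x) * ψ x) +
        χ t * ∫ x, w (t, x) * fderiv ℝ ψ x (U (t, x))))) := by
    refine tendsto_integral_of_dominated_convergence
      (fun t => (B * TransportSolution.energy w 0 U G t).toReal) (fun n => ?_) ?_
      (fun n => ?_) ?_
    · have hχm := hχ.smooth.continuous.measurable
      have hχm' := (hχ.smooth.continuous_deriv (by simp)).measurable
      have hζm := (hζc n).measurable
      have hψm := hψ.smooth.continuous.measurable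
      have hd : Continuous (fderiv ℝ fun y => ψ y * ζ n y) :=
        (hψ.smooth.mul (hζ n).smooth).continuous_fderiv (by simp)
      have m1 : Measurable fun q : ℝ × E3 => w q * (ψ q.2 * ζ n q.2) := by fun_prop
      have m2 : Measurable fun q : ℝ × E3 => w q * fderiv ℝ (fun y => ψ y * ζ n y) q.2 (U q) :=
        hwm.mul (isBoundedBilinearMap_apply.continuous.measurable.comp
          ((hd.measurable.comp measurable_snd).prodMk hUm))
      exact ((hχm'.mul m1.stronglyMeasurable.integral_prod_right'.measurable).add
        (hχm.mul m2.stronglyMeasurable.integral_prod_right'.measurable)).aestronglyMeasurable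
    · refine integrable_toReal_of_lintegral_ne_top (henm.const_mul _).aemeasurable ?_
      rw [lintegral_const_mul' _ _ ENNReal.coe_ne_top]
      exact ENNReal.mul_ne_top ENNReal.coe_ne_top henf
    · filter_upwards [hB', ae_lt_top henm henf] with t ht hf
      rw [← toReal_enorm]
      exact ENNReal.toReal_mono (ENNReal.mul_ne_top ENNReal.coe_ne_top hf.ne) (ht n)
    · filter_upwards [hA, hB] with t h1 h2
      exact (h1.const_mul _).add (h2.const_mul _)
  have hfin := hlim.add (hw₀lim.const_mul (χ 0))
  -- Each `ψ ζ n` is an admissible interior test function, so the whole sequence is constantly zero.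
  have h0 := tendsto_nhds_unique hfin (tendsto_const_nhds.congr fun n =>
    (hweak χ hχ _ (IsTestFunction.mul_cutoff hψ.smooth (hζ n))).symm)
  simpa using h0

/-! ### Fields in `W₀^{1,2}(Ω)` and the divergence of a weighted field -/

theorem IsW012.congr {Ω : Set E3} {v v' : E3 → E3} {G G' : E3 → E3 →L[ℝ] E3}
    (h : IsW012 Ω v G) (hv : v =ᵐ[volume.restrict Ω] v') (hG : G =ᵐ[volume.restrict Ω] G') :
    IsW012 Ω v' G' := by
  obtain ⟨φ, hφ, h1, h2⟩ := h.approx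
  refine ⟨h.memLp.ae_eq hv, h.memLp_grad.ae_eq hG, fun ψ hψ w => ?_, φ, hφ, ?_, ?_⟩
  · rw [integral_congr_ae (g := fun x => (fderiv ℝ ψ x w) • v x)
      (by filter_upwards [hv] with x hx; rw [hx]), h.weak_grad ψ hψ w,
      integral_congr_ae (g := fun x => ψ x • G' x w)
        (by filter_upwards [hG] with x hx; rw [hx])]
  · refine h1.congr fun n => eLpNorm_congr_ae ?_
    filter_upwards [hv] with x hx
    rw [hx]
  · refine h2.congr fun n => eLpNorm_congr_ae ?_
    filter_upwards [hG] with x hx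
    rw [hx]

theorem IsTestFunction.eq_zero_of_notMem {X Y : Type*} [NormedAddCommGroup X] [NormedSpace ℝ X]
    [NormedAddCommGroup Y] [NormedSpace ℝ Y] {U : Set X} {φ : X → Y} (h : IsTestFunction U φ)
    {x : X} (hx : x ∉ U) : φ x = 0 :=
  image_eq_zero_of_notMem_tsupport fun hn => hx (h.support_subset hn)

theorem IsTestFunction.fderiv_eq_zero_of_notMem {X Y : Type*} [NormedAddCommGroup X]
    [NormedSpace ℝ X] [NormedAddCommGroup Y] [NormedSpace ℝ Y] {U : Set X} {φ : X → Y}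
    (h : IsTestFunction U φ) {x : X} (hx : x ∉ U) : fderiv ℝ φ x = 0 := by
  by_contra hn
  exact hx (h.support_subset (support_fderiv_subset ℝ hn))

theorem eLpNorm_eq_restrict_of_eq_zero {F : Type*} [NormedAddCommGroup F] {Ω : Set E3}
    (hΩ : MeasurableSet Ω) {f : E3 → F} (h0 : ∀ x ∉ Ω, f x = 0) :
    eLpNorm f 2 volume = eLpNorm f 2 (volume.restrict Ω) := by
  rw [← eLpNorm_indicator_eq_eLpNorm_restrict hΩ, indicator_eq_self.2]
  intro x hx
  by_contra hn
  exact hx (h0 x hn)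

theorem memLp_of_memLp_restrict {F : Type*} [NormedAddCommGroup F] {Ω : Set E3}
    (hΩ : MeasurableSet Ω) {f : E3 → F} (h : MemLp f 2 (volume.restrict Ω))
    (h0 : ∀ x ∉ Ω, f x = 0) : MemLp f 2 volume := by
  rw [← memLp_indicator_iff_restrict hΩ, indicator_eq_self.2] at h
  · exact h
  intro x hx
  by_contra hn
  exact hx (h0 x hn)

/-- The approximants and their derivatives vanish outside `Ω`, so for fields extended by zero the
convergence on `Ω` is convergence on the whole space. -/
theorem IsW012.isH1 {Ω : Set E3} (hΩ : MeasurableSet Ω) {v : E3 → E3} {G : E3 → E3 →L[ℝ] E3}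
    (h : IsW012 Ω v G) (hv : ∀ x ∉ Ω, v x = 0) (hG : ∀ x ∉ Ω, G x = 0) : IsH1 v G := by
  obtain ⟨φ, hφ, h1, h2⟩ := h.approx
  refine ⟨memLp_of_memLp_restrict hΩ h.memLp hv, memLp_of_memLp_restrict hΩ h.memLp_grad hG, φ,
    fun n => ⟨(hφ n).smooth, (hφ n).compact_support⟩, ?_, ?_⟩
  · refine h1.congr fun n => (eLpNorm_eq_restrict_of_eq_zero hΩ fun x hx => ?_).symm
    rw [hv x hx, (hφ n).eq_zero_of_notMem hx, sub_zero]
  · refine h2.congr fun n => (eLpNorm_eq_restrict_of_eq_zero hΩ fun x hx => ?_).symm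
    rw [hG x hx, (hφ n).fderiv_eq_zero_of_notMem hx, sub_zero]

theorem IsC1OnClosure.exists_bound {Ω : Set E3} (hΩb : Bornology.IsBounded Ω) {r : E3 → ℝ}
    (h : IsC1OnClosure Ω r) : ∃ M : ℝ≥0, ∀ x ∈ Ω, ‖r x‖ ≤ M ∧ ‖fderiv ℝ r x‖ ≤ M := by
  obtain ⟨h1, h2, D, hD, hDe⟩ := h
  have hc : IsCompact (closure Ω) := hΩb.isCompact_closure
  obtain ⟨M1, hM1⟩ := hc.exists_bound_of_continuousOn h2
  obtain ⟨M2, hM2⟩ := hc.exists_bound_of_continuousOn hD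
  refine ⟨(max M1 M2).toNNReal, fun x hx => ?_⟩
  have hle := Real.le_coe_toNNReal (max M1 M2)
  exact ⟨(hM1 x (subset_closure hx)).trans ((le_max_left _ _).trans hle),
    hDe x hx ▸ (hM2 x (subset_closure hx)).trans ((le_max_right _ _).trans hle)⟩

theorem traceCLM_smulRight (L : E3 →L[ℝ] ℝ) (v : E3) : traceCLM (L.smulRight v) = L v := by
  rw [traceCLM_apply]
  conv_rhs => rw [← (EuclideanSpace.basisFun (Fin 3) ℝ).sum_repr v]
  simp [mul_comm]

/-- For a finite measure, `L²` convergence of the fields gives `L¹` convergence of integrands that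
depend on them in a Lipschitz way. -/
theorem tendsto_integral_of_enorm_sub_le {F : Type*} [NormedAddCommGroup F] {μ : Measure E3}
    [IsFiniteMeasure μ] {φ : ℕ → E3 → F} {v : E3 → F}
    (hm : ∀ n, AEStronglyMeasurable (fun x => φ n x - v x) μ)
    (h : Tendsto (fun n => eLpNorm (fun x => φ n x - v x) 2 μ) atTop (𝓝 0))
    {k : ℕ → E3 → ℝ} {l : E3 → ℝ} (hk : ∀ n, Integrable (k n) μ) (hl : Integrable l μ)
    {M : ℝ≥0} (hM : ∀ n, ∀ᵐ x ∂μ, ‖k n x - l x‖ ≤ M * ‖φ n x - v x‖) :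
    Tendsto (fun n => ∫ x, k n x ∂μ) atTop (𝓝 (∫ x, l x ∂μ)) := by
  refine tendsto_integral_of_lintegral_enorm_sub hk hl ?_
  set c : ℝ≥0∞ := μ univ ^ (1 / (1 : ℝ≥0∞).toReal - 1 / (2 : ℝ≥0∞).toReal) with hc
  have hct : c ≠ ⊤ := ENNReal.rpow_ne_top_of_nonneg (by norm_num) (measure_ne_top _ _)
  have h2 : Tendsto (fun n => M * (eLpNorm (fun x => φ n x - v x) 2 μ * c)) atTop (𝓝 0) := by
    have := ENNReal.Tendsto.const_mul (a := (M : ℝ≥0∞))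
      (ENNReal.Tendsto.mul_const (b := c) h (Or.inr hct)) (Or.inr ENNReal.coe_ne_top)
    simpa using this
  refine tendsto_of_tendsto_of_tendsto_of_le_of_le tendsto_const_nhds h2 (fun n => bot_le)
    fun n => ?_
  calc ∫⁻ x, ‖k n x - l x‖ₑ ∂μ ≤ ∫⁻ x, M * ‖φ n x - v x‖ₑ ∂μ := by
        refine lintegral_mono_ae ?_
        filter_upwards [hM n] with x hx
        rw [← ofReal_norm, ← ofReal_norm, ← ENNReal.ofReal_coe_nnreal,
          ← ENNReal.ofReal_mul M.coe_nonneg]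
        exact ENNReal.ofReal_le_ofReal hx
    _ = M * eLpNorm (fun x => φ n x - v x) 1 μ := by
        rw [lintegral_const_mul' _ _ ENNReal.coe_ne_top, eLpNorm_one_eq_lintegral_enorm]
    _ ≤ _ := mul_le_mul' le_rfl
        (eLpNorm_le_eLpNorm_mul_rpow_measure_univ (by norm_num) (hm n))

/-- The divergence of `r v`. -/
noncomputable def weightedDivergence (r : E3 → ℝ) (v : E3) (A : E3 →L[ℝ] E3) (x : E3) : ℝ :=
  r x * traceCLM A + fderiv ℝ r x v

/-- Although `r` is `C¹` only inside `Ω`, the product `r φ` is `C¹` everywhere, since `φ` vanishes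
near every point outside `Ω`. The whole-space formula then applies. -/
theorem integral_mul_fderiv_eq_neg_of_test {Ω : Set E3} (hΩo : IsOpen Ω) {r : E3 → ℝ}
    (hr : ContDiffOn ℝ 1 r Ω) {φ : E3 → E3} (hφ : IsTestFunction Ω φ) {ψ : E3 → ℝ}
    (hψ : ContDiff ℝ 1 ψ) (hψc : HasCompactSupport ψ) :
    ∫ x in Ω, r x * fderiv ℝ ψ x (φ x) =
      -∫ x in Ω, weightedDivergence r (φ x) (fderiv ℝ φ x) x * ψ x := by
  have hF : ContDiff ℝ 1 fun x => r x • φ x := by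
    rw [contDiff_iff_contDiffAt]
    intro x
    by_cases hx : x ∈ Ω
    · exact (hr.contDiffAt (hΩo.mem_nhds hx)).smul
        ((hφ.smooth.of_le (by exact_mod_cast le_top)).contDiffAt)
    · have : (fun x => r x • φ x) =ᶠ[𝓝 x] fun _ => 0 := by
        have hx' : x ∉ tsupport φ := fun h => hx (hφ.support_subset h)
        filter_upwards [notMem_tsupport_iff_eventuallyEq.1 hx'] with y hy
        simp [hy]
      exact contDiffAt_const.congr_of_eventuallyEq this
  have hdF : ∀ x ∈ Ω, traceCLM (fderiv ℝ (fun x => r x • φ x) x) =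
      weightedDivergence r (φ x) (fderiv ℝ φ x) x := by
    intro x hx
    have h1 : DifferentiableAt ℝ r x :=
      (hr.contDiffAt (hΩo.mem_nhds hx)).differentiableAt (by simp)
    have h2 : DifferentiableAt ℝ φ x := (hφ.smooth.differentiable (by simp)).differentiableAt
    rw [fderiv_fun_smul h1 h2, map_add, map_smul, traceCLM_smulRight]
    rfl
  have h := integral_fderiv_apply_eq_neg_of_smooth hψ hψc hF
  rw [← setIntegral_eq_integral_of_forall_compl_eq_zero (s := Ω)
      (fun x hx => by simp [hφ.eq_zero_of_notMem hx]),
    ← setIntegral_eq_integral_of_forall_compl_eq_zero (s := Ω)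
      (f := fun x => ψ x * traceCLM (fderiv ℝ (fun x => r x • φ x) x)) (fun x hx => by
        have hx' : x ∉ tsupport φ := fun h => hx (hφ.support_subset h)
        have : (fun x => r x • φ x) =ᶠ[𝓝 x] fun _ => 0 := by
          filter_upwards [notMem_tsupport_iff_eventuallyEq.1 hx'] with y hy
          simp [hy]
        rw [this.fderiv_eq]; simp)] at h
  simp only [map_smul, smul_eq_mul] at h
  rw [h, setIntegral_congr_fun hΩo.measurableSet (fun x hx => by rw [hdF x hx, mul_comm])]

/-- By density of test fields. The function `ψ` need not vanish near the boundary: the zero trace of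
`v` removes the boundary term. This is what lets the extension by zero of `r` satisfy its equation
on the whole space. -/
theorem IsW012.integral_mul_fderiv_eq_neg {Ω : Set E3} (hΩo : IsOpen Ω)
    (hΩb : Bornology.IsBounded Ω) {r : E3 → ℝ} (hr : IsC1OnClosure Ω r) {v : E3 → E3}
    {G : E3 → E3 →L[ℝ] E3} (hW : IsW012 Ω v G) {ψ : E3 → ℝ}
    (hψ : ContDiff ℝ 1 ψ) (hψc : HasCompactSupport ψ) :
    ∫ x in Ω, r x * fderiv ℝ ψ x (v x) =
      -∫ x in Ω, weightedDivergence r (v x) (G x) x * ψ x := by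
  obtain ⟨M, hM⟩ := hr.exists_bound hΩb
  obtain ⟨P, hP⟩ := hψc.exists_bound_of_continuous hψ.continuous
  obtain ⟨P', hP'⟩ := (hψc.fderiv ℝ).exists_bound_of_continuous (hψ.continuous_fderiv (by simp))
  obtain ⟨c, hc0, hc⟩ := exists_abs_traceCLM_le
  obtain ⟨φ, hφ, h1, h2⟩ := hW.approx
  have hP0 : 0 ≤ P := (norm_nonneg _).trans (hP 0)
  have hP'0 : 0 ≤ P' := (norm_nonneg _).trans (hP' 0)
  have : IsFiniteMeasure (volume.restrict Ω) :=
    ⟨by rw [Measure.restrict_apply_univ]; exact hΩb.measure_lt_top⟩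
  have hmem : ∀ᵐ x ∂(volume.restrict Ω), x ∈ Ω := ae_restrict_mem hΩo.measurableSet
  have hrm : AEStronglyMeasurable r (volume.restrict Ω) :=
    hr.1.continuousOn.aestronglyMeasurable hΩo.measurableSet
  have hdr : AEStronglyMeasurable (fderiv ℝ r) (volume.restrict Ω) :=
    (measurable_fderiv ℝ r).aestronglyMeasurable
  have hψm : AEStronglyMeasurable ψ (volume.restrict Ω) := hψ.continuous.aestronglyMeasurable
  have hψd : AEStronglyMeasurable (fderiv ℝ ψ) (volume.restrict Ω) :=
    (hψ.continuous_fderiv (by simp)).aestronglyMeasurable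
  have b1 : ∀ x ∈ Ω, ∀ y : E3, ‖r x * fderiv ℝ ψ x y‖ ≤ (M * P') * ‖y‖ := fun x hx y => by
    rw [norm_mul, mul_assoc]
    refine mul_le_mul (hM x hx).1 ?_ (norm_nonneg _) M.coe_nonneg
    exact ((fderiv ℝ ψ x).le_opNorm y).trans (mul_le_mul_of_nonneg_right (hP' x) (norm_nonneg _))
  have b2 : ∀ x ∈ Ω, ∀ A : E3 →L[ℝ] E3, ‖r x * traceCLM A * ψ x‖ ≤ (M * c * P) * ‖A‖ := by
    intro x hx A
    rw [norm_mul, norm_mul]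
    calc _ ≤ M * (c * ‖A‖) * P := by
          gcongr
          · exact (hM x hx).1
          · exact hc A
          · exact hP x
      _ = _ := by ring
  have b3 : ∀ x ∈ Ω, ∀ y : E3, ‖fderiv ℝ r x y * ψ x‖ ≤ (M * P) * ‖y‖ := by
    intro x hx y
    rw [norm_mul]
    calc _ ≤ (M * ‖y‖) * P := by
          gcongr
          · exact ((fderiv ℝ r x).le_opNorm y).trans
              (mul_le_mul_of_nonneg_right (hM x hx).2 (norm_nonneg _))
          · exact hP x
      _ = _ := by ring
  have happ : ∀ {L : E3 → E3 →L[ℝ] ℝ} {y : E3 → E3},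
      AEStronglyMeasurable L (volume.restrict Ω) → AEStronglyMeasurable y (volume.restrict Ω) →
      AEStronglyMeasurable (fun x => L x (y x)) (volume.restrict Ω) := fun hL hy =>
    isBoundedBilinearMap_apply.continuous.comp_aestronglyMeasurable (hL.prodMk hy)
  have htr : ∀ {A : E3 → E3 →L[ℝ] E3}, AEStronglyMeasurable A (volume.restrict Ω) →
      AEStronglyMeasurable (fun x => traceCLM (A x)) (volume.restrict Ω) := fun hA =>
    traceCLM.continuous.comp_aestronglyMeasurable hA
  have i1 : ∀ y : E3 → E3, MemLp y 2 (volume.restrict Ω) →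
      Integrable (fun x => r x * fderiv ℝ ψ x (y x)) (volume.restrict Ω) := fun y hy =>
    ((hy.integrable one_le_two).norm.const_mul (M * P')).mono' (hrm.mul (happ hψd hy.1))
      (hmem.mono fun x hx => b1 x hx _)
  have i2 : ∀ A : E3 → E3 →L[ℝ] E3, MemLp A 2 (volume.restrict Ω) →
      Integrable (fun x => r x * traceCLM (A x) * ψ x) (volume.restrict Ω) := fun A hA =>
    ((hA.integrable one_le_two).norm.const_mul (M * c * P)).mono' ((hrm.mul (htr hA.1)).mul hψm)
      (hmem.mono fun x hx => b2 x hx _)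
  have i3 : ∀ y : E3 → E3, MemLp y 2 (volume.restrict Ω) →
      Integrable (fun x => fderiv ℝ r x (y x) * ψ x) (volume.restrict Ω) := fun y hy =>
    ((hy.integrable one_le_two).norm.const_mul (M * P)).mono' ((happ hdr hy.1).mul hψm)
      (hmem.mono fun x hx => b3 x hx _)
  have hφ2 : ∀ n, MemLp (φ n) 2 (volume.restrict Ω) := fun n =>
    (memLp_of_smooth (hφ n).smooth.continuous (hφ n).compact_support).restrict _
  have hφd2 : ∀ n, MemLp (fderiv ℝ (φ n)) 2 (volume.restrict Ω) := fun n =>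
    (memLp_of_smooth ((hφ n).smooth.continuous_fderiv (by simp))
      ((hφ n).compact_support.fderiv ℝ)).restrict _
  have t1 := tendsto_integral_of_enorm_sub_le (fun n => (hφ2 n).1.sub hW.memLp.1) h1
    (fun n => i1 _ (hφ2 n)) (i1 _ hW.memLp) (M := M * P'.toNNReal) fun n => by
      filter_upwards [hmem] with x hx
      have := b1 x hx (φ n x - v x)
      rw [map_sub, mul_sub] at this
      simpa [hP'0] using this
  have t2 := tendsto_integral_of_enorm_sub_le (fun n => (hφd2 n).1.sub hW.memLp_grad.1) h2
    (fun n => i2 _ (hφd2 n)) (i2 _ hW.memLp_grad) (M := M * c.toNNReal * P.toNNReal) fun n => by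
      filter_upwards [hmem] with x hx
      have := b2 x hx (fderiv ℝ (φ n) x - G x)
      rw [map_sub, mul_sub, sub_mul] at this
      simpa [hP0, hc0] using this
  have t3 := tendsto_integral_of_enorm_sub_le (fun n => (hφ2 n).1.sub hW.memLp.1) h1
    (fun n => i3 _ (hφ2 n)) (i3 _ hW.memLp) (M := M * P.toNNReal) fun n => by
      filter_upwards [hmem] with x hx
      have := b3 x hx (φ n x - v x)
      rw [map_sub, sub_mul] at this
      simpa [hP0] using this
  have hsum : ∀ (y : E3 → E3) (A : E3 → E3 →L[ℝ] E3), MemLp y 2 (volume.restrict Ω) →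
      MemLp A 2 (volume.restrict Ω) →
      ∫ x in Ω, weightedDivergence r (y x) (A x) x * ψ x =
        (∫ x in Ω, r x * traceCLM (A x) * ψ x) + ∫ x in Ω, fderiv ℝ r x (y x) * ψ x :=
    fun y A hy hA => by
      rw [← integral_add (i2 A hA) (i3 y hy)]
      simp_rw [weightedDivergence, add_mul]
  rw [hsum v G hW.memLp hW.memLp_grad]
  refine tendsto_nhds_unique t1 ((t2.add t3).neg.congr fun n => ?_)
  rw [← hsum _ _ (hφ2 n) (hφd2 n),
    integral_mul_fderiv_eq_neg_of_test hΩo hr.1 (hφ n) hψ hψc]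

/-! ### Measurable representatives extended by zero, and operations on transport solutions -/

theorem exists_measurable_zero_extension {α F : Type*} [MeasurableSpace α] {μ : Measure α}
    [NormedAddCommGroup F] [MeasurableSpace F] [BorelSpace F]
    {S : Set α} (hS : MeasurableSet S) {f : α → F} (hf : MemLp f 2 (μ.restrict S)) :
    ∃ f' : α → F, Measurable f' ∧ MemLp f' 2 μ ∧ (∀ p ∉ S, f' p = 0) ∧
      f' =ᵐ[μ.restrict S] f := by
  have he : S.indicator (hf.1.mk f) =ᵐ[μ.restrict S] f :=
    (indicator_ae_eq_restrict hS).trans hf.1.ae_eq_mk.symm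
  refine ⟨S.indicator (hf.1.mk f), hf.1.stronglyMeasurable_mk.measurable.indicator hS, ?_,
    fun p hp => indicator_of_notMem hp _, he⟩
  exact (memLp_indicator_iff_restrict hS).2 (hf.ae_eq hf.1.ae_eq_mk)

theorem volume_restrict_cylinder (T : ℝ) (Ω : Set E3) :
    (volume.restrict (cylinder T Ω) : Measure (ℝ × E3)) =
      (volume.restrict (Ioo 0 T)).prod (volume.restrict Ω) := by
  rw [cylinder, Measure.volume_eq_prod, Measure.prod_restrict]

theorem prod_restrict_univ_prod (T : ℝ) (Ω : Set E3) :
    ((volume.restrict (Ioo 0 T)).prod (volume : Measure E3)).restrict (univ ×ˢ Ω) =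
      volume.restrict (cylinder T Ω) := by
  rw [volume_restrict_cylinder, ← Measure.prod_restrict, Measure.restrict_univ]

/-- Measurable representatives, extended by zero, of a density and a velocity field. -/
structure ZeroExtension (T : ℝ) (Ω : Set E3) (ρ : ℝ → E3 → ℝ) (u : ℝ → E3 → E3)
    (R : ℝ × E3 → ℝ) (U : ℝ × E3 → E3) (G : ℝ × E3 → E3 →L[ℝ] E3) : Prop where
  measurable_R : Measurable R
  measurable_U : Measurable U
  measurable_G : Measurable G
  memLp_R : MemLp R 2 ((volume.restrict (Ioo 0 T)).prod volume)
  memLp_U : MemLp U 2 ((volume.restrict (Ioo 0 T)).prod volume)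
  memLp_G : MemLp G 2 ((volume.restrict (Ioo 0 T)).prod volume)
  R_zero : ∀ t, ∀ x ∉ Ω, R (t, x) = 0
  U_zero : ∀ t, ∀ x ∉ Ω, U (t, x) = 0
  G_zero : ∀ t, ∀ x ∉ Ω, G (t, x) = 0
  R_eq : ∀ᵐ p ∂(volume.restrict (cylinder T Ω)), R p = ρ p.1 p.2
  U_eq : ∀ᵐ p ∂(volume.restrict (cylinder T Ω)), U p = u p.1 p.2
  isW012 : ∀ᵐ t ∂(volume.restrict (Ioo 0 T)),
    IsW012 Ω (fun x => U (t, x)) (fun x => G (t, x))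

theorem exists_zeroExtension {T : ℝ} {Ω : Set E3} (hΩ : MeasurableSet Ω) {ρ : ℝ → E3 → ℝ}
    {u : ℝ → E3 → E3} (hu : MemL2W012 T Ω u)
    (hρ : MemLp (fun p : ℝ × E3 => ρ p.1 p.2) 2 (volume.restrict (cylinder T Ω))) :
    ∃ R U G, ZeroExtension T Ω ρ u R U G := by
  obtain ⟨hu2, Du, hDu, hW⟩ := hu
  have hS : MeasurableSet ((univ : Set ℝ) ×ˢ Ω) := MeasurableSet.univ.prod hΩ
  rw [← prod_restrict_univ_prod] at hu2 hDu hρ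
  obtain ⟨R, hR1, hR2, hR3, hR4⟩ := exists_measurable_zero_extension hS hρ
  obtain ⟨U, hU1, hU2, hU3, hU4⟩ := exists_measurable_zero_extension hS hu2
  obtain ⟨G, hG1, hG2, hG3, hG4⟩ := exists_measurable_zero_extension hS hDu
  rw [prod_restrict_univ_prod] at hR4 hU4 hG4
  refine ⟨R, U, G, hR1, hU1, hG1, hR2, hU2, hG2, fun t x hx => hR3 _ fun h => hx h.2,
    fun t x hx => hU3 _ fun h => hx h.2, fun t x hx => hG3 _ fun h => hx h.2, hR4, hU4, ?_⟩
  rw [volume_restrict_cylinder] at hU4 hG4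
  filter_upwards [hW, Measure.ae_ae_of_ae_prod hU4, Measure.ae_ae_of_ae_prod hG4] with t h1 h2 h3
  exact h1.congr (h2.mono fun x hx => hx.symm) (h3.mono fun x hx => hx.symm)

theorem IsTestFunction.prod_mul {V : Set ℝ} {W : Set E3} {χ : ℝ → ℝ} {ψ : E3 → ℝ}
    (hχ : IsTestFunction V χ) (hψ : IsTestFunction W ψ) :
    IsTestFunction (V ×ˢ W) fun p : ℝ × E3 => χ p.1 * ψ p.2 := by
  have hsub : tsupport (fun p : ℝ × E3 => χ p.1 * ψ p.2) ⊆ tsupport χ ×ˢ tsupport ψ := by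
    refine closure_minimal (fun p hp => ?_) ((isClosed_tsupport _).prod (isClosed_tsupport _))
    exact ⟨subset_tsupport _ (left_ne_zero_of_mul hp), subset_tsupport _ (right_ne_zero_of_mul hp)⟩
  refine ⟨(hχ.smooth.comp contDiff_fst).mul (hψ.smooth.comp contDiff_snd), ?_,
    hsub.trans (prod_mono hχ.support_subset hψ.support_subset)⟩
  exact (hχ.compact_support.isCompact.prod hψ.compact_support.isCompact).of_isClosed_subset
    (isClosed_tsupport _) hsub

theorem memLp_of_continuous_compact {T : ℝ} {k : ℝ × E3 → ℝ} (hk : Continuous k)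
    (hkc : HasCompactSupport k) : MemLp k 2 ((volume.restrict (Ioo 0 T)).prod volume) :=
  hk.memLp_of_hasCompactSupport hkc

theorem integrable_mul_of_continuous_compact {T : ℝ} {w : ℝ × E3 → ℝ}
    (hw : MemLp w 2 ((volume.restrict (Ioo 0 T)).prod volume)) {k : ℝ × E3 → ℝ}
    (hk : Continuous k) (hkc : HasCompactSupport k) :
    Integrable (fun p => w p * k p) ((volume.restrict (Ioo 0 T)).prod volume) :=
  hw.integrable_mul (memLp_of_continuous_compact hk hkc)

theorem integrable_mul_apply_of_bounded {T : ℝ} {w : ℝ × E3 → ℝ} {U : ℝ × E3 → E3}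
    (hw : MemLp w 2 ((volume.restrict (Ioo 0 T)).prod volume))
    (hU : MemLp U 2 ((volume.restrict (Ioo 0 T)).prod volume))
    {L : ℝ × E3 → E3 →L[ℝ] ℝ} (hL : Measurable L) {M : ℝ} (hM : ∀ p, ‖L p‖ ≤ M) :
    Integrable (fun p => w p * L p (U p)) ((volume.restrict (Ioo 0 T)).prod volume) := by
  have hLU : MemLp (fun p => L p (U p)) 2 ((volume.restrict (Ioo 0 T)).prod volume) := by
    refine MemLp.of_le (g := fun p => M • U p) (hU.const_smul M)
      (isBoundedBilinearMap_apply.continuous.comp_aestronglyMeasurable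
        (hL.aestronglyMeasurable.prodMk hU.1)) (Eventually.of_forall fun p => ?_)
    rw [norm_smul]
    refine ((L p).le_opNorm _).trans (mul_le_mul_of_nonneg_right ?_ (norm_nonneg _))
    exact (hM p).trans (le_abs_self M)
  exact hw.integrable_mul hLU

section TestIntegrability

variable {T : ℝ} {w : ℝ × E3 → ℝ} {U : ℝ × E3 → E3} {χ : ℝ → ℝ} {ψ : E3 → ℝ} {V : Set ℝ}
  {W : Set E3}

theorem integrable_mul_deriv_test (hw : MemLp w 2 ((volume.restrict (Ioo 0 T)).prod volume))
    (hχ : IsTestFunction V χ) (hψ : IsTestFunction W ψ) :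
    Integrable (fun p : ℝ × E3 => deriv χ p.1 * (w p * ψ p.2))
      ((volume.restrict (Ioo 0 T)).prod volume) := by
  have hχ' : IsTestFunction univ (deriv χ) :=
    ⟨hχ.smooth.iterate_deriv 1, hχ.compact_support.deriv, subset_univ _⟩
  have := hχ'.prod_mul hψ
  refine (integrable_mul_of_continuous_compact hw this.smooth.continuous
    this.compact_support).congr (Eventually.of_forall fun p => ?_)
  dsimp only
  ring

theorem integrable_mul_fderiv_test (hw : MemLp w 2 ((volume.restrict (Ioo 0 T)).prod volume))
    (hU : MemLp U 2 ((volume.restrict (Ioo 0 T)).prod volume))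
    (hχ : IsTestFunction V χ) (hψ : IsTestFunction W ψ) :
    Integrable (fun p : ℝ × E3 => χ p.1 * (w p * fderiv ℝ ψ p.2 (U p)))
      ((volume.restrict (Ioo 0 T)).prod volume) := by
  have hψd : Continuous (fderiv ℝ ψ) := hψ.smooth.continuous_fderiv (by simp)
  obtain ⟨M, hM⟩ := (hψ.compact_support.fderiv ℝ).exists_bound_of_continuous hψd
  obtain ⟨N, hN⟩ := hχ.compact_support.exists_bound_of_continuous hχ.smooth.continuous
  exact (integrable_mul_apply_of_bounded hw hU (hψd.measurable.comp measurable_snd)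
    (fun p => hM _)).bdd_mul
    (hχ.smooth.continuous.comp continuous_fst).aestronglyMeasurable
    (Eventually.of_forall fun p => hN _)

end TestIntegrability

/-- The continuity equation tested with products. -/
theorem ZeroExtension.weak {T : ℝ} {Ω : Set E3} (hΩ : MeasurableSet Ω) {ρ : ℝ → E3 → ℝ}
    {u : ℝ → E3 → E3} {R : ℝ × E3 → ℝ} {U : ℝ × E3 → E3} {G : ℝ × E3 → E3 →L[ℝ] E3}
    (h : ZeroExtension T Ω ρ u R U G) {ρ₀ : E3 → ℝ} (hc : SolvesContinuityEquation T Ω ρ u ρ₀)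
    {χ : ℝ → ℝ} (hχ : IsTestFunction (Iio T) χ) {ψ : E3 → ℝ} (hψ : IsTestFunction Ω ψ) :
    (∫ t in Ioo 0 T, (deriv χ t * (∫ x, R (t, x) * ψ x) +
      χ t * ∫ x, R (t, x) * fderiv ℝ ψ x (U (t, x)))) + χ 0 * ∫ x in Ω, ρ₀ x * ψ x = 0 := by
  have hS : MeasurableSet ((univ : Set ℝ) ×ˢ Ω) := MeasurableSet.univ.prod hΩ
  have h0 := hc _ (hχ.prod_mul hψ)
  have e1 : ∫ x in Ω, ρ₀ x * (χ 0 * ψ x) = χ 0 * ∫ x in Ω, ρ₀ x * ψ x := by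
    rw [← integral_const_mul]
    exact integral_congr_ae (Eventually.of_forall fun x => by dsimp only; ring)
  have i1 := integrable_mul_deriv_test h.memLp_R hχ hψ
  have i2 := integrable_mul_fderiv_test h.memLp_R h.memLp_U hχ hψ
  have e2 : ∫ p in cylinder T Ω, (ρ p.1 p.2 * deriv (fun s => χ s * ψ p.2) p.1
        + ρ p.1 p.2 * fderiv ℝ (fun y => χ p.1 * ψ y) p.2 (u p.1 p.2)) =
      ∫ p, (deriv χ p.1 * (R p * ψ p.2) + χ p.1 * (R p * fderiv ℝ ψ p.2 (U p)))
        ∂((volume.restrict (Ioo 0 T)).prod volume) := by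
    rw [← setIntegral_eq_integral_of_forall_compl_eq_zero
      (μ := (volume.restrict (Ioo 0 T)).prod volume) (s := (univ : Set ℝ) ×ˢ Ω) (fun p hp => by
        have : p.2 ∉ Ω := fun hn => hp ⟨mem_univ _, hn⟩
        have hR : R p = 0 := h.R_zero p.1 p.2 this
        simp [hR]), prod_restrict_univ_prod]
    refine integral_congr_ae ?_
    filter_upwards [h.R_eq, h.U_eq] with p hp1 hp2
    have d1 : deriv (fun s => χ s * ψ p.2) p.1 = deriv χ p.1 * ψ p.2 :=
      deriv_mul_const ((hχ.smooth.differentiable (by simp)).differentiableAt) _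
    have d2 : fderiv ℝ (fun y => χ p.1 * ψ y) p.2 = χ p.1 • fderiv ℝ ψ p.2 :=
      fderiv_const_mul ((hψ.smooth.differentiable (by simp)).differentiableAt) _
    rw [d1, d2, ← hp1, ← hp2]
    simp only [smul_apply, smul_eq_mul]
    ring
  dsimp only at h0
  rw [e1, e2, integral_prod _ (i1.fun_add i2)] at h0
  refine Eq.trans ?_ h0
  congr 1
  refine integral_congr_ae ?_
  filter_upwards [i1.prod_right_ae, i2.prod_right_ae] with t h1 h2
  rw [integral_add h1 h2, integral_const_mul, integral_const_mul]

/-- Reduces the lower bound on the density to the comparison principle for an upper bound. -/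
theorem TransportSolution.neg {T : ℝ} {w : ℝ × E3 → ℝ} {U : ℝ × E3 → E3}
    {G : ℝ × E3 → E3 →L[ℝ] E3} {w₀ : E3 → ℝ} (h : TransportSolution T w 0 U G w₀) :
    TransportSolution T (fun p => -w p) 0 U G (fun x => -w₀ x) := by
  refine ⟨h.measurable_w.neg, h.measurable_g, h.measurable_U, h.measurable_G, h.measurable_init.neg,
    h.memLp_w.neg, h.memLp_g, h.memLp_U, h.memLp_G, h.memLp_init.neg, h.isH1, fun χ hχ ψ hψ => ?_⟩
  have h0 := h.weak χ hχ ψ hψ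
  simp only [neg_mul, integral_neg, Pi.zero_apply, zero_mul, integral_zero, sub_zero, mul_neg]
    at h0 ⊢
  rw [← neg_eq_zero]
  refine Eq.trans ?_ h0
  rw [neg_add, neg_neg, ← integral_neg]
  congr 1
  exact integral_congr_ae (Eventually.of_forall fun t => by dsimp only; ring)

theorem setIntegral_deriv_eq_neg {T : ℝ} (hT : 0 < T) {χ : ℝ → ℝ} (hχ : IsTestFunction (Iio T) χ) :
    ∫ t in Ioo 0 T, deriv χ t = -χ 0 := by
  have h1 : χ T = 0 := hχ.eq_zero_of_notMem (lt_irrefl T)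
  rw [← integral_Ioc_eq_integral_Ioo, ← intervalIntegral.integral_of_le hT.le,
    intervalIntegral.integral_deriv_eq_sub
      (fun t _ => (hχ.smooth.differentiable (by simp)).differentiableAt)
      ((hχ.smooth.continuous_deriv (by simp)).intervalIntegrable _ _), h1, zero_sub]

/-- A time-independent `r` contributes `∫ χ' = -χ 0` in time, which is absorbed in the initial
value; its transport term becomes the source `g = div(r U)`. -/
theorem TransportSolution.sub_stationary {T : ℝ} (hT : 0 < T) {w g : ℝ × E3 → ℝ}
    {U : ℝ × E3 → E3} {G : ℝ × E3 → E3 →L[ℝ] E3} {w₀ : E3 → ℝ}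
    (h : TransportSolution T w 0 U G w₀) {r : E3 → ℝ} (hrm : Measurable r)
    (hr : MemLp r 2 volume) (hgm : Measurable g)
    (hg : MemLp g 2 ((volume.restrict (Ioo 0 T)).prod volume))
    (heq : ∀ᵐ t ∂(volume.restrict (Ioo 0 T)), ∀ ψ : E3 → ℝ, IsTestFunction univ ψ →
      ∫ x, r x * fderiv ℝ ψ x (U (t, x)) = -∫ x, g (t, x) * ψ x) :
    TransportSolution T (fun p => w p - r p.2) g U G (fun x => w₀ x - r x) := by
  refine ⟨h.measurable_w.sub (hrm.comp measurable_snd), hgm, h.measurable_U, h.measurable_G,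
    h.measurable_init.sub hrm, h.memLp_w.sub (hr.comp_snd _), hg, h.memLp_U, h.memLp_G,
    h.memLp_init.sub hr, h.isH1, fun χ hχ ψ hψ => ?_⟩
  have hψ2 : MemLp ψ 2 volume := memLp_of_smooth hψ.smooth.continuous hψ.compact_support
  have hmul : ∀ {f : E3 → ℝ}, MemLp f 2 volume → Integrable (fun x => f x * ψ x) volume :=
    fun hf => hf.integrable_mul hψ2
  have h0 := h.weak χ hχ ψ hψ
  simp only [Pi.zero_apply, zero_mul, integral_zero, sub_zero] at h0
  have i1 := (integrable_mul_deriv_test h.memLp_w hχ hψ).integral_prod_left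
  have i2 := (integrable_mul_fderiv_test h.memLp_w h.memLp_U hχ hψ).integral_prod_left
  simp only [integral_const_mul] at i1 i2
  have i3 : Integrable (fun t => deriv χ t * ∫ x, r x * ψ x) (volume.restrict (Ioo 0 T)) :=
    (((hχ.smooth.continuous_deriv (by simp)).integrable_of_hasCompactSupport
      hχ.compact_support.deriv).mul_const _).restrict
  have key : ∫ t in Ioo 0 T, (deriv χ t * (∫ x, (w (t, x) - r x) * ψ x) +
      χ t * ((∫ x, (w (t, x) - r x) * fderiv ℝ ψ x (U (t, x))) - ∫ x, g (t, x) * ψ x)) =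
      ∫ t in Ioo 0 T, ((deriv χ t * (∫ x, w (t, x) * ψ x) +
        χ t * (∫ x, w (t, x) * fderiv ℝ ψ x (U (t, x)))) - deriv χ t * ∫ x, r x * ψ x) := by
    refine integral_congr_ae ?_
    filter_upwards [heq, ae_memLp_slice h.measurable_w h.memLp_w,
      ae_memLp_slice h.measurable_U h.memLp_U] with t h1 h2 h3
    simp only [sub_mul]
    rw [integral_sub (hmul h2) (hmul hr),
      integral_sub (integrable_mul_fderiv_apply h2 h3 hψ.smooth hψ.compact_support)
        (integrable_mul_fderiv_apply hr h3 hψ.smooth hψ.compact_support), h1 ψ hψ]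
    ring
  rw [key, integral_sub (i1.fun_add i2) i3, integral_mul_const, setIntegral_deriv_eq_neg hT hχ]
  simp only [sub_mul]
  rw [integral_sub (hmul h.memLp_init) (hmul hr)]
  linear_combination h0

theorem ae_prod_mem {T : ℝ} {Ω : Set E3} (hΩ : MeasurableSet Ω) :
    ∀ᵐ p ∂(volume.restrict (cylinder T Ω) : Measure (ℝ × E3)), p ∈ cylinder T Ω :=
  ae_restrict_mem (measurableSet_Ioo.prod hΩ)

theorem isFiniteMeasure_cylinder {Ω : Set E3} (hΩb : Bornology.IsBounded Ω) (T : ℝ) :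
    IsFiniteMeasure (volume.restrict (cylinder T Ω) : Measure (ℝ × E3)) := by
  refine ⟨?_⟩
  rw [Measure.restrict_apply_univ]
  exact (Metric.isBounded_Ioo 0 T |>.prod hΩb).measure_lt_top

theorem integrable_of_memLp_of_eq_zero {Ω : Set E3} (hΩ : MeasurableSet Ω)
    (hΩb : Bornology.IsBounded Ω) {T : ℝ} {f : ℝ × E3 → ℝ}
    (hf : MemLp f 2 ((volume.restrict (Ioo 0 T)).prod volume))
    (h0 : ∀ t, ∀ x ∉ Ω, f (t, x) = 0) :
    Integrable f ((volume.restrict (Ioo 0 T)).prod volume) := by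
  have := isFiniteMeasure_cylinder hΩb T
  have hS : MeasurableSet ((univ : Set ℝ) ×ˢ Ω) := MeasurableSet.univ.prod hΩ
  have e : ((univ : Set ℝ) ×ˢ Ω).indicator f = f := indicator_eq_self.2 fun p hp => by
    by_contra hn
    exact hp (h0 p.1 p.2 fun h => hn ⟨mem_univ _, h⟩)
  rw [← e, integrable_indicator_iff hS, IntegrableOn, prod_restrict_univ_prod]
  have := hf.restrict ((univ : Set ℝ) ×ˢ Ω)
  rw [prod_restrict_univ_prod] at this
  exact this.integrable one_le_two

theorem integral_cylinder_eq {Ω : Set E3} {T : ℝ} {f : ℝ × E3 → ℝ}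
    (h0 : ∀ t, ∀ x ∉ Ω, f (t, x) = 0) :
    ∫ p in cylinder T Ω, f p = ∫ p, f p ∂((volume.restrict (Ioo 0 T)).prod volume) := by
  rw [← prod_restrict_univ_prod]
  refine setIntegral_eq_integral_of_forall_compl_eq_zero fun p hp => ?_
  exact h0 p.1 p.2 fun h => hp ⟨mem_univ _, h⟩

/-! ### The divergence of the threshold times the velocity -/

/-- The density of `div (r U)`. -/
noncomputable def divergenceDensity (Ω : Set E3) (r : E3 → ℝ) (U : ℝ × E3 → E3)
    (G : ℝ × E3 → E3 →L[ℝ] E3) (p : ℝ × E3) : ℝ :=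
  Ω.indicator r p.2 * traceCLM (G p) + fderiv ℝ r p.2 (U p)

theorem IsC1OnClosure.measurable_indicator {Ω : Set E3} (hΩ : MeasurableSet Ω) {r : E3 → ℝ}
    (hr : IsC1OnClosure Ω r) : Measurable (Ω.indicator r) := by
  classical
  rw [← piecewise_eq_indicator]
  exact hr.1.continuousOn.measurable_piecewise continuousOn_const hΩ

theorem IsC1OnClosure.memLp_indicator {Ω : Set E3} (hΩ : MeasurableSet Ω)
    (hΩb : Bornology.IsBounded Ω) {r : E3 → ℝ} (hr : IsC1OnClosure Ω r) :
    MemLp (Ω.indicator r) 2 volume := by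
  obtain ⟨M, hM⟩ := hr.exists_bound hΩb
  refine MemLp.of_le (g := Ω.indicator fun _ => (M : ℝ))
    (memLp_indicator_const 2 hΩ (M : ℝ) (Or.inr hΩb.measure_lt_top.ne))
    (hr.measurable_indicator hΩ).aestronglyMeasurable (Eventually.of_forall fun x => ?_)
  by_cases hx : x ∈ Ω
  · simpa [hx] using (hM x hx).1
  · simp [hx]

section DivergenceDensity

variable {T : ℝ} {Ω : Set E3} {ρ : ℝ → E3 → ℝ} {u : ℝ → E3 → E3} {R : ℝ × E3 → ℝ}
  {U : ℝ × E3 → E3} {G : ℝ × E3 → E3 →L[ℝ] E3} {r : E3 → ℝ}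

/-- The indicator removes the trace term and `U = 0` the other one, whatever value `fderiv ℝ r`
takes outside `Ω`. -/
theorem ZeroExtension.divergenceDensity_zero (h : ZeroExtension T Ω ρ u R U G) (t : ℝ) (x : E3)
    (hx : x ∉ Ω) : divergenceDensity Ω r U G (t, x) = 0 := by
  simp [divergenceDensity, hx, h.U_zero t x hx]

theorem ZeroExtension.measurable_divergenceDensity (hΩ : MeasurableSet Ω)
    (hr : IsC1OnClosure Ω r) (h : ZeroExtension T Ω ρ u R U G) :
    Measurable (divergenceDensity Ω r U G) := by
  have h1 := hr.measurable_indicator hΩ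
  have h2 := h.measurable_G
  exact ((h1.comp measurable_snd).mul (traceCLM.measurable.comp h2)).add
    (isBoundedBilinearMap_apply.continuous.measurable.comp
      (((measurable_fderiv ℝ r).comp measurable_snd).prodMk h.measurable_U))

theorem ZeroExtension.memLp_divergenceDensity (hΩ : MeasurableSet Ω)
    (hΩb : Bornology.IsBounded Ω) (hr : IsC1OnClosure Ω r) (h : ZeroExtension T Ω ρ u R U G) :
    MemLp (divergenceDensity Ω r U G) 2 ((volume.restrict (Ioo 0 T)).prod volume) := by
  obtain ⟨M, hM⟩ := hr.exists_bound hΩb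
  obtain ⟨c, hc0, hc⟩ := exists_abs_traceCLM_le
  refine MemLp.of_le (g := fun p => M * c * ‖G p‖ + M * ‖U p‖)
    ((h.memLp_G.norm.const_mul (M * c)).add (h.memLp_U.norm.const_mul (M : ℝ)))
    (h.measurable_divergenceDensity hΩ hr).aestronglyMeasurable
    (Eventually.of_forall fun p => ?_)
  refine le_trans ?_ (le_abs_self _)
  by_cases hx : p.2 ∈ Ω
  · rw [divergenceDensity, indicator_of_mem hx]
    refine (norm_add_le _ _).trans (add_le_add ?_ ?_)
    · rw [norm_mul, mul_assoc]
      exact mul_le_mul (hM _ hx).1 (hc _) (norm_nonneg _) M.coe_nonneg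
    · exact ((fderiv ℝ r p.2).le_opNorm _).trans
        (mul_le_mul_of_nonneg_right (hM _ hx).2 (norm_nonneg _))
  · have : divergenceDensity Ω r U G p = 0 := h.divergenceDensity_zero p.1 p.2 hx
    rw [this, norm_zero]
    positivity

/-- The exceptional set of times is chosen before `ψ`, so `ψ` may be the slice at time `t` of a
space-time test function. -/
theorem ZeroExtension.integral_indicator_mul_fderiv (hΩo : IsOpen Ω)
    (hΩb : Bornology.IsBounded Ω) (hr : IsC1OnClosure Ω r) (h : ZeroExtension T Ω ρ u R U G) :
    ∀ᵐ t ∂(volume.restrict (Ioo 0 T)), ∀ ψ : E3 → ℝ, ContDiff ℝ 1 ψ → HasCompactSupport ψ →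
      ∫ x, Ω.indicator r x * fderiv ℝ ψ x (U (t, x)) =
        -∫ x, divergenceDensity Ω r U G (t, x) * ψ x := by
  filter_upwards [h.isW012] with t ht ψ hψ hψc
  have := ht.integral_mul_fderiv_eq_neg hΩo hΩb hr hψ hψc
  rw [← setIntegral_eq_integral_of_forall_compl_eq_zero (s := Ω) (fun x hx => by simp [hx]),
    ← setIntegral_eq_integral_of_forall_compl_eq_zero (s := Ω)
      (f := fun x => divergenceDensity Ω r U G (t, x) * ψ x)
      (fun x hx => by simp [h.divergenceDensity_zero t x hx])]
  rw [setIntegral_congr_fun hΩo.measurableSet (g := fun x => r x * fderiv ℝ ψ x (U (t, x)))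
    (fun x hx => by simp [hx]), this,
    setIntegral_congr_fun hΩo.measurableSet
      (f := fun x => divergenceDensity Ω r U G (t, x) * ψ x)
      (g := fun x => weightedDivergence r (U (t, x)) (G (t, x)) x * ψ x)
      (fun x hx => by simp [divergenceDensity, weightedDivergence, hx])]

theorem hasCompactSupport_slice {φ : ℝ × E3 → ℝ} (hφ : HasCompactSupport φ) (t : ℝ) :
    HasCompactSupport fun x => φ (t, x) := by
  refine HasCompactSupport.intro (hφ.isCompact.image continuous_snd) fun x hx => ?_
  by_contra hn
  exact hx ⟨(t, x), subset_tsupport _ hn, rfl⟩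

theorem fderiv_slice {φ : ℝ × E3 → ℝ} (hφ : ContDiff ℝ ∞ φ) (t : ℝ) (x : E3) :
    fderiv ℝ (fun y => φ (t, y)) x = (fderiv ℝ φ (t, x)).comp (.inr ℝ ℝ E3) := by
  have h1 : HasFDerivAt φ (fderiv ℝ φ (t, x)) (t, x) :=
    ((hφ.differentiable (by simp)).differentiableAt).hasFDerivAt
  exact (h1.comp x (hasFDerivAt_prodMk_right t x)).fderiv

theorem ZeroExtension.hasWeakDivergence (hΩo : IsOpen Ω)
    (hΩb : Bornology.IsBounded Ω) (hr : IsC1OnClosure Ω r) (h : ZeroExtension T Ω ρ u R U G) :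
    HasWeakDivergence T Ω (fun t x => r x • u t x)
      (fun t x => divergenceDensity Ω r U G (t, x)) := by
  have hΩ := hΩo.measurableSet
  have hg := h.memLp_divergenceDensity hΩ hΩb hr
  have hgz := h.divergenceDensity_zero (r := r)
  have hgi := integrable_of_memLp_of_eq_zero hΩ hΩb hg hgz
  constructor
  · have := hgi.restrict (s := (univ : Set ℝ) ×ˢ Ω)
    rw [prod_restrict_univ_prod] at this
    exact IntegrableOn.locallyIntegrableOn this
  · intro φ hφ
    have hdc : Continuous (fderiv ℝ φ) := hφ.smooth.continuous_fderiv (by simp)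
    obtain ⟨M, hM⟩ := (hφ.compact_support.fderiv ℝ).exists_bound_of_continuous hdc
    have i1 : Integrable (fun p : ℝ × E3 => Ω.indicator r p.2 *
        fderiv ℝ (fun y => φ (p.1, y)) p.2 (U p)) ((volume.restrict (Ioo 0 T)).prod volume) := by
      have := integrable_mul_apply_of_bounded ((hr.memLp_indicator hΩ hΩb).comp_snd
        (volume.restrict (Ioo 0 T))) h.memLp_U
        (L := fun p => (fderiv ℝ φ p).comp (.inr ℝ ℝ E3)) (M := M * 1)
        (by fun_prop) (fun p => by
          refine (ContinuousLinearMap.opNorm_comp_le _ _).trans ?_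
          refine mul_le_mul (hM p) (ContinuousLinearMap.norm_inr_le_one ℝ ℝ E3)
            (norm_nonneg _) ((norm_nonneg _).trans (hM 0)))
      refine this.congr (Eventually.of_forall fun p => ?_)
      dsimp only
      rw [fderiv_slice hφ.smooth]
    have i2 : Integrable (fun p => divergenceDensity Ω r U G p * φ p)
        ((volume.restrict (Ioo 0 T)).prod volume) :=
      integrable_mul_of_continuous_compact hg hφ.smooth.continuous hφ.compact_support
    rw [integral_cylinder_eq (f := fun p => divergenceDensity Ω r U G (p.1, p.2) * φ p)
      (fun t x hx => by simp [hgz t x hx])]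
    have e1 : ∫ p in cylinder T Ω, fderiv ℝ (fun y => φ (p.1, y)) p.2 (r p.2 • u p.1 p.2) =
        ∫ p in cylinder T Ω, Ω.indicator r p.2 * fderiv ℝ (fun y => φ (p.1, y)) p.2 (U p) := by
      refine integral_congr_ae ?_
      filter_upwards [h.U_eq, ae_prod_mem hΩ] with p hp hpΩ
      rw [indicator_of_mem hpΩ.2, map_smul, hp, smul_eq_mul]
    rw [e1, integral_cylinder_eq (f := fun p => Ω.indicator r p.2 *
      fderiv ℝ (fun y => φ (p.1, y)) p.2 (U p)) (fun t x hx => by simp [hx]),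
      integral_prod _ i1, integral_prod _ i2, ← integral_neg]
    refine integral_congr_ae ?_
    filter_upwards [h.integral_indicator_mul_fderiv hΩo hΩb hr] with t ht
    exact ht _ ((hφ.smooth.comp (contDiff_prodMk_right t)).of_le (by exact_mod_cast le_top))
      (hasCompactSupport_slice hφ.compact_support t)

end DivergenceDensity

theorem integrable_mul_of_locallyIntegrableOn {X : Type*} [NormedAddCommGroup X]
    [MeasurableSpace X] [BorelSpace X] {μ : Measure X} {U : Set X} {f φ : X → ℝ}
    (hf : LocallyIntegrableOn f U μ) (hφ : Continuous φ) (hφc : HasCompactSupport φ)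
    (hφU : tsupport φ ⊆ U) : Integrable (fun x => f x * φ x) μ := by
  have h1 : IntegrableOn (fun x => f x * φ x) (tsupport φ) μ :=
    (hf.integrableOn_compact_subset hφU hφc.isCompact).mul_continuousOn hφ.continuousOn
      hφc.isCompact
  refine (integrableOn_iff_integrable_of_support_subset fun x hx => ?_).1 h1
  exact subset_tsupport _ (right_ne_zero_of_mul hx)

/-- Identifies the divergence given in assertion (i) with the explicit `divergenceDensity`. -/
theorem HasWeakDivergence.ae_eq {T : ℝ} {Ω : Set E3} (hΩo : IsOpen Ω) {v : ℝ → E3 → E3}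
    {g g' : ℝ → E3 → ℝ} (h : HasWeakDivergence T Ω v g) (h' : HasWeakDivergence T Ω v g') :
    ∀ᵐ p ∂(volume.restrict (cylinder T Ω)), g p.1 p.2 = g' p.1 p.2 := by
  have hco : IsOpen (cylinder T Ω) := isOpen_Ioo.prod hΩo
  have key := hco.ae_eq_zero_of_integral_contDiff_smul_eq_zero (μ := volume)
    (f := fun p : ℝ × E3 => g p.1 p.2 - g' p.1 p.2) (h.1.sub h'.1) fun φ hφ hφc hφs => by
      have hφt : IsTestFunction (cylinder T Ω) φ := ⟨hφ, hφc, hφs⟩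
      have hint : ∀ {g : ℝ → E3 → ℝ}, LocallyIntegrableOn (fun p : ℝ × E3 => g p.1 p.2)
          (cylinder T Ω) → Integrable (fun p => g p.1 p.2 * φ p) := fun hg =>
        integrable_mul_of_locallyIntegrableOn hg hφ.continuous hφc hφs
      have e : ∀ g : ℝ → E3 → ℝ, ∫ p in cylinder T Ω, g p.1 p.2 * φ p = ∫ p, g p.1 p.2 * φ p :=
        fun g => setIntegral_eq_integral_of_forall_compl_eq_zero fun p hp => by
          rw [hφt.eq_zero_of_notMem hp, mul_zero]
      have h1 := h.2 φ hφt
      rw [h'.2 φ hφt, neg_inj, e, e] at h1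
      simp only [smul_eq_mul, mul_sub]
      simp_rw [mul_comm (φ _)]
      rw [integral_sub (hint h.1) (hint h'.1), h1, sub_self]
  rw [ae_restrict_iff' hco.measurableSet]
  filter_upwards [key] with p hp hpc
  exact sub_eq_zero.1 (hp hpc)

/-! ### Comparison principle by renormalizing with the positive part -/

theorem hasDerivAt_max_zero_sq (s : ℝ) :
    HasDerivAt (fun s : ℝ => (max s 0) ^ 2) (2 * max s 0) s := by
  rcases lt_trichotomy s 0 with hs | rfl | hs
  · rw [max_eq_right hs.le, mul_zero]
    refine (hasDerivAt_const s (0 : ℝ)).congr_of_eventuallyEq ?_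
    filter_upwards [eventually_lt_nhds hs] with x hx
    rw [max_eq_right hx.le]; norm_num
  · rw [max_self, mul_zero]
    rw [hasDerivAt_iff_isLittleO]
    have h : (fun x : ℝ => x * x) =o[𝓝 0] fun x => x := by
      simpa using (Asymptotics.isLittleO_one_iff ℝ).2 (tendsto_id (x := 𝓝 (0 : ℝ))) |>.mul_isBigO
        (Asymptotics.isBigO_refl (fun x : ℝ => x) (𝓝 0))
    refine (Asymptotics.IsBigO.of_norm_le fun x => ?_).trans_isLittleO (by simpa using h)
    simp only [max_self, smul_zero, sub_zero, Real.norm_eq_abs]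
    rcases le_total x 0 with hx | hx
    · rw [max_eq_right hx]; simpa using mul_self_nonneg x
    · rw [max_eq_left hx, sq]; simp
  · rw [max_eq_left hs.le]
    have := hasDerivAt_pow 2 s
    refine (by simpa using this : HasDerivAt (fun s : ℝ => s ^ 2) (2 * s) s).congr_of_eventuallyEq ?_
    filter_upwards [eventually_gt_nhds hs] with x hx
    rw [max_eq_left hx.le]

/-- A `C¹` approximation of the positive part. -/
theorem exists_smoothed_posPart {ε : ℝ} (hε : 0 < ε) :
    ∃ b b' : ℝ → ℝ, (∀ s, HasDerivAt b (b' s) s) ∧ Continuous b' ∧ LipschitzWith 1 b ∧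
      (∀ s ≤ 0, b s = 0 ∧ b' s = 0) ∧ (∀ s, max s 0 ≤ b s + ε) ∧
      ∀ s, |b s - s * b' s| ≤ ε := by
  have hpos : ∀ s : ℝ, 0 < (max s 0) ^ 2 + ε ^ 2 := fun s => by positivity
  have hge : ∀ s : ℝ, ε ≤ √((max s 0) ^ 2 + ε ^ 2) := fun s =>
    Real.le_sqrt_of_sq_le (by nlinarith [sq_nonneg (max s 0)])
  have hge' : ∀ s : ℝ, max s 0 ≤ √((max s 0) ^ 2 + ε ^ 2) := fun s =>
    Real.le_sqrt_of_sq_le (by nlinarith [sq_nonneg ε])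
  have hd : ∀ s, HasDerivAt (fun s : ℝ => √((max s 0) ^ 2 + ε ^ 2) - ε)
      (max s 0 / √((max s 0) ^ 2 + ε ^ 2)) s := fun s => by
    have := (((hasDerivAt_max_zero_sq s).add_const (ε ^ 2)).sqrt (hpos s).ne').sub_const ε
    rwa [mul_div_mul_left _ _ two_ne_zero] at this
  -- With `q = √(s⁺² + ε²)` one has `b = q - ε` and `s b' = q - ε²/q`, so `b - s b' = ε²/q - ε` lies
  -- in `[-ε, 0]` because `q ≥ ε`.
  refine ⟨fun s => √((max s 0) ^ 2 + ε ^ 2) - ε, fun s => max s 0 / √((max s 0) ^ 2 + ε ^ 2), hd,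
    ?_, ?_, fun s hs => ?_, fun s => ?_, fun s => ?_⟩
  · refine Continuous.div (by fun_prop) (by fun_prop) fun s => (hε.trans_le (hge s)).ne'
  · refine lipschitzWith_of_nnnorm_deriv_le (fun s => (hd s).differentiableAt) fun s => ?_
    rw [(hd s).deriv, ← NNReal.coe_le_coe, coe_nnnorm, Real.norm_of_nonneg (by positivity)]
    exact div_le_one_of_le₀ (hge' s) (by positivity)
  · simp [max_eq_right hs, Real.sqrt_sq hε.le]
  · simpa using hge' s
  · have hs : s * (max s 0 / √((max s 0) ^ 2 + ε ^ 2)) =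
        √((max s 0) ^ 2 + ε ^ 2) - ε ^ 2 / √((max s 0) ^ 2 + ε ^ 2) := by
      have h1 : s * max s 0 = max s 0 ^ 2 := by
        rcases le_total s 0 with h | h
        · simp [max_eq_right h]
        · rw [max_eq_left h, sq]
      have h0 := (hε.trans_le (hge s)).ne'
      rw [← mul_div_assoc, h1, eq_sub_iff_add_eq, ← add_div, div_eq_iff h0,
        Real.mul_self_sqrt (hpos s).le]
    dsimp only
    rw [hs, abs_le]
    have h0 := hε.trans_le (hge s)
    have h2 : ε ^ 2 / √((max s 0) ^ 2 + ε ^ 2) ≤ ε := by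
      rw [div_le_iff₀ h0, sq ε]
      have := hge s
      rw [sq ε] at this
      exact mul_le_mul_of_nonneg_left this hε.le
    have h3 : 0 ≤ ε ^ 2 / √((max s 0) ^ 2 + ε ^ 2) := by positivity
    constructor <;> linarith

/-- A test function equal to `T - t` on a bounded cylinder. -/
theorem exists_linear_test {Ω : Set E3} (hΩb : Bornology.IsBounded Ω) (T : ℝ) :
    ∃ φ : ℝ × E3 → ℝ, ContDiff ℝ ∞ φ ∧ HasCompactSupport φ ∧ (∀ x, φ (T, x) = 0) ∧
      ∀ p ∈ cylinder T Ω, φ p = T - p.1 ∧ ∀ s y, fderiv ℝ φ p (s, y) = -s := by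
  obtain ⟨r, hr0, hr⟩ := ((Metric.isBounded_Ioo 0 T).prod hΩb).subset_ball_lt 0 (0 : ℝ × E3)
  let f : ContDiffBump (0 : ℝ × E3) := ⟨r, r + 1, hr0, by linarith⟩
  refine ⟨fun p => (T - p.1) * f p, (contDiff_const.sub contDiff_fst).mul f.contDiff,
    f.hasCompactSupport.mul_left, fun x => by simp, fun p hp => ?_⟩
  have h1 : f =ᶠ[𝓝 p] 1 := f.eventuallyEq_one_of_mem_ball (hr hp)
  have h2 : (fun p : ℝ × E3 => (T - p.1) * f p) =ᶠ[𝓝 p] fun p => T - p.1 := by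
    filter_upwards [h1] with q hq
    rw [hq]; simp
  refine ⟨h2.eq_of_nhds, fun s y => ?_⟩
  have h3 : HasFDerivAt (fun p : ℝ × E3 => T - p.1) (-(ContinuousLinearMap.fst ℝ ℝ E3)) p :=
    hasFDerivAt_fst.const_sub T
  rw [h2.fderiv_eq, h3.fderiv]
  simp

/-- Renormalize with the smoothed positive part and test with `T - t`: the time derivative yields
`-∫∫ b(w)` and the initial term vanishes. The test function has no spatial gradient on the cylinder
and `w` vanishes off `Ω`, so no flux remains. What is left is `(T - t) (b(w) - w b'(w)) div U`, of
size `ε` times the integrable `‖G‖`. -/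
theorem TransportSolution.ae_nonpos {T : ℝ} (hT : 0 < T) {Ω : Set E3} (hΩ : MeasurableSet Ω)
    (hΩb : Bornology.IsBounded Ω) {w g : ℝ × E3 → ℝ} {U : ℝ × E3 → E3}
    {G : ℝ × E3 → E3 →L[ℝ] E3} {w₀ : E3 → ℝ} (h : TransportSolution T w g U G w₀)
    (hwz : ∀ t, ∀ x ∉ Ω, w (t, x) = 0) (hGz : ∀ t, ∀ x ∉ Ω, G (t, x) = 0)
    (hw₀ : ∀ᵐ x ∂(volume : Measure E3), w₀ x ≤ 0)
    (hg : ∀ᵐ p ∂((volume.restrict (Ioo 0 T)).prod volume), 0 < w p → g p = 0) :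
    ∀ᵐ p ∂((volume.restrict (Ioo 0 T)).prod volume), w p ≤ 0 := by
  set μ : Measure (ℝ × E3) := (volume.restrict (Ioo 0 T)).prod volume with hμ
  obtain ⟨φ, hφ, hφc, hφT, hφl⟩ := exists_linear_test hΩb T
  obtain ⟨c, hc0, hc⟩ := exists_abs_traceCLM_le
  have hwi : Integrable w μ := integrable_of_memLp_of_eq_zero hΩ hΩb h.memLp_w hwz
  have hGi : Integrable (fun p => ‖G p‖) μ :=
    integrable_of_memLp_of_eq_zero hΩ hΩb h.memLp_G.norm fun t x hx => by simp [hGz t x hx]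
  have hΩi : Integrable (((univ : Set ℝ) ×ˢ Ω).indicator fun _ => (1 : ℝ)) μ := by
    rw [integrable_indicator_iff (MeasurableSet.univ.prod hΩ), IntegrableOn, hμ,
      prod_restrict_univ_prod]
    have := isFiniteMeasure_cylinder hΩb T
    exact integrable_const 1
  have htime : ∀ᵐ p ∂μ, p.1 ∈ Ioo 0 T := by
    have := (Measure.quasiMeasurePreserving_fst (μ := volume.restrict (Ioo 0 T))
      (ν := (volume : Measure E3))).ae (ae_restrict_mem measurableSet_Ioo)
    exact this
  set K : ℝ := T * c * ∫ p, ‖G p‖ ∂μ with hK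
  set V : ℝ := ∫ p, ((univ : Set ℝ) ×ˢ Ω).indicator (fun _ => (1 : ℝ)) p ∂μ with hV
  have main : ∀ ε : ℝ, 0 < ε → ∫ p, max (w p) 0 ∂μ ≤ ε * (K + V) := by
    intro ε hε
    obtain ⟨b, b', hb, hb'c, hL, hb0, hbε, hbb⟩ := exists_smoothed_posPart hε
    have hR := h.renormalized hT hb hb'c hL (hb0 0 le_rfl).1 hφ hφc hφT
    have hrhs : ∫ x, b (w₀ x) * φ (0, x) = 0 := by
      rw [← integral_zero E3 ℝ (μ := volume)]
      refine integral_congr_ae ?_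
      filter_upwards [hw₀] with x hx
      rw [(hb0 _ hx).1, zero_mul]
    rw [hrhs, neg_zero] at hR
    have hbc : Continuous b := hL.continuous
    have hbw : Integrable (fun p => b (w p)) μ := by
      refine hwi.norm.mono' (hbc.comp_aestronglyMeasurable hwi.1) (Eventually.of_forall fun p => ?_)
      have := hL.dist_le_mul (w p) 0
      simpa [Real.dist_eq, (hb0 0 le_rfl).1] using this
    set D : ℝ × E3 → ℝ := fun p =>
      (T - p.1) * (b (w p) - w p * b' (w p)) * traceCLM (G p) with hD
    have hDb : ∀ᵐ p ∂μ, ‖D p‖ ≤ T * ε * (c * ‖G p‖) := by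
      filter_upwards [htime] with p hp
      rw [hD, norm_mul, norm_mul]
      refine mul_le_mul (mul_le_mul ?_ (hbb _) (abs_nonneg _) hT.le) (hc _) (norm_nonneg _)
        (by positivity)
      rw [Real.norm_of_nonneg (by linarith [hp.2])]
      linarith [hp.1]
    have hDi : Integrable D μ := by
      refine ((hGi.const_mul c).const_mul (T * ε)).mono' ?_ hDb
      have h1 := h.measurable_w
      have h2 := h.measurable_G
      have h3 := hb'c.measurable
      have h4 := hbc.measurable
      exact Measurable.aestronglyMeasurable (by fun_prop)
    have hint : ∫ p, (D p - b (w p)) ∂μ = 0 := by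
      have hDb : Integrable (fun p => D p - b (w p)) μ := hDi.sub hbw
      rw [← hR, hμ, integral_prod _ hDb]
      refine integral_congr_ae ?_
      filter_upwards [Measure.ae_ae_of_ae_prod hg, ae_restrict_mem measurableSet_Ioo] with t ht hT
      refine integral_congr_ae ?_
      filter_upwards [ht] with x hx
      by_cases hxΩ : x ∈ Ω
      · obtain ⟨f1, f2⟩ := hφl (t, x) ⟨hT, hxΩ⟩
        -- The source never acts: `b'` vanishes on `(-∞, 0]`, and `g` vanishes where `w > 0`.
        have hgz : b' (w (t, x)) * g (t, x) = 0 := by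
          rcases le_or_gt (w (t, x)) 0 with hw | hw
          · rw [(hb0 _ hw).2, zero_mul]
          · rw [hx hw, mul_zero]
        rw [f1, f2, f2]
        simp only [hD]
        linear_combination (T - t) * hgz
      · simp [hD, hwz t x hxΩ, hb0 0 le_rfl]
    rw [integral_sub hDi hbw, sub_eq_zero] at hint
    calc ∫ p, max (w p) 0 ∂μ
        ≤ ∫ p, (b (w p) + ε * ((univ : Set ℝ) ×ˢ Ω).indicator (fun _ => (1 : ℝ)) p) ∂μ := by
          refine integral_mono (hwi.pos_part) (hbw.add (hΩi.const_mul ε)) fun p => ?_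
          by_cases hp : p.2 ∈ Ω
          · have : p ∈ (univ : Set ℝ) ×ˢ Ω := ⟨mem_univ _, hp⟩
            simpa [this] using hbε (w p)
          · have : w p = 0 := hwz p.1 p.2 hp
            simp [this, hp, (hb0 0 le_rfl).1]
      _ = (∫ p, D p ∂μ) + ε * V := by
          rw [integral_add hbw (hΩi.const_mul ε), integral_const_mul, hint]
      _ ≤ T * ε * (c * ∫ p, ‖G p‖ ∂μ) + ε * V := by
          gcongr
          rw [← integral_const_mul, ← integral_const_mul]
          refine integral_mono_ae hDi ((hGi.const_mul c).const_mul (T * ε)) ?_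
          filter_upwards [hDb] with p hp
          exact (le_abs_self _).trans hp
      _ = _ := by rw [hK]; ring
  have hle : ∫ p, max (w p) 0 ∂μ ≤ 0 := by
    have ht : Tendsto (fun ε : ℝ => ε * (K + V)) (𝓝[>] 0) (𝓝 0) := by
      have : Tendsto (fun ε : ℝ => ε * (K + V)) (𝓝 0) (𝓝 (0 * (K + V))) :=
        tendsto_id.mul_const _
      rw [zero_mul] at this
      exact this.mono_left nhdsWithin_le_nhds
    refine ge_of_tendsto ht ?_
    filter_upwards [self_mem_nhdsWithin] with ε hε
    exact main ε hε
  have h0 : ∫ p, max (w p) 0 ∂μ = 0 :=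
    le_antisymm hle (integral_nonneg fun p => le_max_right _ _)
  have hwp : Integrable (fun p => max (w p) 0) μ := hwi.pos_part
  have hae := (integral_eq_zero_iff_of_nonneg (f := fun p => max (w p) 0)
    (fun p => le_max_right _ _) hwp).1 h0
  filter_upwards [hae] with p hp
  exact max_eq_right_iff.1 hp

/-! ### Vanishing of the source on the zero set of the solution -/

/-- Small bounded functions whose derivatives approximate the indicator function of `{0}`. -/
theorem exists_small_renormalization {ε : ℝ} (hε : 0 < ε) :
    ∃ b : ℝ → ℝ, (∀ s, HasDerivAt b (1 / (1 + (s / ε) ^ 2)) s) ∧ LipschitzWith 1 b ∧ b 0 = 0 ∧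
      (∀ s, |b s| ≤ 2 * ε) ∧ ∀ s, |1 / (1 + (s / ε) ^ 2) * s| ≤ ε := by
  -- The scaled arctangent has size `O(ε)` while its slope at `0` stays equal to `1`; the constant
  -- `2` in the bound comes from `π / 2 ≤ 2`.
  have hd : ∀ s, HasDerivAt (fun s => ε * Real.arctan (s / ε)) (1 / (1 + (s / ε) ^ 2)) s := by
    intro s
    have h1 : HasDerivAt (fun s : ℝ => s / ε) (1 / ε) s := (hasDerivAt_id s).div_const ε
    have := (h1.arctan).const_mul ε
    refine this.congr_deriv ?_
    field_simp
  refine ⟨_, hd, ?_, by simp, fun s => ?_, fun s => ?_⟩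
  · refine lipschitzWith_of_nnnorm_deriv_le (fun s => (hd s).differentiableAt) fun s => ?_
    rw [(hd s).deriv, ← NNReal.coe_le_coe, coe_nnnorm, Real.norm_of_nonneg (by positivity)]
    refine div_le_one_of_le₀ ?_ (by positivity)
    nlinarith [sq_nonneg (s / ε)]
  · rw [abs_mul, abs_of_pos hε, mul_comm]
    refine mul_le_mul_of_nonneg_right ?_ hε.le
    rw [abs_le]
    have := Real.pi_le_four
    constructor
    · linarith [Real.neg_pi_div_two_lt_arctan (s / ε)]
    · linarith [Real.arctan_lt_pi_div_two (s / ε)]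
  · rw [abs_mul, abs_of_pos (by positivity), div_mul_eq_mul_div, one_mul,
      div_le_iff₀ (by positivity)]
    have h1 : |s| = ε * |s / ε| := by
      rw [abs_div, abs_of_pos hε, mul_div_cancel₀ _ hε.ne']
    rw [h1]
    refine mul_le_mul_of_nonneg_left ?_ hε.le
    nlinarith [sq_nonneg (|s / ε| - 1), sq_abs (s / ε), abs_nonneg (s / ε)]

theorem tendsto_small_renormalization_deriv (s : ℝ) :
    Tendsto (fun ε : ℝ => 1 / (1 + (s / ε) ^ 2)) (𝓝[>] 0)
      (𝓝 (({0} : Set ℝ).indicator (fun _ => 1) s)) := by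
  by_cases hs : s = 0
  · simp [hs]
  · rw [indicator_of_notMem (by simpa using hs)]
    have h1 : Tendsto (fun ε : ℝ => (s / ε) ^ 2) (𝓝[>] 0) atTop := by
      have h2 : Tendsto (fun ε : ℝ => (|s| * ε⁻¹) ^ 2) (𝓝[>] 0) atTop :=
        (tendsto_pow_atTop two_ne_zero).comp
          (tendsto_inv_nhdsGT_zero.const_mul_atTop (abs_pos.2 hs))
      refine h2.congr fun ε => ?_
      rw [mul_pow, sq_abs, ← mul_pow, div_eq_mul_inv]
    exact (tendsto_const_nhds (x := (1 : ℝ))).div_atTop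
      (tendsto_atTop_add_const_left _ 1 h1)

/-- In the equation renormalized with `ε arctan(s/ε)`, every term but the source is `O(ε)`, since
both `b(w)` and `w b'(w)` are. The source term converges by dominated convergence to the integral
over `{w = 0}`. -/
theorem TransportSolution.integral_indicator_mul_eq_zero {T : ℝ} (hT : 0 < T)
    {w g : ℝ × E3 → ℝ} {U : ℝ × E3 → E3} {G : ℝ × E3 → E3 →L[ℝ] E3} {w₀ : E3 → ℝ}
    (h : TransportSolution T w g U G w₀) {φ : ℝ × E3 → ℝ} (hφ : ContDiff ℝ ∞ φ)
    (hφc : HasCompactSupport φ) (hφ0 : ∀ x, φ (0, x) = 0) (hφT : ∀ x, φ (T, x) = 0) :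
    ∫ p, ({0} : Set ℝ).indicator (fun _ => 1) (w p) * (g p * φ p)
      ∂((volume.restrict (Ioo 0 T)).prod volume) = 0 := by
  set μ : Measure (ℝ × E3) := (volume.restrict (Ioo 0 T)).prod volume with hμ
  obtain ⟨c, hc0, hc⟩ := exists_abs_traceCLM_le
  have hwm := h.measurable_w
  have hgm := h.measurable_g
  have hUm := h.measurable_U
  have hGm := h.measurable_G
  have hφm : Measurable φ := hφ.continuous.measurable
  have hdc : Continuous (fderiv ℝ φ) := hφ.continuous_fderiv (by simp)
  have hdm : Measurable (fderiv ℝ φ) := hdc.measurable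
  have hφ2 : MemLp φ 2 μ := memLp_of_continuous_compact hφ.continuous hφc
  have hd2 : MemLp (fun p => ‖fderiv ℝ φ p‖) 2 μ :=
    memLp_of_continuous_compact hdc.norm (hφc.fderiv ℝ).norm
  have hgφ : Integrable (fun p => g p * φ p) μ :=
    integrable_mul_of_continuous_compact h.memLp_g hφ.continuous hφc
  set A : ℝ × E3 → ℝ := fun p =>
    fderiv ℝ φ p (1, 0) + fderiv ℝ φ p (0, U p) + φ p * traceCLM (G p) with hA
  have hGφ : Integrable (fun p => φ p * traceCLM (G p)) μ := by
    refine integrable_of_enorm_le_mul (hφ2.const_mul c) h.memLp_G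
      (Measurable.aestronglyMeasurable (by fun_prop)) fun p => ?_
    rw [norm_mul, norm_mul, Real.norm_of_nonneg hc0, mul_comm c, mul_assoc]
    exact mul_le_mul_of_nonneg_left (hc _) (norm_nonneg _)
  have hUφ : Integrable (fun p => fderiv ℝ φ p (0, U p)) μ := by
    refine integrable_of_enorm_le_mul hd2 h.memLp_U
      (isBoundedBilinearMap_apply.continuous.measurable.comp
        (hdm.prodMk (measurable_const.prodMk hUm))).aestronglyMeasurable fun p => ?_
    rw [norm_norm]
    refine ((fderiv ℝ φ p).le_opNorm _).trans (mul_le_mul_of_nonneg_left ?_ (norm_nonneg _))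
    simp [Prod.norm_def]
  have htφ : Integrable (fun p => fderiv ℝ φ p (1, 0)) μ :=
    (hdc.clm_apply continuous_const).integrable_of_hasCompactSupport
      ((hφc.fderiv ℝ).comp_left (g := fun L : ℝ × E3 →L[ℝ] ℝ => L (1, 0)) (by simp))
  have hAi : Integrable A μ := (htφ.add hUφ).add hGφ
  set K : ℝ := 2 * (∫ p, |A p| ∂μ) + ∫ p, |φ p * traceCLM (G p)| ∂μ with hK
  have hbound : ∀ ε : ℝ, 0 < ε →
      |∫ p, 1 / (1 + (w p / ε) ^ 2) * (g p * φ p) ∂μ| ≤ ε * K := by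
    intro ε hε
    obtain ⟨b, hb, hL, hb0, hbε, hbw⟩ := exists_small_renormalization hε
    have hb'c : Continuous fun s : ℝ => 1 / (1 + (s / ε) ^ 2) :=
      Continuous.div (by fun_prop) (by fun_prop) fun s => by positivity
    have hR := h.renormalized hT hb hb'c hL hb0 hφ hφc hφT
    simp only [hφ0, mul_zero, integral_zero, neg_zero] at hR
    have hb'm := hb'c.measurable
    have hbm := hL.continuous.measurable
    have hb'1 : ∀ s : ℝ, ‖1 / (1 + (s / ε) ^ 2)‖ ≤ 1 := fun s => by
      rw [Real.norm_of_nonneg (by positivity)]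
      exact div_le_one_of_le₀ (by nlinarith [sq_nonneg (s / ε)]) (by positivity)
    have j1 : Integrable (fun p => b (w p) * A p) μ :=
      hAi.bdd_mul (hbm.comp hwm).aestronglyMeasurable (Eventually.of_forall fun p => hbε _)
    have j2 : Integrable (fun p => 1 / (1 + (w p / ε) ^ 2) * w p * (φ p * traceCLM (G p))) μ :=
      hGφ.bdd_mul (((hb'm.comp hwm).mul hwm)).aestronglyMeasurable
        (Eventually.of_forall fun p => hbw _)
    have j3 : Integrable (fun p => 1 / (1 + (w p / ε) ^ 2) * (g p * φ p)) μ :=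
      hgφ.bdd_mul (hb'm.comp hwm).aestronglyMeasurable (Eventually.of_forall fun p => hb'1 _)
    have j12 : Integrable (fun p => b (w p) * A p -
        1 / (1 + (w p / ε) ^ 2) * w p * (φ p * traceCLM (G p))) μ := j1.sub j2
    have j : Integrable (fun p => b (w p) * A p -
        1 / (1 + (w p / ε) ^ 2) * w p * (φ p * traceCLM (G p)) -
        1 / (1 + (w p / ε) ^ 2) * (g p * φ p)) μ := j12.sub j3
    have hsum : ∫ p, (b (w p) * A p -
        1 / (1 + (w p / ε) ^ 2) * w p * (φ p * traceCLM (G p)) -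
        1 / (1 + (w p / ε) ^ 2) * (g p * φ p)) ∂μ = 0 := by
      rw [← hR, hμ, integral_prod _ j]
      refine integral_congr_ae (Eventually.of_forall fun t => ?_)
      refine integral_congr_ae (Eventually.of_forall fun x => ?_)
      simp only [hA]
      ring
    rw [integral_sub j12 j3, integral_sub j1 j2, sub_eq_zero] at hsum
    rw [← hsum]
    refine (abs_sub _ _).trans ?_
    have k1 : |∫ p, b (w p) * A p ∂μ| ≤ 2 * ε * ∫ p, |A p| ∂μ := by
      rw [← integral_const_mul]
      refine (abs_integral_le_integral_abs).trans
        (integral_mono j1.abs (hAi.abs.const_mul _) fun p => ?_)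
      dsimp only
      rw [abs_mul]
      exact mul_le_mul_of_nonneg_right (hbε _) (abs_nonneg _)
    have k2 : |∫ p, 1 / (1 + (w p / ε) ^ 2) * w p * (φ p * traceCLM (G p)) ∂μ| ≤
        ε * ∫ p, |φ p * traceCLM (G p)| ∂μ := by
      rw [← integral_const_mul]
      refine (abs_integral_le_integral_abs).trans
        (integral_mono j2.abs (hGφ.abs.const_mul _) fun p => ?_)
      dsimp only
      rw [abs_mul]
      exact mul_le_mul_of_nonneg_right (hbw _) (abs_nonneg _)
    calc _ ≤ 2 * ε * (∫ p, |A p| ∂μ) + ε * ∫ p, |φ p * traceCLM (G p)| ∂μ := add_le_add k1 k2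
      _ = _ := by rw [hK]; ring
  have hlim : Tendsto (fun ε : ℝ => ∫ p, 1 / (1 + (w p / ε) ^ 2) * (g p * φ p) ∂μ) (𝓝[>] 0)
      (𝓝 (∫ p, ({0} : Set ℝ).indicator (fun _ => 1) (w p) * (g p * φ p) ∂μ)) := by
    refine tendsto_integral_filter_of_dominated_convergence (fun p => ‖g p * φ p‖)
      (Eventually.of_forall fun ε => ?_) (Eventually.of_forall fun ε => ?_) hgφ.norm
      (Eventually.of_forall fun p => (tendsto_small_renormalization_deriv (w p)).mul_const _)
    · exact Measurable.aestronglyMeasurable (by fun_prop)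
    · refine Eventually.of_forall fun p => ?_
      rw [norm_mul]
      refine mul_le_of_le_one_left (norm_nonneg _) ?_
      rw [Real.norm_of_nonneg (by positivity)]
      exact div_le_one_of_le₀ (by nlinarith [sq_nonneg (w p / ε)]) (by positivity)
  refine tendsto_nhds_unique hlim (squeeze_zero_norm' (a := fun ε : ℝ => ε * K) ?_ ?_)
  · filter_upwards [self_mem_nhdsWithin] with ε hε
    exact hbound ε hε
  · have : Tendsto (fun ε : ℝ => ε * K) (𝓝 0) (𝓝 (0 * K)) := tendsto_id.mul_const _
    rw [zero_mul] at this
    exact this.mono_left nhdsWithin_le_nhds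

/-- The transport analogue of the fact that a Sobolev function has zero gradient a.e. on its zero
set. -/
theorem TransportSolution.ae_eq_zero_of_eq_zero {T : ℝ} (hT : 0 < T) {Ω : Set E3}
    (hΩo : IsOpen Ω) (hΩb : Bornology.IsBounded Ω) {w g : ℝ × E3 → ℝ} {U : ℝ × E3 → E3}
    {G : ℝ × E3 → E3 →L[ℝ] E3} {w₀ : E3 → ℝ} (h : TransportSolution T w g U G w₀)
    (hgz : ∀ t, ∀ x ∉ Ω, g (t, x) = 0) :
    ∀ᵐ p ∂(volume.restrict (cylinder T Ω)), w p = 0 → g p = 0 := by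
  have hco : IsOpen (cylinder T Ω) := isOpen_Ioo.prod hΩo
  have hgi := integrable_of_memLp_of_eq_zero hΩo.measurableSet hΩb h.memLp_g hgz
  have hgc : IntegrableOn g (cylinder T Ω) := by
    have := hgi.restrict (s := (univ : Set ℝ) ×ˢ Ω)
    rwa [prod_restrict_univ_prod] at this
  have hS : MeasurableSet {p | w p = 0} := h.measurable_w (measurableSet_singleton 0)
  have e : ∀ p, {p | w p = 0}.indicator g p = ({0} : Set ℝ).indicator (fun _ => 1) (w p) * g p :=
    fun p => by
      by_cases hp : w p = 0 <;> simp [hp]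
  have key := hco.ae_eq_zero_of_integral_contDiff_smul_eq_zero (μ := volume)
    (f := {p | w p = 0}.indicator g)
    (IntegrableOn.locallyIntegrableOn (hgc.indicator hS)) fun φ hφ hφc hφs => by
      have hφt : IsTestFunction (cylinder T Ω) φ := ⟨hφ, hφc, hφs⟩
      have h0 := h.integral_indicator_mul_eq_zero hT hφ hφc
        (fun x => hφt.eq_zero_of_notMem fun hn => lt_irrefl _ hn.1.1)
        (fun x => hφt.eq_zero_of_notMem fun hn => lt_irrefl _ hn.1.2)
      rw [← integral_cylinder_eq (Ω := Ω) (fun t x hx => by simp [hgz t x hx])] at h0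
      refine Eq.trans ?_ h0
      rw [← setIntegral_eq_integral_of_forall_compl_eq_zero (s := cylinder T Ω)
        (fun p hp => by rw [hφt.eq_zero_of_notMem hp, zero_smul])]
      refine integral_congr_ae (Eventually.of_forall fun p => ?_)
      dsimp only
      rw [e, smul_eq_mul]
      ring
  rw [ae_restrict_iff' hco.measurableSet]
  filter_upwards [key] with p hp hpc hw
  have := hp hpc
  rwa [indicator_of_mem (by exact hw)] at this

/-! ### Recovering the bounds on the initial value -/

/-- Near a given point, shrinking nonnegative bumps are admissible tests. Their averages are
nonnegative and converge a.e. to `f`, after truncating `f` to a closed ball in `Ω` to make it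
globally integrable. -/
theorem ae_nonneg_of_forall_integral_test_nonneg {Ω : Set E3} (hΩo : IsOpen Ω) {f : E3 → ℝ}
    (hf : LocallyIntegrableOn f Ω) (h : ∀ ψ : E3 → ℝ, IsTestFunction Ω ψ → (∀ x, 0 ≤ ψ x) →
      0 ≤ ∫ x in Ω, f x * ψ x) : ∀ᵐ x ∂(volume.restrict Ω), 0 ≤ f x := by
  rw [ae_restrict_iff' hΩo.measurableSet, ae_iff]
  simp only [Classical.not_imp, not_le]
  refine measure_null_of_locally_null _ fun x hx => ?_
  obtain ⟨r, hr0, hr⟩ := Metric.nhds_basis_closedBall.mem_iff.1 (hΩo.mem_nhds hx.1)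
  refine ⟨_, inter_mem_nhdsWithin _ (Metric.ball_mem_nhds x hr0), ?_⟩
  set g : E3 → ℝ := (Metric.closedBall x r).indicator f with hg
  have hgi : Integrable g volume := by
    rw [hg, integrable_indicator_iff Metric.isClosed_closedBall.measurableSet]
    exact hf.integrableOn_compact_subset hr (isCompact_closedBall x r)
  let φ : ℕ → ContDiffBump (0 : E3) := fun n =>
    ⟨1 / (n + 1 : ℝ), 2 * (1 / (n + 1 : ℝ)), by positivity, by
      have : 0 < 1 / (n + 1 : ℝ) := by positivity
      linarith⟩
  have hφr : Tendsto (fun n => (φ n).rOut) atTop (𝓝 0) := by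
    have := (tendsto_one_div_add_atTop_nhds_zero_nat (𝕜 := ℝ)).const_mul 2
    rw [mul_zero] at this
    exact this
  have hae := ContDiffBump.ae_convolution_tendsto_right_of_locallyIntegrable (μ := volume)
    (φ := φ) (l := atTop) (K := 2) hφr (Eventually.of_forall fun n => le_rfl)
    hgi.locallyIntegrable
  refine measure_mono_null (fun y hy => ?_) (ae_iff.1 hae)
  intro hlim
  have hyb : y ∈ Metric.ball x r := hy.2
  have hgy : g y = f y := indicator_of_mem (Metric.ball_subset_closedBall hyb) _
  have hneg : f y < 0 := hy.1.2
  rw [hgy] at hlim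
  refine absurd hneg (not_lt.2 (ge_of_tendsto hlim ?_))
  have hd : 0 < r - dist y x := sub_pos.2 hyb
  filter_upwards [hφr.eventually_lt_const hd] with n hn
  rw [convolution_eq_swap]
  have hsupp : tsupport (fun z => (φ n).normed volume (y - z)) ⊆ Metric.closedBall y (φ n).rOut := by
    refine closure_minimal (fun z hz => ?_) Metric.isClosed_closedBall
    have hz' : y - z ∈ Function.support ((φ n).normed volume) := hz
    rw [ContDiffBump.support_normed_eq, Metric.mem_ball, dist_zero_right] at hz'
    rw [Metric.mem_closedBall, dist_comm, dist_eq_norm]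
    exact hz'.le
  have hball : Metric.closedBall y (φ n).rOut ⊆ Metric.closedBall x r :=
    Metric.closedBall_subset_closedBall' (by linarith)
  have hψ : IsTestFunction Ω fun z => (φ n).normed volume (y - z) :=
    ⟨(φ n).contDiff_normed.comp (contDiff_const.sub contDiff_id),
      (isCompact_closedBall y _).of_isClosed_subset (isClosed_tsupport _) hsupp,
      hsupp.trans (hball.trans hr)⟩
  refine (h _ hψ fun z => (φ n).nonneg_normed _).trans (le_of_eq ?_)
  rw [setIntegral_eq_integral_of_forall_compl_eq_zero
    (fun z hz => by rw [hψ.eq_zero_of_notMem hz, mul_zero])]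
  refine integral_congr_ae (Eventually.of_forall fun z => ?_)
  simp only [ContinuousLinearMap.lsmul_apply, smul_eq_mul]
  by_cases hz : z ∈ Metric.closedBall x r
  · rw [hg, indicator_of_mem hz, mul_comm]
  · have : (φ n).normed volume (y - z) = 0 := by
      by_contra hn
      exact hz (hball (hsupp (subset_tsupport _ hn)))
    rw [this]; simp

/-- The primitive is continuous at `0`, and a property valid a.e. holds at times arbitrarily close
to `0`; closedness of `S` passes it to the limit. -/
theorem mem_of_ae_primitive_mem {T : ℝ} (hT : 0 < T) {F : ℝ → ℝ} (hF : IntegrableOn F (Ioo 0 T))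
    {c : ℝ} {S : Set ℝ} (hS : IsClosed S)
    (h : ∀ᵐ t ∂(volume.restrict (Ioo 0 T)), c + ∫ s in (0 : ℝ)..t, F s ∈ S) : c ∈ S := by
  have hFi : IntegrableOn F (uIcc 0 T) := by
    rwa [uIcc_of_le hT.le, integrableOn_Icc_iff_integrableOn_Ioo]
  have hcont := intervalIntegral.continuousOn_primitive_interval hFi 0 left_mem_uIcc
  have hlim : Tendsto (fun t => c + ∫ s in (0 : ℝ)..t, F s) (𝓝[Ioo 0 T] 0) (𝓝 c) := by
    have h1 : Tendsto (fun t => ∫ s in (0 : ℝ)..t, F s) (𝓝[Ioo 0 T] 0) (𝓝 0) := by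
      have : Tendsto _ _ _ := hcont.mono (t := uIcc 0 T) (s := Ioo 0 T) (by
        rw [uIcc_of_le hT.le]; exact Ioo_subset_Icc_self)
      simpa using this
    simpa using h1.const_add c
  rw [nhdsWithin_Ioo_eq_nhdsGT hT] at hlim
  refine hS.mem_of_frequently_of_tendsto (fun hev => ?_) hlim
  obtain ⟨d, hd0, hd⟩ := mem_nhdsGT_iff_exists_Ioo_subset.1 hev
  have hm : 0 < min d T := lt_min hd0 hT
  rw [ae_restrict_iff' measurableSet_Ioo] at h
  have h0 : volume (Ioo 0 (min d T)) = 0 := by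
    refine measure_mono_null (fun t ht => ?_) (ae_iff.1 h)
    intro hn
    exact hd ⟨ht.1, ht.2.trans_le (min_le_left _ _)⟩
      (hn ⟨ht.1, ht.2.trans_le (min_le_right _ _)⟩)
  rw [Real.volume_Ioo, ENNReal.ofReal_eq_zero] at h0
  linarith

/-- Bounds on the density are inherited by the initial value. -/
theorem ZeroExtension.initial_bounds {T : ℝ} (hT : 0 < T) {Ω : Set E3} (hΩo : IsOpen Ω)
    {ρ : ℝ → E3 → ℝ} {u : ℝ → E3 → E3} {R : ℝ × E3 → ℝ}
    {U : ℝ × E3 → E3} {G : ℝ × E3 → E3 →L[ℝ] E3} (h : ZeroExtension T Ω ρ u R U G)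
    {r : E3 → ℝ} (hr : IsC1OnClosure Ω r) {ρ₀ : E3 → ℝ} (hρ₀ : LocallyIntegrableOn ρ₀ Ω)
    (hc : SolvesContinuityEquation T Ω ρ u ρ₀)
    (hb : ∀ᵐ p ∂(volume.restrict (cylinder T Ω)), 0 ≤ ρ p.1 p.2 ∧ ρ p.1 p.2 ≤ r p.2) :
    ∀ᵐ x ∂(volume.restrict Ω), 0 ≤ ρ₀ x ∧ ρ₀ x ≤ r x := by
  have hΩ := hΩo.measurableSet
  have hrl : LocallyIntegrableOn r Ω := hr.1.continuousOn.locallyIntegrableOn hΩ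
  have key : ∀ ψ : E3 → ℝ, IsTestFunction Ω ψ → (∀ x, 0 ≤ ψ x) →
      ∫ x in Ω, ρ₀ x * ψ x ∈ Icc 0 (∫ x in Ω, r x * ψ x) := by
    intro ψ hψ hψ0
    have hψ2 : MemLp ψ 2 volume := memLp_of_smooth hψ.smooth.continuous hψ.compact_support
    have hψd : Continuous (fderiv ℝ ψ) := hψ.smooth.continuous_fderiv (by simp)
    obtain ⟨M, hM⟩ := (hψ.compact_support.fderiv ℝ).exists_bound_of_continuous hψd
    have hψp : MemLp (fun p : ℝ × E3 => ψ p.2) 2 ((volume.restrict (Ioo 0 T)).prod volume) :=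
      hψ2.comp_snd _
    have i1 : Integrable (fun p => R p * ψ p.2) ((volume.restrict (Ioo 0 T)).prod volume) :=
      h.memLp_R.integrable_mul hψp
    have i2 := integrable_mul_apply_of_bounded h.memLp_R h.memLp_U
      (hψd.measurable.comp measurable_snd) (fun p => hM p.2)
    -- The weak formulation with tests `χ ψ` says that `t ↦ ∫ R ψ` is a.e. a primitive starting from
    -- `∫ ρ₀ ψ`, so bounds valid for a.e. time reach the initial value.
    have hprim := ae_eq_primitive_of_weak_deriv hT i1.integral_prod_left i2.integral_prod_left
      fun χ hχ => h.weak hΩ hc hχ hψ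
    refine mem_of_ae_primitive_mem hT i2.integral_prod_left isClosed_Icc ?_
    have hbR := hb.and h.R_eq
    rw [volume_restrict_cylinder] at hbR
    filter_upwards [hprim, Measure.ae_ae_of_ae_prod hbR,
      ae_memLp_slice h.measurable_R h.memLp_R] with t h1 h2 h3
    rw [← h1, ← setIntegral_eq_integral_of_forall_compl_eq_zero (μ := volume) (s := Ω)
      (f := fun x => R (t, x) * ψ x) (fun x hx => by rw [hψ.eq_zero_of_notMem hx, mul_zero])]
    constructor
    · refine integral_nonneg_of_ae ?_
      filter_upwards [h2] with x hx
      rw [hx.2]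
      exact mul_nonneg hx.1.1 (hψ0 x)
    · refine integral_mono_ae (h3.integrable_mul hψ2).restrict
        (integrable_mul_of_locallyIntegrableOn hrl hψ.smooth.continuous hψ.compact_support
          hψ.support_subset).restrict ?_
      filter_upwards [h2] with x hx
      rw [hx.2]
      exact mul_le_mul_of_nonneg_right hx.1.2 (hψ0 x)
  have h1 := ae_nonneg_of_forall_integral_test_nonneg hΩo hρ₀ fun ψ hψ hψ0 => (key ψ hψ hψ0).1
  have h2 := ae_nonneg_of_forall_integral_test_nonneg hΩo (hrl.sub hρ₀) fun ψ hψ hψ0 => by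
    have hi : ∀ {f : E3 → ℝ}, LocallyIntegrableOn f Ω →
        Integrable (fun x => f x * ψ x) (volume.restrict Ω) := fun hf =>
      (integrable_mul_of_locallyIntegrableOn hf hψ.smooth.continuous hψ.compact_support
        hψ.support_subset).restrict
    simp only [Pi.sub_apply, sub_mul]
    rw [integral_sub (hi hrl) (hi hρ₀), sub_nonneg]
    exact (key ψ hψ hψ0).2
  filter_upwards [h1, h2] with x hx1 hx2
  exact ⟨hx1, sub_nonneg.1 hx2⟩

/-! ### Assembly of the equivalence -/

/-- The extended density solves the transport problem on the whole space. -/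
theorem ZeroExtension.exists_transportSolution {T : ℝ} {Ω : Set E3} (hΩo : IsOpen Ω)
    (hΩb : Bornology.IsBounded Ω) (hΩL : HasLipschitzBoundary Ω) {ρ : ℝ → E3 → ℝ}
    {u : ℝ → E3 → E3} {R : ℝ × E3 → ℝ} {U : ℝ × E3 → E3} {G : ℝ × E3 → E3 →L[ℝ] E3}
    (h : ZeroExtension T Ω ρ u R U G) {r : E3 → ℝ} (hr : IsC1OnClosure Ω r) {ρ₀ : E3 → ℝ}
    (hρ₀ : LocallyIntegrableOn ρ₀ Ω) (hc : SolvesContinuityEquation T Ω ρ u ρ₀)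
    (hb : ∀ᵐ x ∂(volume.restrict Ω), 0 ≤ ρ₀ x ∧ ρ₀ x ≤ r x) :
    ∃ w₀ : E3 → ℝ, TransportSolution T R 0 U G w₀ ∧ (∀ x ∉ Ω, w₀ x = 0) ∧
      w₀ =ᵐ[volume.restrict Ω] ρ₀ := by
  have hΩ := hΩo.measurableSet
  -- The bounds on `ρ₀` upgrade it from locally integrable to square integrable, as a transport
  -- solution requires.
  have hm : MemLp ρ₀ 2 (volume.restrict Ω) := by
    refine MemLp.of_le ((hr.memLp_indicator hΩ hΩb).restrict Ω) hρ₀.aestronglyMeasurable ?_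
    filter_upwards [hb, ae_restrict_mem hΩ] with x hx hxΩ
    rw [indicator_of_mem hxΩ, Real.norm_of_nonneg hx.1,
      Real.norm_of_nonneg (hx.1.trans hx.2)]
    exact hx.2
  obtain ⟨w₀, h1, h2, h3, h4⟩ := exists_measurable_zero_extension hΩ hm
  refine ⟨w₀, transportSolution_of_interior hΩo hΩb hΩL h.measurable_R h.measurable_U
    h.measurable_G h1 h.memLp_R h.memLp_U h.memLp_G h2 ?_ h.R_zero h.U_zero h3
    fun χ hχ ψ hψ => ?_, h3, h4⟩
  · filter_upwards [h.isW012] with t ht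
    exact ht.isH1 hΩ (h.U_zero t) (h.G_zero t)
  · refine Eq.trans ?_ (h.weak hΩ hc hχ hψ)
    congr 2
    rw [← setIntegral_eq_integral_of_forall_compl_eq_zero (μ := volume) (s := Ω)
      (f := fun x => w₀ x * ψ x) (fun x hx => by rw [hψ.eq_zero_of_notMem hx, mul_zero])]
    refine integral_congr_ae ?_
    filter_upwards [h4] with x hx
    rw [hx]

end Congestion

theorem lemma4p1 (T : ℝ) (hT : 0 < T) (Ω : Set Congestion.E3)
    (hΩo : IsOpen Ω) (hΩb : Bornology.IsBounded Ω) (hΩL : Congestion.HasLipschitzBoundary Ω)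
    (ρstar : Congestion.E3 → ℝ) (hρstar : Congestion.IsC1OnClosure Ω ρstar)
    (hρstar_pos : ∀ x ∈ Ω, 0 < ρstar x)
    (u : ℝ → Congestion.E3 → Congestion.E3) (hu : Congestion.MemL2W012 T Ω u)
    (ρ : ℝ → Congestion.E3 → ℝ)
    (hρ : MemLp (fun p : ℝ × Congestion.E3 => ρ p.1 p.2) 2
      (volume.restrict (Congestion.cylinder T Ω)))
    (ρ₀ : Congestion.E3 → ℝ) (hρ₀ : LocallyIntegrableOn ρ₀ Ω)
    (hcont : Congestion.SolvesContinuityEquation T Ω ρ u ρ₀) :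
    ((∃ g : ℝ → Congestion.E3 → ℝ,
        Congestion.HasWeakDivergence T Ω (fun t x => ρstar x • u t x) g ∧
        ∀ᵐ p ∂(volume.restrict (Congestion.cylinder T Ω)),
          ρstar p.2 ≤ ρ p.1 p.2 → g p.1 p.2 = 0) ∧
      (∀ᵐ x ∂(volume.restrict Ω), 0 ≤ ρ₀ x ∧ ρ₀ x ≤ ρstar x))
    ↔ (∀ᵐ p ∂(volume.restrict (Congestion.cylinder T Ω)),
        0 ≤ ρ p.1 p.2 ∧ ρ p.1 p.2 ≤ ρstar p.2) := by
  have hΩ := hΩo.measurableSet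
  obtain ⟨R, U, G, h⟩ := Congestion.exists_zeroExtension hΩ hu hρ
  set r : Congestion.E3 → ℝ := Ω.indicator ρstar with hrdef
  set g₀ : ℝ × Congestion.E3 → ℝ := Congestion.divergenceDensity Ω ρstar U G with hg₀
  have hg₀z : ∀ t, ∀ x ∉ Ω, g₀ (t, x) = 0 := h.divergenceDensity_zero
  have hdiv := h.hasWeakDivergence hΩo hΩb hρstar
  -- the difference of the density and the threshold
  have hsub : ∀ w₀ : Congestion.E3 → ℝ, Congestion.TransportSolution T R 0 U G w₀ →
      Congestion.TransportSolution T (fun p => R p - r p.2) g₀ U G (fun x => w₀ x - r x) :=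
    fun w₀ hw => hw.sub_stationary hT (hρstar.measurable_indicator hΩ) (hρstar.memLp_indicator hΩ hΩb)
      (h.measurable_divergenceDensity hΩ hρstar) (h.memLp_divergenceDensity hΩ hΩb hρstar) (by
        filter_upwards [h.integral_indicator_mul_fderiv hΩo hΩb hρstar] with t ht ψ hψ
        exact ht ψ (hψ.smooth.of_le (by exact_mod_cast le_top)) hψ.compact_support)
  have hinit : ∀ {P : Congestion.E3 → Prop}, (∀ᵐ x ∂(volume.restrict Ω), P x) → (∀ x ∉ Ω, P x) →
      ∀ᵐ x ∂(volume : Measure Congestion.E3), P x := fun h1 h2 => by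
    rw [ae_restrict_iff' hΩ] at h1
    filter_upwards [h1] with x hx
    by_cases hxΩ : x ∈ Ω
    exacts [hx hxΩ, h2 x hxΩ]
  have hto : ∀ {P : ℝ × Congestion.E3 → Prop},
      (∀ᵐ p ∂((volume.restrict (Ioo 0 T)).prod (volume : Measure Congestion.E3)), P p) →
      ∀ᵐ p ∂(volume.restrict (Congestion.cylinder T Ω)), P p := fun h1 => by
    rw [← Congestion.prod_restrict_univ_prod]
    exact ae_restrict_of_ae h1
  have hfrom : ∀ {P : ℝ × Congestion.E3 → Prop},
      (∀ᵐ p ∂(volume.restrict (Congestion.cylinder T Ω)), P p) → (∀ t, ∀ x ∉ Ω, P (t, x)) →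
      ∀ᵐ p ∂((volume.restrict (Ioo 0 T)).prod (volume : Measure Congestion.E3)), P p :=
    fun h1 h2 => by
      rw [← Congestion.prod_restrict_univ_prod,
        ae_restrict_iff' (MeasurableSet.univ.prod hΩ)] at h1
      filter_upwards [h1] with p hp
      by_cases hpΩ : p.2 ∈ Ω
      exacts [hp ⟨mem_univ _, hpΩ⟩, h2 p.1 p.2 hpΩ]
  constructor
  · rintro ⟨⟨g, hg, hgz⟩, hb⟩
    obtain ⟨w₀, hw, hw₀z, hw₀⟩ :=
      h.exists_transportSolution hΩo hΩb hΩL hρstar hρ₀ hcont hb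
    -- Lower bound: comparison for `-R`, which has zero source and nonpositive initial value.
    have hlow := hw.neg.ae_nonpos hT hΩ hΩb (fun t x hx => by simp [h.R_zero t x hx]) h.G_zero
      (hinit (by
        filter_upwards [hw₀, hb] with x h1 h2
        rw [h1]
        linarith [h2.1]) fun x hx => by simp [hw₀z x hx])
      (Eventually.of_forall fun p _ => rfl)
    -- Upper bound: comparison for `R - r`. Where it is positive, `ρ > ρ*`, so the given divergence
    -- vanishes there, and it agrees a.e. with `g₀`.
    have hup := (hsub w₀ hw).ae_nonpos hT hΩ hΩb
      (fun t x hx => by simp [hrdef, h.R_zero t x hx, hx]) h.G_zero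
      (hinit (by
        filter_upwards [hw₀, hb, ae_restrict_mem hΩ] with x h1 h2 h3
        rw [h1, hrdef, indicator_of_mem h3]
        linarith [h2.2]) fun x hx => by simp [hw₀z x hx, hrdef, hx])
      (hfrom (by
        filter_upwards [hdiv.ae_eq hΩo hg, hgz, h.R_eq, Congestion.ae_prod_mem hΩ]
          with p h1 h2 h3 h4 h5
        rw [h3, hrdef, indicator_of_mem h4.2, sub_pos] at h5
        exact h1.trans (h2 h5.le)) fun t x hx _ => hg₀z t x hx)
    filter_upwards [hto hlow, hto hup, h.R_eq, Congestion.ae_prod_mem hΩ] with p h1 h2 h3 h4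
    rw [h3, hrdef, indicator_of_mem h4.2] at h2
    rw [h3] at h1
    constructor <;> linarith
  · intro hb
    have hb₀ := h.initial_bounds hT hΩo hρstar hρ₀ hcont hb
    obtain ⟨w₀, hw, hw₀z, hw₀⟩ :=
      h.exists_transportSolution hΩo hΩb hΩL hρstar hρ₀ hcont hb₀
    refine ⟨⟨fun t x => g₀ (t, x), hdiv, ?_⟩, hb₀⟩
    -- Under (ii), `ρ ≥ ρ*` forces `ρ = ρ*`, so the point lies in the zero set of `R - r`.
    filter_upwards [(hsub w₀ hw).ae_eq_zero_of_eq_zero hT hΩo hΩb hg₀z, hb, h.R_eq,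
      Congestion.ae_prod_mem hΩ] with p h1 h2 h3 h4 h5
    refine h1 ?_
    rw [h3, hrdef, indicator_of_mem h4.2]
    linarith [h2.2]
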